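/- Let $A=(a_1\,\cdots\,a_n)\in\mathbb{Z}^{d\times n}$ be a matrix of rank $d$, let $\mathbb{Z}A\subseteq\mathbb{Z}^d$ be the lattice generated by its columns, and for $\beta\in\mathbb{C}^d$ let $\mathcal{M}_A(\beta)=\mathcal{D}/\mathcal{D}H_A(\beta)$ be the hypergeometric $\mathcal{D}$-module on $X=\mathbb{C}^n$, where $H_A(\beta)$ is the left ideal of the Weyl algebra generated by $\partial^{u_+}-\partial^{u_-}$ ($u\in\mathbb{Z}^n$, $Au=0$) and $\sum_j a_{ij}x_j\partial_j-\beta_i$ ($1\le i\le d$). For $\tau\subseteq\{1,\dots,n\}$ put $Y_\tau=\{x\in\mathbb{C}^n: x_i=0 \text{ for } i\notin\tau\}$, let $\Delta_\tau$ be the convex hull of $\{0\}\cup\{a_i:i\in\tau\}$, and let $\operatorname{vol}_{\mathbb{Z}A}(\Delta_\tau)=d!\operatorname{vol}(\Delta_\tau)/[\mathbb{Z}^d:\mathbb{Z}A]$. At $p\in Y_\tau$, let $\mathcal{O}_{\widehat{X|Y_\tau},p}$ be the space of formal series $f=\sum_{\alpha} f_\alpha(x_\tau)x_{\overline\tau}^\alpha$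 ($\alpha\in\mathbb{N}^{\overline\tau}$, $\overline\tau=\{1,\dots,n\}\setminus\tau$) whose coefficients $f_\alpha$ are holomorphic on a common neighbourhood of $p$ in $Y_\tau$; for $s\in\mathbb{R}$ let $\mathcal{O}_{X|Y_\tau}(s)_p$ be the space of Gevrey series of order $s$, i.e. those $f$ for which $\sum_\alpha (\alpha!)^{1-s} f_\alpha(x_\tau)x_{\overline\tau}^\alpha$ converges near $p$. A solution of $\mathcal{M}_A(\beta)$ in such a space is an element annihilated by $H_A(\beta)$, and $\mathcal{H}om_{\mathcal{D}}(\mathcal{M}_A(\beta),\,\cdot\,)_p$ denotes the vector space of solutions. A regular triangulation of $A_\tau=(a_i)_{i\in\tau}$ is a simplicial complex $\mathrm{T}$ of subsets $\sigma\subseteq\tau$ with $(a_i)_{i\in\sigma}$ linearly independent, such that the cones $\operatorname{pos}(\sigma)=\sum_{i\in\sigma}\mathbb{R}_{\ge0}a_i$, $\sigma\in\mathrm{T}$, form a fan with union $\operatorname{pos}(\tau)$ and such that for some $\omega\in\mathbb{R}^\tau$ one has: $\sigma\in\mathrm{T}$ if and only if there is $c\in\mathbb{R}^d$ with $\langle c,a_j\rangle=\omega_j$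 for $j\in\sigma$ and $\langle c,a_j\rangle<\omega_j$ for $j\in\tau\setminus\sigma$. Call $\mathrm{T}$ suitable for $\tau$ if it is a regular triangulation of $A_\tau$ and $\operatorname{vol}_{\mathbb{Z}A}(\Delta_\tau)=\sum_{\sigma\in\mathrm{T},\,|\sigma|=d}\operatorname{vol}_{\mathbb{Z}A}(\Delta_\sigma)$. For $\sigma$ with $|\sigma|=d$ and $A_\sigma$ invertible let $|A_\sigma^{-1}a_j|$ be the sum of the entries of $A_\sigma^{-1}a_j$ and, for $R>0$, $$U_\sigma=U_{\sigma,R}=\Big\{x\in\mathbb{C}^n:\ \prod_{i\in\sigma}x_i\ne0,\ |x_j|<R\,\big|x_\sigma^{A_\sigma^{-1}a_j}\big| \text{ for all } j\notin\sigma \text{ with } |A_\sigma^{-1}a_j|=1\Big\}.$$ Theorem. Every $\tau\subseteq\{1,\dots,n\}$ has a suitable triangulation. There is $R>0$, depending only on $A$, such that for every $\tau\subseteq\{1,\dots,n\}$ and every triangulation $\mathrm{T}(\tau)$ suitable for $\tau$ the following holds. (1) $W_{\mathrm{T}(\tau)}:=Y_\tau\cap\bigcap_{\sigma\in\mathrm{T}(\tau),\,|\sigma|=d}U_\sigma$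 is a nonempty relatively open subset of $Y_\tau$, and for all $\beta\in\mathbb{C}^d$ and $p\in W_{\mathrm{T}(\tau)}$ $$\dim_{\mathbb{C}}\mathcal{H}om_{\mathcal{D}}(\mathcal{M}_A(\beta),\mathcal{O}_{\widehat{X|Y_\tau}})_p\ \ge\ \operatorname{vol}_{\mathbb{Z}A}(\Delta_\tau).$$ (2) For every $s\in\mathbb{R}$ put $\mathrm{T}(\tau,s)=\{\sigma\in\mathrm{T}(\tau): |\sigma|=d,\ |A_\sigma^{-1}a_j|\le s \text{ for all } j\notin\tau\}$. Then $W_{\mathrm{T}(\tau,s)}:=Y_\tau\cap\bigcap_{\sigma\in\mathrm{T}(\tau,s)}U_\sigma$ is a nonempty relatively open subset of $Y_\tau$, and for all $\beta\in\mathbb{C}^d$ and $p\in W_{\mathrm{T}(\tau,s)}$ $$\dim_{\mathbb{C}}\mathcal{H}om_{\mathcal{D}}(\mathcal{M}_A(\beta),\mathcal{O}_{X|Y_\tau}(s))_p\ \ge\ \sum_{\sigma\in\mathrm{T}(\tau,s)}\operatorname{vol}_{\mathbb{Z}A}(\Delta_\sigma).$$ -/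

import Mathlib

namespace GKZ

open scoped Nat ENNReal

noncomputable section

/-! ### The matrix `A`, its simplices and its regular triangulations

`A` is a `d × n` integer matrix with columns `a_0, …, a_{n-1}`; sets of columns are sets of
indices, `σ, τ : Finset (Fin n)`. -/

/-- The column `a_j`, as a vector of `ℝ^d`. -/
def col {d n : ℕ} (A : Matrix (Fin d) (Fin n) ℤ) (j : Fin n) : Fin d → ℝ :=
  fun i => (A i j : ℝ)

/-- The lattice `ℤA ⊆ ℤ^d` generated by the columns of `A`. -/
def lattice {d n : ℕ} (A : Matrix (Fin d) (Fin n) ℤ) : AddSubgroup (Fin d → ℤ) :=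
  AddSubgroup.closure (Set.range fun (j : Fin n) (i : Fin d) => A i j)

/-- `Δ_τ`, the convex hull of the origin and the `a_i` with `i ∈ τ`. -/
def polytope {d n : ℕ} (A : Matrix (Fin d) (Fin n) ℤ) (τ : Finset (Fin n)) :
    Set (Fin d → ℝ) :=
  convexHull ℝ (insert 0 (col A '' (τ : Set (Fin n))))

/-- The normalized volume `vol_{ℤA}(Δ_τ) = d! vol(Δ_τ) / [ℤ^d : ℤA]`. -/
def normVol {d n : ℕ} (A : Matrix (Fin d) (Fin n) ℤ) (τ : Finset (Fin n)) : ℝ≥0∞ :=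
  (d ! : ℝ≥0∞) * MeasureTheory.volume (polytope A τ) / ((lattice A).index : ℝ≥0∞)

/-- The cone `pos(σ) = ∑_{i ∈ σ} ℝ_{≥0} a_i`. -/
def pos {d n : ℕ} (A : Matrix (Fin d) (Fin n) ℤ) (σ : Finset (Fin n)) : Set (Fin d → ℝ) :=
  {y | ∃ c : Fin n → ℝ, (∀ i ∈ σ, 0 ≤ c i) ∧ y = ∑ i ∈ σ, c i • col A i}

/-- `T` is a triangulation of `A_τ`: a simplicial complex of sets of linearly independent columns
of `A_τ` whose cones form a simplicial fan with support `pos(τ)`. -/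
structure IsTriangulation {d n : ℕ} (A : Matrix (Fin d) (Fin n) ℤ) (τ : Finset (Fin n))
    (T : Finset (Finset (Fin n))) : Prop where
  subset : ∀ σ ∈ T, σ ⊆ τ
  linearIndependent : ∀ σ ∈ T, LinearIndependent ℝ fun i : σ => col A i
  down_closed : ∀ σ ∈ T, ∀ ρ ⊆ σ, ρ ∈ T
  inter : ∀ σ ∈ T, ∀ σ' ∈ T, pos A σ ∩ pos A σ' = pos A (σ ∩ σ')
  cover : ⋃ σ ∈ T, pos A σ = pos A τ

open Classical in
/-- The collection `T_ω` of subsets of the columns of `A_τ` defined by a weight `ω`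
(only the entries `ω_j` with `j ∈ τ` matter). -/
def weightComplex {d n : ℕ} (A : Matrix (Fin d) (Fin n) ℤ) (τ : Finset (Fin n))
    (ω : Fin n → ℝ) : Finset (Finset (Fin n)) :=
  τ.powerset.filter fun σ => ∃ c : Fin d → ℝ,
    (∀ j ∈ σ, c ⬝ᵥ col A j = ω j) ∧ ∀ j ∈ τ \ σ, c ⬝ᵥ col A j < ω j

/-- `T` is a regular triangulation of `A_τ`. -/
def IsRegularTriangulation {d n : ℕ} (A : Matrix (Fin d) (Fin n) ℤ) (τ : Finset (Fin n))
    (T : Finset (Finset (Fin n))) : Prop :=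
  (∃ ω : Fin n → ℝ, T = weightComplex A τ ω) ∧ IsTriangulation A τ T

/-- The `(d-1)`-dimensional simplices of `T`, i.e. those with `d` vertices. -/
def facets (d : ℕ) {n : ℕ} (T : Finset (Finset (Fin n))) : Finset (Finset (Fin n)) :=
  T.filter fun σ => σ.card = d

/-- `T` is a regular triangulation of `A_τ` with
`vol_{ℤA}(Δ_τ) = ∑_{σ ∈ T, dim σ = d-1} vol_{ℤA}(Δ_σ)`. -/
def IsVolumeTriangulation {d n : ℕ} (A : Matrix (Fin d) (Fin n) ℤ) (τ : Finset (Fin n))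
    (T : Finset (Finset (Fin n))) : Prop :=
  IsRegularTriangulation A τ T ∧ normVol A τ = ∑ σ ∈ facets d T, normVol A σ

/-- The square submatrix `A_σ` for a set `σ` of `d` columns. -/
def subMatrix {d n : ℕ} (A : Matrix (Fin d) (Fin n) ℤ) (σ : Finset (Fin n)) (h : σ.card = d) :
    Matrix (Fin d) (Fin d) ℝ :=
  Matrix.of fun i k => col A (σ.orderEmbOfFin h k) i

/-- The vector `A_σ⁻¹ a_j`; its `k`-th entry belongs to the `k`-th element of `σ`. -/
def simplexCoord {d n : ℕ} (A : Matrix (Fin d) (Fin n) ℤ) (σ : Finset (Fin n)) (h : σ.card = d)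
    (j : Fin n) : Fin d → ℝ :=
  (subMatrix A σ h)⁻¹.mulVec (col A j)

/-- The number `|A_σ⁻¹ a_j|`, the sum of the entries of `A_σ⁻¹ a_j`. One has `a_j ∈ H_σ` iff
it equals `1` and, for `s > 0`, `a_j / s ∉ H_σ⁺` iff it is at most `s`. -/
def height {d n : ℕ} (A : Matrix (Fin d) (Fin n) ℤ) (σ : Finset (Fin n)) (h : σ.card = d)
    (j : Fin n) : ℝ :=
  ∑ k, simplexCoord A σ h j k

open Classical in
/-- `T(τ, s)`: the `(d-1)`-simplices `σ` of `T` with `|A_σ⁻¹ a_j| ≤ s` for all `j ∉ τ`. -/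
def facetsOfOrder {d n : ℕ} (A : Matrix (Fin d) (Fin n) ℤ) (τ : Finset (Fin n))
    (T : Finset (Finset (Fin n))) (s : ℝ) : Finset (Finset (Fin n)) :=
  (facets d T).filter fun σ => ∀ h : σ.card = d, ∀ j ∉ τ, height A σ h j ≤ s

/-! ### The domains -/

/-- The coordinate subspace `Y_τ = {x_i = 0 : i ∉ τ}` of `ℂ^n`. -/
def coordSubspace {n : ℕ} (τ : Finset (Fin n)) : Set (Fin n → ℂ) :=
  {x | ∀ i ∉ τ, x i = 0}

/-- `U_σ = {x : ∏_{i ∈ σ} x_i ≠ 0, |x_j| < R |x_σ^{A_σ⁻¹ a_j}| for all j ∉ σ with a_j ∈ H_σ}`. -/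
def simplexDomain {d n : ℕ} (A : Matrix (Fin d) (Fin n) ℤ) (R : ℝ) (σ : Finset (Fin n)) :
    Set (Fin n → ℂ) :=
  {x | (∀ i ∈ σ, x i ≠ 0) ∧ ∀ h : σ.card = d, ∀ j ∉ σ, height A σ h j = 1 →
    ‖x j‖ < R * ∏ k, ‖x (σ.orderEmbOfFin h k)‖ ^ simplexCoord A σ h j k}

/-- `W = Y_τ ∩ ⋂_{σ ∈ S} U_σ` for a set `S` of `(d-1)`-simplices. -/
def commonDomain {d n : ℕ} (A : Matrix (Fin d) (Fin n) ℤ) (R : ℝ) (τ : Finset (Fin n))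
    (S : Finset (Finset (Fin n))) : Set (Fin n → ℂ) :=
  coordSubspace τ ∩ ⋂ σ ∈ S, simplexDomain A R σ

/-! ### Formal and Gevrey series along `Y_τ`

The germs at `p ∈ Y_τ` are written as power series `f = ∑_m c_m (x - p)^m`. Grouping the terms
by the exponents of the `x_i` with `i ∉ τ` (where `p_i = 0`) gives
`f = ∑_α f_α(x_τ) x_{τᶜ}^α` with `f_α ∈ ℂ[[x_τ - p_τ]]`. -/

/-- The stalk at a point of `Y_τ` of the formal completion of `𝒪_X` along `Y_τ`: all coefficients
`f_α` are holomorphic on a common neighbourhood of the point, i.e. their Taylor series converge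
absolutely on a common polydisc. -/
def formalSeries {n : ℕ} (τ : Finset (Fin n)) : Submodule ℂ (MvPowerSeries (Fin n) ℂ) where
  carrier := {f | ∃ r : ℝ, 0 < r ∧ ∀ α : Fin n →₀ ℕ,
    Summable fun m : {m : Fin n →₀ ℕ // ∀ i ∉ τ, m i = α i} =>
      ‖MvPowerSeries.coeff m.1 f‖ * r ^ ∑ i ∈ τ, m.1 i}
  zero_mem' := ⟨1, one_pos, fun α => by simp⟩
  add_mem' := by
    rintro f g ⟨r, hr, hf⟩ ⟨t, ht, hg⟩
    refine ⟨min r t, lt_min hr ht, fun α => Summable.of_nonneg_of_le (fun m => by positivity)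
      (fun m => ?_) ((hf α).add (hg α))⟩
    have h0 : 0 ≤ min r t := (lt_min hr ht).le
    calc _ ≤ (‖MvPowerSeries.coeff m.1 f‖ + ‖MvPowerSeries.coeff m.1 g‖) *
          (min r t) ^ ∑ i ∈ τ, m.1 i := by
            rw [map_add]; gcongr; exact norm_add_le _ _
      _ ≤ _ := by
            rw [add_mul]
            gcongr
            · exact min_le_left _ _
            · exact min_le_right _ _
  smul_mem' := by
    rintro c f ⟨r, hr, hf⟩
    refine ⟨r, hr, fun α => ((hf α).mul_left ‖c‖).congr fun m => ?_⟩
    simp [mul_assoc]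

/-- The power series that converge absolutely near the centre of expansion. -/
def convergentSeries (n : ℕ) : Submodule ℂ (MvPowerSeries (Fin n) ℂ) where
  carrier := {f | ∃ r : ℝ, 0 < r ∧ Summable fun m : Fin n →₀ ℕ =>
      ‖MvPowerSeries.coeff m f‖ * r ^ ∑ i, m i}
  zero_mem' := ⟨1, one_pos, by simp⟩
  add_mem' := by
    rintro f g ⟨r, hr, hf⟩ ⟨t, ht, hg⟩
    refine ⟨min r t, lt_min hr ht, Summable.of_nonneg_of_le (fun m => by positivity)
      (fun m => ?_) (hf.add hg)⟩
    have h0 : 0 ≤ min r t := (lt_min hr ht).le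
    calc _ ≤ (‖MvPowerSeries.coeff m f‖ + ‖MvPowerSeries.coeff m g‖) *
          (min r t) ^ ∑ i, m i := by
            rw [map_add]; gcongr; exact norm_add_le _ _
      _ ≤ _ := by
            rw [add_mul]
            gcongr
            · exact min_le_left _ _
            · exact min_le_right _ _
  smul_mem' := by
    rintro c f ⟨r, hr, hf⟩
    refine ⟨r, hr, (hf.mul_left ‖c‖).congr fun m => ?_⟩
    simp [mul_assoc]

/-- The map `ρ_s : ∑_α f_α x_{τᶜ}^α ↦ ∑_α f_α / (α!)^{s-1} x_{τᶜ}^α`. -/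
def rho {n : ℕ} (τ : Finset (Fin n)) (s : ℝ) :
    MvPowerSeries (Fin n) ℂ →ₗ[ℂ] MvPowerSeries (Fin n) ℂ where
  toFun f := fun m =>
    MvPowerSeries.coeff m f / (((∏ i ∈ τᶜ, ((m i)! : ℝ)) ^ (s - 1) : ℝ) : ℂ)
  map_add' f g := by
    funext m
    exact (congrArg (· / _) (map_add (MvPowerSeries.coeff m) f g)).trans (add_div _ _ _)
  map_smul' c f := by
    funext m
    exact (congrArg (· / _) (map_smul (MvPowerSeries.coeff m) c f)).trans (mul_div_assoc _ _ _)

/-- The Gevrey series of order `s` along `Y_τ` at a point of `Y_τ`. -/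
def gevreySeries {n : ℕ} (τ : Finset (Fin n)) (s : ℝ) :
    Submodule ℂ (MvPowerSeries (Fin n) ℂ) :=
  (convergentSeries n).comap (rho τ s)

/-! ### The hypergeometric system -/

/-- `∂_i`, acting on power series in `x - p`. -/
def partialOp {n : ℕ} (i : Fin n) : Module.End ℂ (MvPowerSeries (Fin n) ℂ) :=
  (MvPowerSeries.pderiv ℂ i).toLinearMap

/-- Multiplication by `x_i = p_i + (x_i - p_i)`, acting on power series in `x - p`. -/
def coordOp {n : ℕ} (p : Fin n → ℂ) (i : Fin n) : Module.End ℂ (MvPowerSeries (Fin n) ℂ) :=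
  LinearMap.mulLeft ℂ (MvPowerSeries.C (p i) + MvPowerSeries.X i)

/-- The Weyl algebra `ℂ[x]⟨∂⟩`, realized by its (faithful) action on power series in `x - p`. -/
def weylAlgebra {n : ℕ} (p : Fin n → ℂ) :
    Subalgebra ℂ (Module.End ℂ (MvPowerSeries (Fin n) ℂ)) :=
  Algebra.adjoin ℂ (Set.range (coordOp p) ∪ Set.range partialOp)

/-- The element `∂_i` of the Weyl algebra. -/
def weylD {n : ℕ} (p : Fin n → ℂ) (i : Fin n) : weylAlgebra p :=
  ⟨partialOp i, Algebra.subset_adjoin (Or.inr ⟨i, rfl⟩)⟩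

/-- The element `x_i` of the Weyl algebra. -/
def weylX {n : ℕ} (p : Fin n → ℂ) (i : Fin n) : weylAlgebra p :=
  ⟨coordOp p i, Algebra.subset_adjoin (Or.inl ⟨i, rfl⟩)⟩

/-- `∂^u = ∂_0^{u_0} ⋯ ∂_{n-1}^{u_{n-1}}`. -/
def weylDPow {n : ℕ} (p : Fin n → ℂ) (u : Fin n → ℕ) : weylAlgebra p :=
  (List.ofFn fun i => weylD p i ^ u i).prod

/-- The toric operator `□_u = ∂^{u₊} - ∂^{u₋}`. -/
def toricOp {n : ℕ} (p : Fin n → ℂ) (u : Fin n → ℤ) : weylAlgebra p :=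
  weylDPow p (fun i => (u i).toNat) - weylDPow p (fun i => (-u i).toNat)

/-- The operator `E_i - β_i = ∑_j a_{ij} x_j ∂_j - β_i`. -/
def eulerOp {d n : ℕ} (A : Matrix (Fin d) (Fin n) ℤ) (β : Fin d → ℂ) (p : Fin n → ℂ)
    (i : Fin d) : weylAlgebra p :=
  ∑ j, (A i j : ℂ) • (weylX p j * weylD p j) - algebraMap ℂ (weylAlgebra p) (β i)

/-- The hypergeometric left ideal `H_A(β)` of the Weyl algebra. -/
def hypergeometricIdeal {d n : ℕ} (A : Matrix (Fin d) (Fin n) ℤ) (β : Fin d → ℂ)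
    (p : Fin n → ℂ) : Submodule (weylAlgebra p) (weylAlgebra p) :=
  Submodule.span (weylAlgebra p)
    ({P | ∃ u : Fin n → ℤ, A.mulVec u = 0 ∧ P = toricOp p u} ∪ Set.range (eulerOp A β p))

/-- The solutions at `p` of `M_A(β) = D / D H_A(β)` in a space `F` of series in `x - p`: a
homomorphism `M_A(β) → F` is determined by the image `f ∈ F` of the class of `1`, which may be any
`f` annihilated by `H_A(β)`. -/
def solutions {d n : ℕ} (A : Matrix (Fin d) (Fin n) ℤ) (β : Fin d → ℂ) (p : Fin n → ℂ)
    (F : Submodule ℂ (MvPowerSeries (Fin n) ℂ)) : Submodule ℂ (MvPowerSeries (Fin n) ℂ) where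
  carrier := {f | f ∈ F ∧ ∀ P ∈ hypergeometricIdeal A β p, P.1 f = 0}
  zero_mem' := ⟨F.zero_mem, fun P _ => map_zero P.1⟩
  add_mem' := fun hf hg => ⟨F.add_mem hf.1 hg.1, fun P hP => by
    rw [map_add, hf.2 P hP, hg.2 P hP, add_zero]⟩
  smul_mem' := fun c f hf => ⟨F.smul_mem c hf.1, fun P hP => by
    rw [map_smul, hf.2 P hP, smul_zero]⟩

/-- The dimension of a complex vector space, as an element of `[0, ∞]` (`∞` if it is infinite). -/
def cdim (V : Type) [AddCommGroup V] [Module ℂ V] : ℝ≥0∞ :=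
  ((Cardinal.toENat (Module.rank ℂ V) : ℕ∞) : ℝ≥0∞)

end

end GKZ

namespace GKZ

open scoped Nat ENNReal

noncomputable section

/-! ### Growth of the reciprocal Gamma function -/

/-! The solutions are Taylor expansions at `p` of Γ-series. For `σ` with `d` elements and a class in
`ℤA / ℤA_σ`, sum the monomials `x_σ^(A_σ⁻¹(β - Aκ)) x^κ / (Γ(A_σ⁻¹(β - Aκ) + 1) κ!)` over the `κ`
vanishing on `σ` with `Aκ` in the class. Applying `∂^m` replaces `β` by `β - Am`, so the derivatives
at `p` depend on `m` only through `Am` (toric equations), and every exponent `v` satisfies `Av = β`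
(Euler equations). `relations` records these two properties and `expSeries` turns them into a
solution.

Convergence: a Stirling-type bound on `1/Γ` (`exists_gamma_inv_bound`) makes the size of the terms
depend essentially on the heights `h_j = |A_σ⁻¹ a_j|` (`exists_seriesTerm_bound`). For `j ∈ τ` the
volume condition forces `h_j ≤ 1` (`IsTriangulation.height_le_one`); a height below 1 gives
superexponential decay, and height 1 gives a geometric series whose ratio is less than 1 on `U_σ`.
For `j ∉ τ` one has `p_j = 0`, so `h_j` only affects the growth in `m_j`, and `h_j ≤ s` means Gevrey
order `s`.

Independence at generic `β`: the Taylor coefficients of a combination of Γ-series are the factorial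
moments of a discrete measure on the set of exponents. If they all vanish, so does the mass of each
fibre (`tsum_fiber_eq_zero`), and for generic `β` the exponent determines the simplex and the term
(`linearIndependent_hyperCoeff`).

Arbitrary `β`: join `β` to a generic parameter by a complex line. The series are holomorphic along
it, with uniform bounds; dividing combinations that vanish at `β` by the line parameter keeps the
number of independent solutions (`exists_linearIndependent_at_zero`).

Count: the pairs of a simplex and a class number `∑ [ℤA : ℤA_σ]`, which is at least the sum of the
normalized volumes (`normVol_le_relIndex`).

Triangulations: linear programming duality shows that a generic weight induces a regular
triangulation; close to the constant weight 1 all heights on `τ` are at most 1, which gives the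
volume identity. A point `x_j = exp(-t ω_j)` with `t` large lies in all the `U_σ` at once. Part (1)
is part (2) for `s` so large that no simplex is excluded. -/

theorem exists_gamma_inv_shift_bound (B : ℝ) : ∃ K : ℝ, 0 < K ∧ ∀ a : ℂ, ‖a‖ ≤ B → ∀ k : ℕ,
    ‖(Complex.Gamma (a + 1 + k))⁻¹‖ ≤ K * (2 ^ k / k !) ∧
    ‖(Complex.Gamma (a + 1 - k))⁻¹‖ ≤ K * (2 ^ k * k !) := by
  -- `1/Γ` is entire, hence bounded on a fixed ball, and `1/Γ(z) = z/Γ(z+1)` reaches the other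
  -- arguments. Starting from the shift `L ≥ B` makes each factor at least `j + 1` in norm; passing
  -- between `j!` and `(L + j)!` costs only a power of 2 and a constant.
  obtain ⟨L, hL⟩ := exists_nat_ge B
  obtain ⟨K₀, hK₀⟩ := (isCompact_closedBall (0 : ℂ) (B + 1 + L)).exists_bound_of_continuousOn
    Complex.differentiable_one_div_Gamma.continuous.continuousOn
  set K₁ := max K₀ 1 with hK₁
  have hK₁pos : 0 < K₁ := lt_max_of_lt_right one_pos
  have hle : ∀ z : ℂ, ‖z‖ ≤ B + 1 + L → ‖(Complex.Gamma z)⁻¹‖ ≤ K₁ := fun z hz =>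
    (hK₀ z (by simpa using hz)).trans (le_max_left _ _)
  have hadd : ∀ k : ℕ, ((L + k)! : ℝ) ≤ 2 ^ (L + k) * (L ! * k !) := fun k => by
    have h1 : (L + k)! = (L + k).choose L * L ! * k ! := by
      simpa using (Nat.choose_mul_factorial_mul_factorial (Nat.le_add_right L k)).symm
    have h2 : (L + k).choose L ≤ 2 ^ (L + k) := Nat.choose_le_two_pow _ _
    have : (L + k)! ≤ 2 ^ (L + k) * (L ! * k !) := by
      rw [h1, mul_assoc]; gcongr
    exact_mod_cast this
  refine ⟨K₁ * (L ! * 2 ^ L), by positivity, fun a ha k => ⟨?_, ?_⟩⟩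
  · rcases le_or_gt L k with hk | hk
    · obtain ⟨j, rfl⟩ := Nat.exists_eq_add_of_le hk
      have key : ‖(Complex.Gamma (a + 1 + (L + j : ℕ)))⁻¹‖ ≤ K₁ / j ! := by
        clear hk
        induction j with
        | zero =>
          simp only [add_zero, Nat.factorial_zero, Nat.cast_one, div_one]
          apply hle
          calc ‖a + 1 + (L : ℂ)‖ ≤ ‖a‖ + ‖(1 : ℂ)‖ + ‖(L : ℂ)‖ := norm_add₃_le
            _ ≤ B + 1 + L := by simp [ha]
        | succ j ih =>
          have hs := Complex.one_div_Gamma_eq_self_mul_one_div_Gamma_add_one (a + 1 + (L + j : ℕ))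
          have h2 : a + 1 + ((L + (j + 1) : ℕ) : ℂ) = a + 1 + (L + j : ℕ) + 1 := by push_cast; ring
          rw [h2]
          have hn : (j + 1 : ℝ) ≤ ‖a + 1 + ((L + j : ℕ) : ℂ)‖ := by
            have h3 : ‖((1 + L + j : ℕ) : ℂ)‖ ≤ ‖a + 1 + ((L + j : ℕ) : ℂ)‖ + ‖a‖ := by
              calc ‖((1 + L + j : ℕ) : ℂ)‖ = ‖(a + 1 + ((L + j : ℕ) : ℂ)) - a‖ := by
                    congr 1; push_cast; ring
                _ ≤ _ := norm_sub_le _ _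
            rw [Complex.norm_natCast] at h3
            push_cast at h3 ⊢
            linarith
          rw [hs, norm_mul] at ih
          rw [Nat.factorial_succ, Nat.cast_mul, le_div_iff₀ (by positivity)]
          rw [le_div_iff₀ (by positivity)] at ih
          calc _ = (j + 1 : ℝ) * ‖(Complex.Gamma (a + 1 + ((L + j : ℕ) : ℂ) + 1))⁻¹‖ * j ! := by
                push_cast; ring
            _ ≤ _ := le_trans (by gcongr) ih
      refine key.trans ?_
      rw [mul_div_assoc', div_le_div_iff₀ (by positivity) (by positivity)]
      calc K₁ * ((L + j)! : ℝ) ≤ K₁ * (2 ^ (L + j) * (L ! * j !)) := by gcongr; exact hadd j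
        _ = K₁ * (L ! * 1) * 2 ^ (L + j) * j ! := by ring
        _ ≤ _ := by gcongr; exact one_le_pow₀ one_le_two
    · have h1 : ‖(Complex.Gamma (a + 1 + k))⁻¹‖ ≤ K₁ := by
        apply hle
        calc ‖a + 1 + (k : ℂ)‖ ≤ ‖a‖ + ‖(1 : ℂ)‖ + ‖(k : ℂ)‖ := norm_add₃_le
            _ ≤ B + 1 + L := by simp only [norm_one, Complex.norm_natCast]; gcongr
      refine h1.trans ?_
      rw [mul_assoc]
      refine le_mul_of_one_le_right hK₁pos.le ?_
      rw [mul_div_assoc', le_div_iff₀ (by positivity), one_mul]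
      have h4 : (k ! : ℝ) ≤ L ! := by exact_mod_cast Nat.factorial_le hk.le
      calc (k ! : ℝ) ≤ L ! * 1 * 1 := by simpa using h4
        _ ≤ _ := by gcongr <;> exact one_le_pow₀ one_le_two
  · have key : ‖(Complex.Gamma (a + 1 - k))⁻¹‖ ≤ K₁ * (L + k)! := by
      induction k with
      | zero =>
        refine (hle _ ?_).trans (le_mul_of_one_le_right hK₁pos.le ?_)
        · simp only [Nat.cast_zero, sub_zero]
          refine (norm_add_le _ _).trans ?_
          have : (0 : ℝ) ≤ L := by positivity
          simp only [norm_one]; linarith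
        · exact_mod_cast Nat.succ_le_of_lt (Nat.factorial_pos _)
      | succ k ih =>
        rw [show a + 1 - ((k + 1 : ℕ) : ℂ) = a - k by push_cast; ring,
          Complex.one_div_Gamma_eq_self_mul_one_div_Gamma_add_one, norm_mul,
          show a - k + 1 = a + 1 - k by ring]
        have h5 : ‖a - k‖ ≤ ((L + k + 1 : ℕ) : ℝ) := by
          refine (norm_sub_le _ _).trans ?_
          rw [Complex.norm_natCast]; push_cast; linarith
        rw [← add_assoc, Nat.factorial_succ, Nat.cast_mul]
        calc _ ≤ ((L + k + 1 : ℕ) : ℝ) * (K₁ * (L + k)!) := by gcongr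
          _ = _ := by ring
    refine key.trans ?_
    calc K₁ * ((L + k)! : ℝ) ≤ K₁ * (2 ^ (L + k) * (L ! * k !)) := by gcongr; exact hadd k
      _ = _ := by ring

/-- On a strip of bounded width, `1 / Γ(c - b + 1)` grows at most like `N ^ b` up to a factor
exponential in `N`, where the exponential rate depends only on `sup |b| / N`. -/
theorem exists_gamma_inv_bound {D : ℝ} (hD : 0 ≤ D) (B : ℝ) : ∃ K : ℝ, 0 < K ∧
    ∀ c : ℂ, ‖c‖ ≤ B → ∀ b N : ℝ, 1 ≤ N → |b| ≤ D * N →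
      ‖(Complex.Gamma (c - b + 1))⁻¹‖ ≤ K * (Real.exp ((D + 2) ^ 2 * N) * N ^ b) := by
  obtain ⟨K, hK, h⟩ := exists_gamma_inv_shift_bound (B + 1)
  refine ⟨K, hK, fun c hc b N hN hb => ?_⟩
  have hN0 : 0 < N := one_pos.trans_le hN
  have hfl := Int.floor_le b
  have hfl' := Int.lt_floor_add_one b
  -- Only the integer part of `b` is a shift; `c` minus the fractional part stays in the ball of
  -- radius `B + 1`.
  set a : ℂ := c - ((Int.fract b : ℝ) : ℂ) with ha
  have hanorm : ‖a‖ ≤ B + 1 := by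
    refine (norm_sub_le _ _).trans ?_
    have : ‖((Int.fract b : ℝ) : ℂ)‖ ≤ 1 := by
      rw [Complex.norm_real, Real.norm_eq_abs, abs_of_nonneg (Int.fract_nonneg b)]
      exact (Int.fract_lt_one b).le
    linarith
  have hcb : c - b + 1 = a + 1 - ((⌊b⌋ : ℤ) : ℂ) := by
    have : (b : ℂ) = ((⌊b⌋ : ℤ) : ℂ) + ((Int.fract b : ℝ) : ℂ) := by
      have := Int.floor_add_fract b
      exact_mod_cast this.symm
    rw [ha]; linear_combination -this
  have h2 : ∀ j : ℕ, (2 : ℝ) ^ j ≤ Real.exp j := fun j => by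
    rw [← Real.exp_one_pow]
    gcongr
    have := Real.add_one_le_exp (1 : ℝ)
    linarith
  rcases le_or_gt 0 ⌊b⌋ with hb0 | hb0
  · obtain ⟨j, hj⟩ := Int.eq_ofNat_of_zero_le hb0
    have hjb : (j : ℝ) ≤ b := by
      have : ((⌊b⌋ : ℤ) : ℝ) = (j : ℝ) := by rw [hj]; simp
      linarith
    have hjD : (j : ℝ) ≤ D * N := hjb.trans ((le_abs_self b).trans hb)
    rw [hcb, hj]
    refine (by simpa using (h a hanorm j).2 :
      ‖(Complex.Gamma (a + 1 - ((j : ℤ) : ℂ)))⁻¹‖ ≤ _).trans ?_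
    gcongr K * ?_
    have h3 : (j ! : ℝ) ≤ Real.exp (D * j) * N ^ b := by
      calc (j ! : ℝ) ≤ (j : ℝ) ^ j := by exact_mod_cast Nat.factorial_le_pow j
        _ ≤ (D * N) ^ j := by gcongr
        _ = D ^ j * N ^ j := mul_pow _ _ _
        _ ≤ Real.exp D ^ j * N ^ (j : ℝ) := by
          rw [Real.rpow_natCast]; gcongr
          have := Real.add_one_le_exp D; linarith
        _ ≤ Real.exp (D * j) * N ^ b := by
          rw [← Real.exp_nat_mul, mul_comm (j : ℝ) D]; gcongr
    calc (2 : ℝ) ^ j * j ! ≤ Real.exp j * (Real.exp (D * j) * N ^ b) := by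
          gcongr; exact h2 j
      _ = Real.exp (j + D * j) * N ^ b := by rw [Real.exp_add]; ring
      _ ≤ _ := by
        gcongr
        nlinarith [mul_nonneg hD hN0.le, mul_nonneg hD (sub_nonneg.2 hjD)]
  · obtain ⟨j, hj⟩ : ∃ j : ℕ, ⌊b⌋ = -(j : ℤ) := ⟨(-⌊b⌋).toNat, by omega⟩
    have hjb : -(j : ℝ) ≤ b ∧ b < -(j : ℝ) + 1 := by
      have : ((⌊b⌋ : ℤ) : ℝ) = -(j : ℝ) := by rw [hj]; simp
      constructor <;> linarith
    have hjD : (j : ℝ) ≤ (D + 1) * N := by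
      have := neg_abs_le b
      nlinarith
    rw [hcb, hj]
    refine (by simpa using (h a hanorm j).1 :
      ‖(Complex.Gamma (a + 1 - ((-(j : ℤ) : ℤ) : ℂ)))⁻¹‖ ≤ _).trans ?_
    gcongr K * ?_
    -- `N ^ j / j!` is a term of the series of `exp N`, and `N ^ (-j) ≤ N ^ b` because `N ≥ 1` and
    -- `-j ≤ b`.
    have h3 : 1 / (j ! : ℝ) ≤ Real.exp N * N ^ b := by
      have h4 := Real.pow_div_factorial_le_exp N hN0.le j
      calc 1 / (j ! : ℝ) = N ^ j / j ! * N ^ (-(j : ℝ)) := by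
            rw [Real.rpow_neg hN0.le, Real.rpow_natCast]; field_simp
        _ ≤ Real.exp N * N ^ b := by
          gcongr
          exact hjb.1
    calc (2 : ℝ) ^ j / j ! = 2 ^ j * (1 / j !) := by ring
      _ ≤ Real.exp j * (Real.exp N * N ^ b) := by gcongr; exact h2 j
      _ = Real.exp (j + N) * N ^ b := by rw [Real.exp_add]; ring
      _ ≤ _ := by gcongr; nlinarith [mul_nonneg hD hN0.le]

/-! ### Summability over multi-indices -/

/-- A finite set of multi-indices lies in a box, and over a box the sum factorises. -/
theorem summable_finsupp_prod {n : ℕ} {t : Fin n → ℕ → ℝ} (h0 : ∀ j k, 0 ≤ t j k)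
    (ht : ∀ j, Summable (t j)) : Summable fun κ : Fin n →₀ ℕ => ∏ j, t j (κ j) := by
  classical
  refine summable_of_sum_le (c := ∏ j, ∑' k, t j k)
    (fun κ => Finset.prod_nonneg fun j _ => h0 j _) fun u => ?_
  let b : Fin n → Finset ℕ := fun j => u.image fun κ => κ j
  calc ∑ κ ∈ u, ∏ j, t j (κ j)
      = ∑ f ∈ u.image (fun κ : Fin n →₀ ℕ => (κ : Fin n → ℕ)), ∏ j, t j (f j) := by
        rw [Finset.sum_image fun _ _ _ _ h => DFunLike.coe_injective h]
    _ ≤ ∑ f ∈ Fintype.piFinset b, ∏ j, t j (f j) := by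
        refine Finset.sum_le_sum_of_subset_of_nonneg ?_
          fun f _ _ => Finset.prod_nonneg fun j _ => h0 j _
        intro f hf
        obtain ⟨κ, hκ, rfl⟩ := Finset.mem_image.1 hf
        exact Fintype.mem_piFinset.2 fun j => Finset.mem_image_of_mem _ hκ
    _ = ∏ j, ∑ k ∈ b j, t j k := (Finset.prod_univ_sum b t).symm
    _ ≤ _ := Finset.prod_le_prod (fun j _ => Finset.sum_nonneg fun k _ => h0 j k)
        fun j _ => (ht j).sum_le_tsum _ fun k _ => h0 j k

/-- The `k`-th term is the `k`-th power of `x (1 + k)^(-(1 - h))`, whose base tends to 0 unless `h =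
1`. -/
theorem summable_pow_mul_rpow_neg {x h : ℝ} (hx : 0 ≤ x) (hh : h ≤ 1) (hx1 : h = 1 → x < 1) :
    Summable fun k : ℕ => x ^ k * (1 + k : ℝ) ^ (-((1 - h) * k)) := by
  rcases hh.eq_or_lt with rfl | hh
  · simpa using summable_geometric_of_lt_one hx (hx1 rfl)
  · have hlim : Filter.Tendsto (fun k : ℕ => x * (1 + k : ℝ) ^ (-(1 - h))) Filter.atTop
        (nhds (x * 0)) := by
      refine Filter.Tendsto.const_mul x ?_
      refine (tendsto_rpow_neg_atTop (sub_pos.2 hh)).comp ?_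
      exact Filter.tendsto_atTop_add_const_left _ _ tendsto_natCast_atTop_atTop
    rw [mul_zero] at hlim
    have hev := hlim.eventually (eventually_le_nhds (show (0 : ℝ) < 1 / 2 by norm_num))
    refine Summable.of_norm_bounded_eventually_nat
      (summable_geometric_of_lt_one (by norm_num) (show (1 / 2 : ℝ) < 1 by norm_num)) ?_
    filter_upwards [hev] with k hk
    have h1 : (0 : ℝ) < 1 + k := by positivity
    have h2 : x ^ k * (1 + k : ℝ) ^ (-((1 - h) * k)) = (x * (1 + k : ℝ) ^ (-(1 - h))) ^ k := by
      rw [mul_pow, ← Real.rpow_mul_natCast h1.le, neg_mul]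
    rw [h2, Real.norm_of_nonneg (by positivity)]
    exact pow_le_pow_left₀ (by positivity) hk k

/-! ### The summands of the hypergeometric series and their growth -/

/-- The entire function `a ↦ q^a / Γ(a + 1)`, where `ℓ = log q`. -/
def gammaMonomial (ℓ a : ℂ) : ℂ := Complex.exp (a * ℓ) * (Complex.Gamma (a + 1))⁻¹

/-- The summand of a hypergeometric series with `x j k` the coordinates of the columns with respect
to a simplex, `ℓ` the logarithms of the coordinates of the simplex, and `c` the coordinates of the
parameter. -/
def seriesTerm {d n : ℕ} (x : Fin n → Fin d → ℝ) (ℓ : Fin d → ℂ) (p : Fin n → ℂ) (c : Fin d → ℂ)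
    (m κ : Fin n →₀ ℕ) : ℂ :=
  (∏ k, gammaMonomial (ℓ k) (c k - (∑ j, x j k * (κ j + m j : ℝ) : ℝ))) *
    ∏ j, (p j ^ κ j / (κ j)!)

/-- In `N^(hk) = N^k N^(-(1-h)k)` the factor `N^k / k!` is absorbed by `exp N`. In the application
`h'` is the height capped at 1; the cap matters only off `τ`, where `ρ = 0`. -/
theorem rpow_div_factorial_le {h h' N ρ : ℝ} (hh : h = h' ∨ ρ = 0) (hh' : h' ≤ 1) (hρ : 0 ≤ ρ)
    (k : ℕ) (hN : 1 + (k : ℝ) ≤ N) :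
    N ^ (h * k) * ρ ^ k / k ! ≤ Real.exp N * (ρ ^ k * (1 + k : ℝ) ^ (-((1 - h') * k))) := by
  have hk : (0 : ℝ) ≤ k := by positivity
  have hN0 : 0 < N := by linarith
  have hN1 : 1 ≤ N := by linarith
  rcases k.eq_zero_or_pos with rfl | hkpos
  · simpa using hN0.le
  rcases hh with rfl | rfl
  · have h1 := Real.pow_div_factorial_le_exp N hN0.le k
    have h2 : N ^ (h * k) = N ^ k * N ^ (-((1 - h) * k)) := by
      rw [← Real.rpow_natCast, ← Real.rpow_add hN0]; ring_nf
    have h3 : N ^ (-((1 - h) * k)) ≤ (1 + k : ℝ) ^ (-((1 - h) * k)) :=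
      Real.rpow_le_rpow_of_nonpos (by positivity) hN
        (neg_nonpos.2 (mul_nonneg (sub_nonneg.2 hh') hk))
    calc N ^ (h * k) * ρ ^ k / k ! = (N ^ k / k !) * (ρ ^ k * N ^ (-((1 - h) * k))) := by
          rw [h2]; ring
      _ ≤ _ := by gcongr
  · simp [hkpos.ne']

/-- The left side is at most `(N^k / k!)^s`. For `s ≥ 0` the exponential series is used at `N / (1 +
s)`, so that the power `s` still costs only `exp N`. All dependence on `s` goes into the base of the
`k`-th power, which is why `R` can be chosen independently of `s`. -/
theorem rpow_mul_factorial_rpow_le {h s N : ℝ} (hh : h ≤ s) (k : ℕ) (hN : 1 + (k : ℝ) ≤ N) :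
    N ^ (h * k) * (k ! : ℝ) ^ (1 - s) / k ! ≤ Real.exp N * ((1 + |s|) ^ |s|) ^ k := by
  have hk : (0 : ℝ) ≤ k := by positivity
  have hN0 : 0 < N := by linarith
  have hN1 : 1 ≤ N := by linarith
  have hf : (0 : ℝ) < k ! := by positivity
  have h1 : N ^ (h * k) * (k ! : ℝ) ^ (1 - s) / k ! ≤ (N ^ k / k !) ^ s := by
    rw [Real.rpow_sub hf, Real.rpow_one, Real.div_rpow (by positivity) hf.le,
      ← Real.rpow_natCast_mul hN0.le, mul_comm (k : ℝ) s]
    calc N ^ (h * k) * ((k ! : ℝ) / (k ! : ℝ) ^ s) / k ! = N ^ (h * k) / (k ! : ℝ) ^ s := by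
          field_simp
      _ ≤ _ := by gcongr
  refine h1.trans ?_
  rcases le_or_gt 0 s with hs | hs
  · rw [abs_of_nonneg hs]
    have h2 := Real.pow_div_factorial_le_exp (N / (1 + s)) (by positivity) k
    have h3 : N ^ k / k ! ≤ Real.exp (N / (1 + s)) * (1 + s) ^ k := by
      calc N ^ k / k ! = (N / (1 + s)) ^ k / k ! * (1 + s) ^ k := by
            rw [div_pow]; field_simp
        _ ≤ _ := by gcongr
    calc (N ^ k / k !) ^ s ≤ (Real.exp (N / (1 + s)) * (1 + s) ^ k) ^ s := by gcongr
      _ = Real.exp (N / (1 + s) * s) * ((1 + s) ^ s) ^ k := by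
        rw [Real.mul_rpow (by positivity) (by positivity), Real.exp_mul,
          ← Real.rpow_natCast_mul (by positivity), ← Real.rpow_mul_natCast (by positivity),
          mul_comm (k : ℝ) s]
      _ ≤ _ := by
        gcongr
        rw [div_mul_eq_mul_div, div_le_iff₀ (by positivity)]
        nlinarith
  · have h4 : (1 : ℝ) ≤ N ^ k / k ! := by
      rw [le_div_iff₀ hf, one_mul]
      calc (k ! : ℝ) ≤ (k : ℝ) ^ k := by exact_mod_cast Nat.factorial_le_pow k
        _ ≤ _ := by gcongr; linarith
    calc (N ^ k / k !) ^ s ≤ 1 := Real.rpow_le_one_of_one_le_of_nonpos h4 hs.le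
      _ = 1 * 1 := (one_mul 1).symm
      _ ≤ _ := by
        gcongr
        · exact Real.one_le_exp hN0.le
        · exact one_le_pow₀ (Real.one_le_rpow (by simp) (abs_nonneg s))

theorem norm_gammaMonomial_le {D : ℝ} (hD : 0 ≤ D) (B : ℝ) (ℓ : ℂ) : ∃ K : ℝ, 0 < K ∧
    ∀ c : ℂ, ‖c‖ ≤ B → ∀ b N : ℝ, 1 ≤ N → |b| ≤ D * N →
      ‖gammaMonomial ℓ (c - b)‖ ≤
        K * (Real.exp ((D + 2) ^ 2 * N) * (N ^ b * Real.exp (-(b * ℓ.re)))) := by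
  obtain ⟨K, hK, h⟩ := exists_gamma_inv_bound hD B
  refine ⟨Real.exp (B * ‖ℓ‖) * K, by positivity, fun c hc b N hN hb => ?_⟩
  rw [gammaMonomial, norm_mul, Complex.norm_exp, sub_mul, Complex.sub_re, Complex.re_ofReal_mul]
  have h1 : (c * ℓ).re ≤ B * ‖ℓ‖ := by
    refine (Complex.re_le_norm _).trans ?_
    rw [norm_mul]; gcongr
  calc _ ≤ Real.exp (B * ‖ℓ‖ - b * ℓ.re) * (K * (Real.exp ((D + 2) ^ 2 * N) * N ^ b)) := by
        gcongr
        exact h c hc b N hN hb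
    _ = _ := by rw [sub_eq_add_neg, Real.exp_add]; ring

/-- The growth rate of the summands of hypergeometric series. -/
def growthRate (d n : ℕ) (D : ℝ) : ℝ := d * (D + 2) ^ 2 + 2 * n

/-- The central estimate: it separates the dependence on the order `m` of the derivative, which is
of Gevrey type, from a summable majorant in `κ`. The constant `C₁` may depend on `s`, whereas the
ratios in `t` involve only `growthRate d n D`. -/
theorem exists_seriesTerm_bound {d n : ℕ} {D : ℝ} (hD : 0 ≤ D) {x : Fin n → Fin d → ℝ}
    (hx : ∀ j k, |x j k| ≤ D) {τ σ : Finset (Fin n)} {s : ℝ} {ℓ : Fin d → ℂ} {p : Fin n → ℂ}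
    (hp : ∀ j ∉ τ, p j = 0) (hτ : ∀ j ∈ τ, ∑ k, x j k ≤ 1) (hs : ∀ j ∉ τ, ∑ k, x j k ≤ s)
    (hσ : ∀ j ∉ σ, ∑ k, x j k = 1 →
      Real.exp (growthRate d n D) * (‖p j‖ * Real.exp (-∑ k, x j k * (ℓ k).re)) < 1) (B : ℝ) :
    ∃ C₁ : ℝ, 0 < C₁ ∧ ∃ t : (Fin n →₀ ℕ) → ℝ, Summable t ∧ (∀ κ, 0 ≤ t κ) ∧
      ∀ c : Fin d → ℂ, (∀ k, ‖c k‖ ≤ B) → ∀ m κ : Fin n →₀ ℕ, (∀ i ∈ σ, κ i = 0) →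
        ‖seriesTerm x ℓ p c m κ‖ * (∏ i ∈ τᶜ, ((m i)! : ℝ)) ^ (1 - s) / ∏ i, ((m i)! : ℝ) ≤
          C₁ ^ (∑ i, m i) * t κ := by
  classical
  choose K hK hKb using fun k => norm_gammaMonomial_le hD B (ℓ k)
  set h : Fin n → ℝ := fun j => ∑ k, x j k with hh
  set y : Fin n → ℝ := fun j => ∑ k, x j k * (ℓ k).re with hy
  set G := growthRate d n D with hG
  set ρ : Fin n → ℝ := fun j => ‖p j‖ * Real.exp (-y j) with hρ
  have hρ0 : ∀ j, 0 ≤ ρ j := fun j => by positivity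
  -- Vertices of `σ` have height 1 and no smallness condition, but `κ` vanishes there. With `0 ^ 0 =
  -- 1`, replacing their ratio by 0 leaves the relevant terms unchanged and makes the majorant
  -- summable.
  set ρ' : Fin n → ℝ := fun j => if j ∈ σ then 0 else ρ j with hρ'
  have hρ'0 : ∀ j, 0 ≤ ρ' j := fun j => by simp only [hρ']; split_ifs <;> simp [hρ0]
  set h' : Fin n → ℝ := fun j => min (h j) 1 with hh'
  set L : ℝ := (1 + |s|) ^ |s| with hL
  have hL1 : 1 ≤ L := Real.one_le_rpow (by simp) (abs_nonneg s)
  obtain ⟨C₂, hC₂⟩ : ∃ C₂ : ℝ, ∀ j, Real.exp (-y j) ≤ C₂ :=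
    ⟨∑ j, Real.exp (-y j), fun j => Finset.single_le_sum (f := fun j => Real.exp (-y j))
      (fun i _ => (Real.exp_pos _).le) (Finset.mem_univ j)⟩
  set C₃ := max C₂ 1 with hC₃
  have hC₃1 : 1 ≤ C₃ := le_max_right _ _
  have hC₃j : ∀ j, Real.exp (-y j) ≤ C₃ := fun j => (hC₂ j).trans (le_max_left _ _)
  set t : Fin n → ℕ → ℝ := fun j k =>
    (Real.exp G * ρ' j) ^ k * (1 + k : ℝ) ^ (-((1 - h' j) * k)) with ht
  have ht0 : ∀ j k, 0 ≤ t j k := fun j k => by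
    have := hρ'0 j
    positivity
  have htsum : ∀ j, Summable (t j) := fun j => by
    refine summable_pow_mul_rpow_neg (mul_nonneg (Real.exp_pos _).le (hρ'0 j)) (min_le_right _ _)
      fun h1 => ?_
    simp only [hρ']
    split_ifs with hj
    · simp
    · by_cases hjτ : j ∈ τ
      · exact hσ j hj ((min_eq_left (hτ j hjτ)).symm.trans h1)
      · simp [hρ, hp j hjτ]
  set P := (∏ k, K k) * Real.exp G with hP
  have hP0 : 0 < P := mul_pos (Finset.prod_pos fun k _ => hK k) (Real.exp_pos _)
  refine ⟨Real.exp G * (C₃ * L), by positivity, fun κ => P * ∏ j, t j (κ j),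
    (summable_finsupp_prod ht0 htsum).mul_left _,
    fun κ => mul_nonneg hP0.le (Finset.prod_nonneg fun j _ => ht0 j _), fun c hc m κ hκ => ?_⟩
  set N : ℝ := 1 + ∑ j, (κ j + m j : ℝ) with hNdef
  have hsum0 : 0 ≤ ∑ j, (κ j + m j : ℝ) := Finset.sum_nonneg fun j _ => by positivity
  have hN1 : 1 ≤ N := by linarith
  have hN0 : 0 < N := by linarith
  have hjN : ∀ j, (κ j + m j : ℝ) ≤ ∑ j, (κ j + m j : ℝ) := fun j =>
    Finset.single_le_sum (f := fun j => (κ j + m j : ℝ)) (fun i _ => by positivity)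
      (Finset.mem_univ j)
  have hκN : ∀ j, 1 + (κ j : ℝ) ≤ N := fun j => by
    have := hjN j
    have : (0 : ℝ) ≤ m j := by positivity
    linarith
  have hmN : ∀ j, 1 + (m j : ℝ) ≤ N := fun j => by
    have := hjN j
    have : (0 : ℝ) ≤ κ j := by positivity
    linarith
  set b : Fin d → ℝ := fun k => ∑ j, x j k * (κ j + m j : ℝ) with hb
  have hbN : ∀ k, |b k| ≤ D * N := fun k => by
    calc |b k| ≤ ∑ j, |x j k * (κ j + m j : ℝ)| := Finset.abs_sum_le_sum_abs _ _
      _ ≤ ∑ j, D * (κ j + m j : ℝ) := by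
        refine Finset.sum_le_sum fun j _ => ?_
        rw [abs_mul, abs_of_nonneg (by positivity : (0 : ℝ) ≤ κ j + m j)]
        gcongr
        exact hx j k
      _ ≤ D * N := by rw [← Finset.mul_sum]; gcongr; linarith
  -- With the same `N` in all `d` Gamma factors the exponents add up to `∑_k b k = ∑_j h_j (κ_j +
  -- m_j)`: for the power of `N`, only the heights survive.
  have hprod : ∏ k, ‖gammaMonomial (ℓ k) (c k - b k)‖ ≤
      (∏ k, K k) * (Real.exp (d * (D + 2) ^ 2 * N) *
        ((∏ j, N ^ (h j * κ j) * Real.exp (-y j) ^ κ j) *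
          ∏ j, N ^ (h j * m j) * Real.exp (-y j) ^ m j)) := by
    calc _ ≤ ∏ k, (K k * (Real.exp ((D + 2) ^ 2 * N) *
          (N ^ b k * Real.exp (-(b k * (ℓ k).re))))) :=
          Finset.prod_le_prod (fun _ _ => norm_nonneg _)
            fun k _ => hKb k (c k) (hc k) (b k) N hN1 (hbN k)
      _ = _ := by
        rw [Finset.prod_mul_distrib, Finset.prod_mul_distrib, Finset.prod_mul_distrib,
          ← Real.exp_sum, ← Real.exp_sum, ← Real.rpow_sum_of_pos hN0, Finset.sum_const,
          Finset.card_univ, Fintype.card_fin, nsmul_eq_mul, ← mul_assoc (d : ℝ),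
          Finset.prod_mul_distrib, Finset.prod_mul_distrib, mul_mul_mul_comm,
          ← Finset.prod_mul_distrib, ← Finset.prod_mul_distrib]
        congr 3
        · rw [← Finset.prod_congr rfl fun j _ => Real.rpow_add hN0 (h j * κ j) (h j * m j),
            ← Real.rpow_sum_of_pos hN0]
          congr 1
          simp only [hb, hh, Finset.sum_mul]
          rw [Finset.sum_comm]
          refine Finset.sum_congr rfl fun j _ => ?_
          rw [← Finset.sum_add_distrib]
          exact Finset.sum_congr rfl fun k _ => by ring
        · simp only [← Real.exp_nat_mul, ← Real.exp_add]
          rw [← Real.exp_sum]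
          congr 1
          simp only [hb, hy, Finset.sum_mul, ← Finset.sum_neg_distrib, Finset.mul_sum]
          rw [Finset.sum_comm]
          refine Finset.sum_congr rfl fun j _ => ?_
          rw [← Finset.sum_add_distrib]
          exact Finset.sum_congr rfl fun k _ => by ring
  have hw : (∏ i ∈ τᶜ, ((m i)! : ℝ)) ^ (1 - s) =
      ∏ j, (if j ∈ τ then (1 : ℝ) else ((m j)! : ℝ) ^ (1 - s)) := by
    rw [← Real.finsetProd_rpow _ _ fun i _ => by positivity, Finset.prod_ite, Finset.prod_const_one,
      one_mul]
    congr 1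
    ext; simp
  set w : Fin n → ℝ := fun j => if j ∈ τ then (1 : ℝ) else ((m j)! : ℝ) ^ (1 - s) with hwdef
  have hw0 : ∀ j, 0 ≤ w j := fun j => by simp only [hwdef]; split_ifs <;> positivity
  have hκfac : ∀ j, N ^ (h j * κ j) * Real.exp (-y j) ^ κ j * ‖p j ^ κ j / ((κ j)! : ℂ)‖ ≤
      Real.exp N * (ρ' j ^ κ j * (1 + κ j : ℝ) ^ (-((1 - h' j) * κ j))) := fun j => by
    have h1 : N ^ (h j * κ j) * Real.exp (-y j) ^ κ j * ‖p j ^ κ j / ((κ j)! : ℂ)‖ =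
        N ^ (h j * κ j) * ρ' j ^ κ j / (κ j)! := by
      have h2 : ρ' j ^ κ j = ρ j ^ κ j := by
        simp only [hρ']
        split_ifs with hj
        · simp [hκ j hj]
        · rfl
      rw [h2, hρ, norm_div, norm_pow, Complex.norm_natCast, mul_pow]; ring
    rw [h1]
    refine rpow_div_factorial_le ?_ (min_le_right _ _) (hρ'0 j) _ (hκN j)
    by_cases hjτ : j ∈ τ
    · exact Or.inl (min_eq_left (hτ j hjτ)).symm
    · right; simp [hρ', hρ, hp j hjτ]
  have hmfac : ∀ j, N ^ (h j * m j) * Real.exp (-y j) ^ m j * w j / (m j)! ≤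
      Real.exp N * (C₃ * L) ^ m j := fun j => by
    have h1 : N ^ (h j * m j) * w j / (m j)! ≤ Real.exp N * L ^ m j := by
      by_cases hjτ : j ∈ τ
      · simp only [hwdef, hjτ, if_true, mul_one]
        calc N ^ (h j * m j) / ((m j)! : ℝ) ≤ N ^ ((m j : ℕ) : ℝ) / ((m j)! : ℝ) := by
              gcongr
              exact mul_le_of_le_one_left (by positivity) (hτ j hjτ)
          _ ≤ Real.exp N := by
            rw [Real.rpow_natCast]; exact Real.pow_div_factorial_le_exp N hN0.le _
          _ ≤ _ := le_mul_of_one_le_right (Real.exp_pos _).le (one_le_pow₀ hL1)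
      · simp only [hwdef, hjτ, if_false]
        exact rpow_mul_factorial_rpow_le (hs j hjτ) _ (hmN j)
    calc _ = (N ^ (h j * m j) * w j / (m j)!) * Real.exp (-y j) ^ m j := by ring
      _ ≤ (Real.exp N * L ^ m j) * C₃ ^ m j := by
        gcongr
        exact hC₃j j
      _ = _ := by rw [mul_pow]; ring
  -- Each of the `d` Gamma factors contributes `(D + 2)^2` to the rate, and each index contributes
  -- `exp N` twice, for `κ_j` and for `m_j`. Since `N = 1 + ∑ (κ_j + m_j)`, the total splits into
  -- powers in `κ` and in `m`.
  have hexp : Real.exp (d * (D + 2) ^ 2 * N) * ((∏ _j : Fin n, Real.exp N) *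
      (∏ _j : Fin n, Real.exp N)) = Real.exp G * ((∏ j, Real.exp G ^ κ j) *
        ∏ j, Real.exp G ^ m j) := by
    simp only [← Real.exp_nat_mul, ← Real.exp_sum, ← Real.exp_add]
    congr 1
    rw [← Finset.sum_mul, ← Finset.sum_mul, ← add_mul, ← Finset.sum_add_distrib]
    simp only [Finset.sum_const, Finset.card_univ, Fintype.card_fin, nsmul_eq_mul]
    rw [hG, growthRate, hNdef, Finset.sum_add_distrib]; ring
  rw [seriesTerm, norm_mul, norm_prod, norm_prod, hw]
  calc (∏ k, ‖gammaMonomial (ℓ k) (c k - b k)‖) * (∏ j, ‖p j ^ κ j / ((κ j)! : ℂ)‖) *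
        (∏ j, w j) / ∏ j, ((m j)! : ℝ)
      ≤ ((∏ k, K k) * (Real.exp (d * (D + 2) ^ 2 * N) *
        ((∏ j, N ^ (h j * κ j) * Real.exp (-y j) ^ κ j) *
          ∏ j, N ^ (h j * m j) * Real.exp (-y j) ^ m j))) *
          (∏ j, ‖p j ^ κ j / ((κ j)! : ℂ)‖) * (∏ j, w j) / ∏ j, ((m j)! : ℝ) := by
        have := Finset.prod_nonneg fun j (_ : j ∈ Finset.univ) => hw0 j
        gcongr
    _ = (∏ k, K k) * Real.exp (d * (D + 2) ^ 2 * N) *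
        ((∏ j, N ^ (h j * κ j) * Real.exp (-y j) ^ κ j * ‖p j ^ κ j / ((κ j)! : ℂ)‖) *
          ∏ j, N ^ (h j * m j) * Real.exp (-y j) ^ m j * w j / (m j)!) := by
        simp only [Finset.prod_mul_distrib, Finset.prod_div_distrib]; ring
    _ ≤ (∏ k, K k) * Real.exp (d * (D + 2) ^ 2 * N) *
        ((∏ j, Real.exp N * (ρ' j ^ κ j * (1 + κ j : ℝ) ^ (-((1 - h' j) * κ j)))) *
          ∏ j, Real.exp N * (C₃ * L) ^ m j) := by
        have hK0 : 0 ≤ ∏ k, K k := Finset.prod_nonneg fun k _ => (hK k).le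
        refine mul_le_mul_of_nonneg_left ?_ (by positivity)
        refine mul_le_mul (Finset.prod_le_prod (fun j _ => by positivity) fun j _ => hκfac j)
          (Finset.prod_le_prod (fun j _ => ?_) fun j _ => hmfac j)
          (Finset.prod_nonneg fun j _ => ?_) (Finset.prod_nonneg fun j _ => ?_)
        · have := hw0 j; positivity
        · have := hw0 j; positivity
        · have := hρ'0 j; positivity
    _ = (∏ k, K k) * (Real.exp (d * (D + 2) ^ 2 * N) * ((∏ _j : Fin n, Real.exp N) *
        (∏ _j : Fin n, Real.exp N))) * ((∏ j, (ρ' j ^ κ j * (1 + κ j : ℝ) ^ (-((1 - h' j) * κ j)))) *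
          ∏ j, (C₃ * L) ^ m j) := by
        simp only [Finset.prod_mul_distrib]; ring
    _ = _ := by
        rw [hexp]
        simp only [ht, hP, mul_pow, Finset.prod_mul_distrib, Finset.prod_pow_eq_pow_sum]; ring

/-! ### Semicontinuity of the dimension in holomorphic families -/

/-- A linear form on `ℂ^J` killing all the columns `(v j m)_j` is a linear relation among the `v j`.
Hence the columns span, and a basis can be chosen among them. -/
theorem exists_minor_ne_zero {K J : Type*} [Fintype J] [DecidableEq J] {v : J → K → ℂ}
    (hv : LinearIndependent ℂ v) : ∃ e : J → K, (Matrix.of fun j i => v j (e i)).det ≠ 0 := by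
  have hspan : Submodule.span ℂ (Set.range fun (m : K) (j : J) => v j m) = ⊤ := by
    by_contra hne
    obtain ⟨L, hL, hle⟩ := Submodule.exists_le_ker_of_lt_top _ (lt_top_iff_ne_top.2 hne)
    apply hL
    have h0 : ∀ j, L (Pi.single j 1) = 0 := by
      refine Fintype.linearIndependent_iff.1 hv _ ?_
      funext m
      have h1 : L (fun j => v j m) = 0 := hle (Submodule.subset_span ⟨m, rfl⟩)
      rw [LinearMap.pi_apply_eq_sum_univ L] at h1
      rw [Finset.sum_apply, Pi.zero_apply, ← h1]
      refine Finset.sum_congr rfl fun j _ => ?_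
      rw [Pi.smul_apply, smul_eq_mul, smul_eq_mul, mul_comm]
      congr 2
      funext i; simp [Pi.single_apply, eq_comm]
    ext j
    simpa using h0 j
  obtain ⟨b, hb, hbspan, hbli⟩ := exists_linearIndependent ℂ (Set.range fun (m : K) (j : J) => v j m)
  rw [hspan] at hbspan
  let B : Module.Basis b ℂ (J → ℂ) := Module.Basis.mk hbli (by
    rw [Subtype.range_coe, hbspan])
  have e₀ : J ≃ b := (Pi.basisFun ℂ J).indexEquiv B
  choose e he using fun i : J => hb (e₀ i).2
  refine ⟨e, fun hdet => ?_⟩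
  have hcol : LinearIndependent ℂ (Matrix.of fun j i => v j (e i)).col := by
    have h1 : (Matrix.of fun j i => v j (e i)).col = Subtype.val ∘ e₀ := funext fun i => he i
    rw [h1]
    exact hbli.comp e₀ e₀.injective
  rw [Matrix.linearIndependent_cols_iff_isUnit, Matrix.isUnit_iff_isUnit_det, hdet] at hcol
  exact not_isUnit_zero hcol

/-- A holomorphic family, over the disc of radius `2`, of elements of the spaces `Q ε` whose
coefficients are uniformly dominated by a multiple of `B`. -/
structure IsDominatedFamily {K : Type*} (B : K → ℝ) (Q : ℂ → Submodule ℂ (K → ℂ))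
    (f : ℂ → K → ℂ) : Prop where
  differentiableOn : ∀ m, DifferentiableOn ℂ (fun ε => f ε m) (Metric.ball 0 2)
  bound : ∃ C, ∀ ε ∈ Metric.ball (0 : ℂ) 2, ∀ m, ‖f ε m‖ ≤ C * B m
  mem : ∀ ε ∈ Metric.ball (0 : ℂ) 2, f ε ∈ Q ε

/-- The spaces `Q ε` depend on `ε` in a closed way at `ε = 0`. -/
def IsClosedAtZero {K : Type*} (Q : ℂ → Submodule ℂ (K → ℂ)) : Prop :=
  ∀ f : ℂ → K → ℂ, (∀ m, ContinuousAt (fun ε => f ε m) 0) →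
    (∀ ε ∈ Metric.ball (0 : ℂ) 2, ε ≠ 0 → f ε ∈ Q ε) → f 0 ∈ Q 0

theorem IsDominatedFamily.sum_smul {K J : Type*} [Fintype J] {B : K → ℝ}
    {Q : ℂ → Submodule ℂ (K → ℂ)} {F : J → ℂ → K → ℂ} (hF : ∀ j, IsDominatedFamily B Q (F j))
    (c : J → ℂ) : IsDominatedFamily B Q fun ε => ∑ j, c j • F j ε where
  differentiableOn m := by
    simp only [Finset.sum_apply, Pi.smul_apply, smul_eq_mul]
    exact DifferentiableOn.fun_sum fun j _ => ((hF j).differentiableOn m).const_mul _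
  bound := by
    choose C hC using fun j => (hF j).bound
    refine ⟨∑ j, ‖c j‖ * C j, fun ε hε m => ?_⟩
    rw [Finset.sum_apply, Finset.sum_mul]
    refine (norm_sum_le _ _).trans (Finset.sum_le_sum fun j _ => ?_)
    rw [Pi.smul_apply, norm_smul, mul_assoc]
    gcongr
    exact hC j ε hε m
  mem ε hε := Submodule.sum_mem _ fun j _ => Submodule.smul_mem _ _ ((hF j).mem ε hε)

/-- The Schwarz lemma on the disc of radius 2 bounds the difference quotient by half the old bound,
so the domination persists; membership at `ε = 0` is what `IsClosedAtZero` provides. -/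
theorem IsDominatedFamily.exists_div {K : Type*} {B : K → ℝ} {Q : ℂ → Submodule ℂ (K → ℂ)}
    (hQ : IsClosedAtZero Q) {f : ℂ → K → ℂ} (hf : IsDominatedFamily B Q f) (h0 : f 0 = 0) :
    ∃ g, IsDominatedFamily B Q g ∧ ∀ ε, ε • g ε = f ε := by
  have hball : Metric.ball (0 : ℂ) 2 ∈ nhds (0 : ℂ) := Metric.ball_mem_nhds _ two_pos
  set g : ℂ → K → ℂ := fun ε m => dslope (fun ε => f ε m) 0 ε with hg
  have hdiff : ∀ m, DifferentiableOn ℂ (fun ε => g ε m) (Metric.ball 0 2) := fun m =>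
    (Complex.differentiableOn_dslope hball).2 (hf.differentiableOn m)
  have hmul : ∀ ε, ε • g ε = f ε := fun ε => by
    funext m
    have := sub_smul_dslope (fun ε => f ε m) 0 ε
    simpa [h0] using this
  have hmem : ∀ ε ∈ Metric.ball (0 : ℂ) 2, ε ≠ 0 → g ε ∈ Q ε := fun ε hε hne => by
    have h1 : g ε = ε⁻¹ • f ε := by rw [← hmul, smul_smul, inv_mul_cancel₀ hne, one_smul]
    rw [h1]
    exact Submodule.smul_mem _ _ (hf.mem ε hε)
  obtain ⟨C, hC⟩ := hf.bound
  refine ⟨g, ⟨hdiff, ⟨C, fun ε hε m => ?_⟩, fun ε hε => ?_⟩, hmul⟩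
  · have hmaps : Set.MapsTo (fun ε => f ε m) (Metric.ball 0 2)
        (Metric.closedBall ((fun ε => f ε m) 0) (C * B m)) := fun z hz => by
      simpa [h0] using hC z hz m
    have hCB : 0 ≤ C * B m := (norm_nonneg _).trans (hC 0 (by simp) m)
    refine (Complex.norm_dslope_le_div_of_mapsTo_ball (hf.differentiableOn m) hmaps hε).trans ?_
    linarith
  · by_cases hne : ε = 0
    · subst hne
      exact hQ g (fun m => ((hdiff m).differentiableAt hball).continuousAt) hmem
    · exact hmem ε hε hne

/-- Induction on the order of vanishing of the determinant. If the family is dependent at 0, some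
combination vanishes there; replacing one member by that combination divided by `ε` multiplies the
determinant by a nonzero constant over `ε`, and the order drops by one. At order 0 the determinant
itself shows independence. -/
theorem exists_linearIndependent_of_det {K J : Type*} [Fintype J] [DecidableEq J] {B : K → ℝ}
    {Q : ℂ → Submodule ℂ (K → ℂ)} (hQ : IsClosedAtZero Q) (e : J → K) (k : ℕ) (E : ℂ → ℂ)
    (hE : ContinuousAt E 0) (hE0 : E 0 ≠ 0) (F : J → ℂ → K → ℂ)
    (hF : ∀ j, IsDominatedFamily B Q (F j))
    (hdet : ∀ᶠ ε in nhdsWithin (0 : ℂ) {0}ᶜ,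
      (Matrix.of fun j i => F j ε (e i)).det = ε ^ k * E ε) :
    ∃ G : J → ℂ → K → ℂ, (∀ j, IsDominatedFamily B Q (G j)) ∧
      LinearIndependent ℂ fun j => G j 0 := by
  have hball : Metric.ball (0 : ℂ) 2 ∈ nhds (0 : ℂ) := Metric.ball_mem_nhds _ two_pos
  induction k generalizing F E with
  | zero =>
    refine ⟨F, hF, ?_⟩
    have hcont : ContinuousAt (fun ε => (Matrix.of fun j i => F j ε (e i)).det) 0 := by
      have : ContinuousAt (fun ε => (Matrix.of fun j i => F j ε (e i))) 0 :=
        continuousAt_pi.2 fun j => continuousAt_pi.2 fun i =>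
          (((hF j).differentiableOn (e i)).differentiableAt hball).continuousAt
      exact ContinuousAt.comp (Continuous.matrix_det continuous_id).continuousAt this
    have h1 : (Matrix.of fun j i => F j 0 (e i)).det = E 0 := by
      refine tendsto_nhds_unique (l := nhdsWithin (0 : ℂ) {0}ᶜ)
        (hcont.tendsto.mono_left nhdsWithin_le_nhds) ?_
      refine (hE.tendsto.mono_left nhdsWithin_le_nhds).congr' ?_
      filter_upwards [hdet] with ε hε
      rw [hε, pow_zero, one_mul]
    have h2 : IsUnit (Matrix.of fun j i => F j 0 (e i)) := by
      rw [Matrix.isUnit_iff_isUnit_det, h1]; exact hE0.isUnit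
    rw [← Matrix.linearIndependent_rows_iff_isUnit] at h2
    exact LinearIndependent.of_comp (LinearMap.funLeft ℂ ℂ e) h2
  | succ k ih =>
    by_cases hli : LinearIndependent ℂ fun j => F j 0
    · exact ⟨F, hF, hli⟩
    obtain ⟨c, hc, j₀, hj₀⟩ := Fintype.not_linearIndependent_iff.1 hli
    obtain ⟨g, hg, hgm⟩ := (IsDominatedFamily.sum_smul hF c).exists_div hQ hc
    refine ih (fun ε => c j₀ * E ε) (hE.const_mul _) (mul_ne_zero hj₀ hE0) (Function.update F j₀ g)
      (fun j => ?_) ?_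
    · by_cases hj : j = j₀
      · subst hj; simpa using hg
      · simpa [hj] using hF j
    · filter_upwards [hdet, self_mem_nhdsWithin] with ε hε hne
      have hne : ε ≠ 0 := hne
      set M : Matrix J J ℂ := Matrix.of fun j i => F j ε (e i) with hM
      have h1 : (Matrix.of fun j i => Function.update F j₀ g j ε (e i)) =
          M.updateRow j₀ (fun i => g ε (e i)) := by
        ext j i
        by_cases hj : j = j₀
        · subst hj; simp
        · simp [hj, hM]
      have h2 : (M.updateRow j₀ (ε • fun i => g ε (e i))).det = c j₀ * M.det := by
        have h3 : (ε • fun i => g ε (e i)) = ∑ j, c j • M j := by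
          funext i
          have := congrFun (hgm ε) (e i)
          simp only [Pi.smul_apply, Finset.sum_apply] at this
          simpa [hM] using this
        rw [h3, Matrix.det_updateRow_sum, smul_eq_mul]
      rw [Matrix.det_updateRow_smul, hε] at h2
      rw [h1]
      apply mul_left_cancel₀ hne
      rw [h2]; ring

/-- If a finite holomorphic family is linearly independent at `ε = 1`, then the space `Q 0` at
`ε = 0` contains as many linearly independent elements with the same growth. -/
theorem exists_linearIndependent_at_zero {K J : Type*} [Finite J] {B : K → ℝ}
    {Q : ℂ → Submodule ℂ (K → ℂ)} (hQ : IsClosedAtZero Q) (F : J → ℂ → K → ℂ)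
    (hF : ∀ j, IsDominatedFamily B Q (F j)) (hli : LinearIndependent ℂ fun j => F j 1) :
    ∃ G : J → K → ℂ, LinearIndependent ℂ G ∧ ∀ j, G j ∈ Q 0 ∧ ∃ C, ∀ m, ‖G j m‖ ≤ C * B m := by
  classical
  have := Fintype.ofFinite J
  have hball : Metric.ball (0 : ℂ) 2 ∈ nhds (0 : ℂ) := Metric.ball_mem_nhds _ two_pos
  obtain ⟨e, he⟩ := exists_minor_ne_zero hli
  have hdiff : DifferentiableOn ℂ (fun ε => (Matrix.of fun j i => F j ε (e i)).det)
      (Metric.ball 0 2) := by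
    simp only [Matrix.det_apply]
    refine DifferentiableOn.fun_sum fun π _ => DifferentiableOn.const_smul ?_ _
    exact DifferentiableOn.fun_finsetProd fun i _ => (hF _).differentiableOn _
  have han := hdiff.analyticOnNhd Metric.isOpen_ball
  -- By the identity theorem, the minor that is nonzero at `ε = 1` has a zero of finite order at `ε
  -- = 0`.
  have hnot : ¬ ∀ᶠ ε in nhds (0 : ℂ), (Matrix.of fun j i => F j ε (e i)).det = 0 := fun h0 => by
    have := han.eqOn_zero_of_preconnected_of_eventuallyEq_zero
      (convex_ball (0 : ℂ) 2).isPreconnected (Metric.mem_ball_self two_pos) h0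
    exact he (this (by simp : (1 : ℂ) ∈ Metric.ball (0 : ℂ) 2))
  obtain ⟨k, E, hE, hE0, hev⟩ :=
    ((han 0 (Metric.mem_ball_self two_pos)).exists_eventuallyEq_pow_smul_nonzero_iff).2 hnot
  obtain ⟨G, hG, hGli⟩ := exists_linearIndependent_of_det hQ e k E hE.continuousAt hE0 F hF
    (Filter.Eventually.filter_mono nhdsWithin_le_nhds (by simpa using hev))
  refine ⟨fun j => G j 0, hGli, fun j => ⟨(hG j).mem 0 (by simp), ?_⟩⟩
  obtain ⟨C, hC⟩ := (hG j).bound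
  exact ⟨C, fun m => hC 0 (by simp) m⟩

/-! ### Discrete measures with vanishing factorial moments -/

/-- The falling factorial `x (x - 1) ⋯ (x - k + 1)`. -/
def fallingFactorial (x : ℂ) (k : ℕ) : ℂ := ∏ l ∈ Finset.range k, (x - l)

theorem fallingFactorial_succ (x : ℂ) (k : ℕ) :
    fallingFactorial x (k + 1) = fallingFactorial x k * (x - k) :=
  Finset.prod_range_succ _ _

theorem exists_fallingFactorial_bound (k : ℕ) {δ : ℝ} (hδ : 0 < δ) :
    ∃ C : ℝ, 0 ≤ C ∧ ∀ x : ℝ, ‖fallingFactorial x k‖ ≤ C * Real.exp (δ * |x|) := by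
  induction k generalizing δ with
  | zero =>
    refine ⟨1, zero_le_one, fun x => ?_⟩
    have : (0 : ℝ) ≤ δ * |x| := by positivity
    simpa [fallingFactorial] using this
  | succ k ih =>
    obtain ⟨C, hC, h⟩ := ih (half_pos hδ)
    refine ⟨C * (2 / δ + k), by positivity, fun x => ?_⟩
    have h1 : ‖(x : ℂ) - k‖ ≤ |x| + k := by
      refine (norm_sub_le _ _).trans ?_
      simp
    have h2 : |x| + k ≤ (2 / δ + k) * Real.exp (δ / 2 * |x|) := by
      have h3 := Real.add_one_le_exp (δ / 2 * |x|)
      have h4 : (0 : ℝ) ≤ δ / 2 * |x| := by positivity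
      have h5 : |x| ≤ 2 / δ * Real.exp (δ / 2 * |x|) := by
        rw [div_mul_eq_mul_div, le_div_iff₀ hδ]; linarith
      have h6 : (k : ℝ) ≤ k * Real.exp (δ / 2 * |x|) :=
        le_mul_of_one_le_right (by positivity) (by linarith)
      linarith
    rw [fallingFactorial_succ, norm_mul]
    calc _ ≤ (C * Real.exp (δ / 2 * |x|)) * ((2 / δ + k) * Real.exp (δ / 2 * |x|)) := by
          gcongr
          · exact h x
          · exact h1.trans h2
      _ = C * (2 / δ + k) * Real.exp (δ / 2 * |x| + δ / 2 * |x|) := by rw [Real.exp_add]; ring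
      _ = _ := by ring_nf

/-- The discrete complex measure with mass `a v` at `lam v` has exponential moments of order `δ` in
the coordinates in `Z`. -/
def HasExpMoment {V : Type*} {n : ℕ} (Z : Finset (Fin n)) (lam : V → Fin n → ℝ) (δ : ℝ)
    (a : V → ℂ) : Prop :=
  Summable fun v => ‖a v‖ * Real.exp (δ * ∑ i ∈ Z, |lam v i|)

/-- All factorial moments in the coordinates in `Z` vanish. -/
def HasVanishingMoments {V : Type*} {n : ℕ} (Z : Finset (Fin n)) (lam : V → Fin n → ℝ)
    (a : V → ℂ) : Prop :=
  ∀ m : Fin n → ℕ, ∑' v, a v * ∏ i ∈ Z, fallingFactorial (lam v i) (m i) = 0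

section

variable {V : Type*} {n : ℕ} {Z : Finset (Fin n)} {lam : V → Fin n → ℝ} {δ : ℝ} {a : V → ℂ}

theorem exists_prod_fallingFactorial_bound (Z : Finset (Fin n)) (m : Fin n → ℕ) (hδ : 0 < δ) :
    ∃ C : ℝ, 0 ≤ C ∧ ∀ x : Fin n → ℝ, ‖∏ i ∈ Z, fallingFactorial (x i) (m i)‖ ≤
      C * Real.exp (δ * ∑ i ∈ Z, |x i|) := by
  choose C hC h using fun i => exists_fallingFactorial_bound (m i) hδ
  refine ⟨∏ i ∈ Z, C i, Finset.prod_nonneg fun i _ => hC i, fun x => ?_⟩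
  rw [norm_prod, Finset.mul_sum, Real.exp_sum, ← Finset.prod_mul_distrib]
  exact Finset.prod_le_prod (fun _ _ => norm_nonneg _) fun i _ => h i (x i)

theorem HasExpMoment.of_norm_le (ha : HasExpMoment Z lam δ a) {b : V → ℂ}
    (hb : ∀ v, ‖b v‖ ≤ ‖a v‖) : HasExpMoment Z lam δ b :=
  Summable.of_nonneg_of_le (fun v => by positivity)
    (fun v => mul_le_mul_of_nonneg_right (hb v) (Real.exp_pos _).le) ha

theorem HasExpMoment.summable_of_le (ha : HasExpMoment Z lam δ a) {b : V → ℂ} {C : ℝ}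
    (hb : ∀ v, ‖b v‖ ≤ ‖a v‖ * (C * Real.exp (δ * ∑ i ∈ Z, |lam v i|))) :
    Summable fun v => ‖b v‖ :=
  Summable.of_nonneg_of_le (fun v => norm_nonneg _) (fun v => (hb v).trans_eq (by ring))
    (ha.mul_left C)

theorem HasExpMoment.summable (ha : HasExpMoment Z lam δ a) (hδ : 0 < δ) (m : Fin n → ℕ) :
    Summable fun v => ‖a v * ∏ i ∈ Z, fallingFactorial (lam v i) (m i)‖ := by
  obtain ⟨C, hC, h⟩ := exists_prod_fallingFactorial_bound Z m hδ
  refine ha.summable_of_le (C := C) fun v => ?_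
  rw [norm_mul]
  exact mul_le_mul_of_nonneg_left (h _) (norm_nonneg _)

/-- `x [x]_k = [x]_{k+1} + k [x]_k` for the falling factorial `[x]_k`. -/
theorem HasVanishingMoments.mul_coord (ha : HasExpMoment Z lam δ a) (hδ : 0 < δ)
    (h0 : HasVanishingMoments Z lam a) {i : Fin n} (hi : i ∈ Z) :
    HasVanishingMoments Z lam fun v => (lam v i : ℂ) * a v := fun m => by
  have h1 : ∀ v, (lam v i : ℂ) * a v * ∏ j ∈ Z, fallingFactorial (lam v j) (m j) =
      a v * ∏ j ∈ Z, fallingFactorial (lam v j) (Function.update m i (m i + 1) j) +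
        m i * (a v * ∏ j ∈ Z, fallingFactorial (lam v j) (m j)) := fun v => by
    have h2 : ∏ j ∈ Z.erase i, fallingFactorial (lam v j) (Function.update m i (m i + 1) j) =
        ∏ j ∈ Z.erase i, fallingFactorial (lam v j) (m j) :=
      Finset.prod_congr rfl fun j hj => by rw [Function.update_of_ne (Finset.ne_of_mem_erase hj)]
    rw [← Finset.mul_prod_erase _ _ hi, ← Finset.mul_prod_erase _ _ hi, h2, Function.update_self,
      fallingFactorial_succ]
    ring
  rw [tsum_congr h1, Summable.tsum_add (ha.summable hδ _).of_norm
    ((ha.summable hδ m).of_norm.mul_left _), tsum_mul_left, h0, h0]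
  simp

theorem HasExpMoment.mul_coord (ha : HasExpMoment Z lam δ a) {i : Fin n}
    (hi : i ∈ Z) {δ' : ℝ} (hδ' : δ' < δ) :
    HasExpMoment Z lam δ' fun v => (lam v i : ℂ) * a v := by
  have hd : 0 < δ - δ' := sub_pos.2 hδ'
  refine Summable.of_nonneg_of_le (fun v => by positivity) (fun v => ?_) (ha.mul_left (1 / (δ - δ')))
  have h1 : |lam v i| ≤ ∑ j ∈ Z, |lam v j| :=
    Finset.single_le_sum (f := fun j => |lam v j|) (fun _ _ => abs_nonneg _) hi
  set S := ∑ j ∈ Z, |lam v j| with hS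
  have h2 : S ≤ 1 / (δ - δ') * Real.exp ((δ - δ') * S) := by
    rw [div_mul_eq_mul_div, le_div_iff₀ hd, one_mul]
    have := Real.add_one_le_exp ((δ - δ') * S)
    linarith
  rw [norm_mul, Complex.norm_real, Real.norm_eq_abs]
  calc |lam v i| * ‖a v‖ * Real.exp (δ' * S)
      ≤ (1 / (δ - δ') * Real.exp ((δ - δ') * S)) * ‖a v‖ * Real.exp (δ' * S) := by
        gcongr; exact h1.trans h2
    _ = 1 / (δ - δ') * (‖a v‖ * Real.exp ((δ - δ') * S + δ' * S)) := by rw [Real.exp_add]; ring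
    _ = _ := by ring_nf

theorem HasVanishingMoments.mul_coord_pow (ha : HasExpMoment Z lam δ a) (hδ : 0 < δ)
    (h0 : HasVanishingMoments Z lam a) {i : Fin n} (hi : i ∈ Z) (k : ℕ) :
    HasVanishingMoments Z lam (fun v => (lam v i : ℂ) ^ k * a v) ∧
      ∃ δ' : ℝ, 0 < δ' ∧ HasExpMoment Z lam δ' fun v => (lam v i : ℂ) ^ k * a v := by
  induction k with
  | zero => simpa using ⟨h0, δ, hδ, ha⟩
  | succ k ih =>
    obtain ⟨h1, δ', hδ', h2⟩ := ih
    have h3 := h1.mul_coord h2 hδ' hi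
    have h4 := h2.mul_coord hi (half_lt_self hδ')
    simp only [← mul_assoc, ← pow_succ'] at h3 h4
    exact ⟨h3, δ' / 2, half_pos hδ', h4⟩

/-- The exponential is expanded in powers of the coordinate and the sums are interchanged. The bound
`|θ| ≤ δ / 2` spends half of the exponential moment on the expansion and leaves the other half for
the falling factorials. -/
theorem HasVanishingMoments.mul_exp (ha : HasExpMoment Z lam δ a) (hδ : 0 < δ)
    (h0 : HasVanishingMoments Z lam a) {i : Fin n} (hi : i ∈ Z) {θ : ℝ} (hθ : |θ| ≤ δ / 2) :
    HasVanishingMoments Z lam fun v => Complex.exp (θ * lam v i * Complex.I) * a v := fun m => by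
  obtain ⟨C, hC, h⟩ := exists_prod_fallingFactorial_bound Z m (half_pos hδ)
  set P : V → ℂ := fun v => ∏ j ∈ Z, fallingFactorial (lam v j) (m j) with hP
  set f : V → ℕ → ℂ := fun v k => (θ * lam v i * Complex.I) ^ k / k ! * (a v * P v) with hf
  have hnorm : ∀ v k, ‖f v k‖ = (|θ| * |lam v i|) ^ k / k ! * ‖a v * P v‖ := fun v k => by
    simp [hf, norm_pow]
  have hexpn : ∀ v, HasSum (fun k => ‖f v k‖) (Real.exp (|θ| * |lam v i|) * ‖a v * P v‖) :=
    fun v => by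
      simp only [hnorm]
      have := NormedSpace.expSeries_div_hasSum_exp (𝔸 := ℝ) (|θ| * |lam v i|)
      rw [← Real.exp_eq_exp_ℝ] at this
      exact this.mul_right _
  have hexp : ∀ v, ∑' k, f v k = Complex.exp (θ * lam v i * Complex.I) * a v * P v := fun v => by
    have := NormedSpace.expSeries_div_hasSum_exp (𝔸 := ℂ) (θ * lam v i * Complex.I)
    rw [← Complex.exp_eq_exp_ℂ] at this
    rw [mul_assoc]
    exact (this.mul_right _).tsum_eq
  have hsum : Summable (Function.uncurry f) := by
    refine Summable.of_norm ?_
    refine (summable_prod_of_nonneg fun _ => norm_nonneg _).2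
      ⟨fun v => (hexpn v).summable, ?_⟩
    simp only [Function.uncurry_apply_pair, (hexpn _).tsum_eq]
    refine Summable.of_nonneg_of_le (fun v => by positivity) (fun v => ?_) (ha.mul_left C)
    have h1 : |lam v i| ≤ ∑ j ∈ Z, |lam v j| :=
      Finset.single_le_sum (f := fun j => |lam v j|) (fun _ _ => abs_nonneg _) hi
    rw [norm_mul]
    calc _ ≤ Real.exp (δ / 2 * ∑ j ∈ Z, |lam v j|) *
          (‖a v‖ * (C * Real.exp (δ / 2 * ∑ j ∈ Z, |lam v j|))) := by
          gcongr
          exact h _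
      _ = C * (‖a v‖ * Real.exp (δ / 2 * ∑ j ∈ Z, |lam v j| + δ / 2 * ∑ j ∈ Z, |lam v j|)) := by
          rw [Real.exp_add]; ring
      _ = _ := by ring_nf
  rw [← tsum_congr hexp, ← hsum.tsum_comm]
  refine (tsum_congr fun k => ?_).trans tsum_zero
  have h1 := (h0.mul_coord_pow ha hδ hi k).1 m
  calc ∑' v, f v k = ∑' v, ((θ * Complex.I) ^ k / k !) * ((lam v i : ℂ) ^ k * a v * P v) :=
        tsum_congr fun v => by simp only [hf, mul_pow]; ring
    _ = 0 := by rw [tsum_mul_left, h1, mul_zero]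

theorem norm_exp_ofReal_mul_I_mul (θ x : ℝ) (z : ℂ) :
    ‖Complex.exp (θ * x * Complex.I) * z‖ = ‖z‖ := by
  rw [norm_mul, ← Complex.ofReal_mul, Complex.norm_exp_ofReal_mul_I, one_mul]

/-- A unimodular factor loses nothing of the exponential moment, so small angles can be added up
without limit. -/
theorem HasVanishingMoments.mul_exp_nat (ha : HasExpMoment Z lam δ a) (hδ : 0 < δ)
    (h0 : HasVanishingMoments Z lam a) {i : Fin n} (hi : i ∈ Z) {θ : ℝ} (hθ : |θ| ≤ δ / 2)
    (k : ℕ) : HasVanishingMoments Z lam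
      (fun v => Complex.exp (θ * lam v i * Complex.I) ^ k * a v) ∧
      HasExpMoment Z lam δ fun v => Complex.exp (θ * lam v i * Complex.I) ^ k * a v := by
  induction k with
  | zero => simpa using ⟨h0, ha⟩
  | succ k ih =>
    have h3 := ih.1.mul_exp ih.2 hδ hi hθ
    have h4 : HasExpMoment Z lam δ fun v => Complex.exp (θ * lam v i * Complex.I) *
        (Complex.exp (θ * lam v i * Complex.I) ^ k * a v) :=
      ih.2.of_norm_le fun v => (norm_exp_ofReal_mul_I_mul _ _ _).le
    simp only [← mul_assoc, ← pow_succ'] at h3 h4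
    exact ⟨h3, h4⟩

theorem tendsto_mean_pow {u : ℂ} (hu : ‖u‖ = 1) :
    Filter.Tendsto (fun N : ℕ => (∑ k ∈ Finset.range N, u ^ k) / N) Filter.atTop
      (nhds (if u = 1 then 1 else 0)) := by
  split_ifs with h
  · subst h
    refine tendsto_const_nhds.congr' ?_
    filter_upwards [Filter.eventually_gt_atTop 0] with N hN
    have : (N : ℂ) ≠ 0 := by exact_mod_cast hN.ne'
    simp [this]
  · rw [tendsto_zero_iff_norm_tendsto_zero]
    have hne : 0 < ‖u - 1‖ := norm_pos_iff.2 (sub_ne_zero.2 h)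
    refine squeeze_zero (fun _ => norm_nonneg _) (g := fun N : ℕ => 2 / ‖u - 1‖ / (N : ℝ))
      (fun N => ?_) (tendsto_const_div_atTop_nhds_zero_nat _)
    rw [geom_sum_eq h, norm_div, norm_div, Complex.norm_natCast]
    gcongr
    refine (norm_sub_le _ _).trans ?_
    rw [norm_pow, hu]; norm_num

/-- Each pair of a nonzero value `f v` and an integer excludes a single angle, so only countably
many are excluded. -/
theorem exists_angle [Countable V] (f : V → ℝ) (hδ : 0 < δ) :
    ∃ θ : ℝ, 0 < θ ∧ θ < δ ∧ ∀ v, Complex.exp (θ * f v * Complex.I) = 1 → f v = 0 := by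
  have hc : (⋃ v, ⋃ z : ℤ, {θ : ℝ | f v ≠ 0 ∧ θ = z * (2 * Real.pi) / f v}).Countable := by
    refine Set.countable_iUnion fun v => Set.countable_iUnion fun z => ?_
    exact (Set.countable_singleton (z * (2 * Real.pi) / f v)).mono fun θ hθ => hθ.2
  obtain ⟨θ, hθ, h0, h1⟩ := (hc.dense_compl ℝ).exists_between hδ
  refine ⟨θ, h0, h1, fun v hv => by_contra fun hne => hθ ?_⟩
  obtain ⟨z, hz⟩ := Complex.exp_eq_one_iff.1 hv
  refine Set.mem_iUnion.2 ⟨v, Set.mem_iUnion.2 ⟨z, hne, ?_⟩⟩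
  rw [eq_div_iff hne]
  have h2 : ((θ * f v : ℝ) : ℂ) = ((z * (2 * Real.pi) : ℝ) : ℂ) := by
    apply mul_right_cancel₀ Complex.I_ne_zero
    push_cast
    rw [hz]; ring
  exact_mod_cast h2

-- The mean of the powers of `exp(iθ(λ_i - μ))` tends to the indicator of `λ_i = μ` for a suitable
-- small `θ`. Every mean has vanishing moments, and dominated convergence carries this to the limit.
open Classical in
theorem HasVanishingMoments.restrict_coord [Countable V] (ha : HasExpMoment Z lam δ a)
    (hδ : 0 < δ) (h0 : HasVanishingMoments Z lam a) {i : Fin n} (hi : i ∈ Z) (μ : ℝ) :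
    HasVanishingMoments Z lam fun v => if lam v i = μ then a v else 0 := fun m => by
  obtain ⟨θ, hθ0, hθ1, hθ⟩ := exists_angle (fun v => lam v i - μ) (half_pos hδ)
  set P : V → ℂ := fun v => ∏ j ∈ Z, fallingFactorial (lam v j) (m j) with hP
  set u : V → ℂ := fun v => Complex.exp (θ * (lam v i - μ : ℝ) * Complex.I) with hu
  have hu1 : ∀ v, ‖u v‖ = 1 := fun v => by
    simp only [hu]
    rw [← Complex.ofReal_mul, Complex.norm_exp_ofReal_mul_I]
  have huμ : ∀ v, u v = 1 ↔ lam v i = μ := fun v =>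
    ⟨fun h => sub_eq_zero.1 (hθ v h), fun h => by simp [hu, h]⟩
  have hmom : ∀ k : ℕ, ∑' v, u v ^ k * (a v * P v) = 0 := fun k => by
    have h1 := (h0.mul_exp_nat ha hδ hi (by rw [abs_of_pos hθ0]; exact hθ1.le) k).1 m
    calc ∑' v, u v ^ k * (a v * P v) = ∑' v, Complex.exp (-(θ * μ * Complex.I)) ^ k *
          (Complex.exp (θ * lam v i * Complex.I) ^ k * a v * P v) := tsum_congr fun v => by
            have : u v = Complex.exp (-(θ * μ * Complex.I)) *
                Complex.exp (θ * lam v i * Complex.I) := by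
              simp only [hu]
              rw [← Complex.exp_add]
              congr 1; push_cast; ring
            rw [this, mul_pow]; ring
      _ = 0 := by rw [tsum_mul_left, h1, mul_zero]
  have hs := ha.summable hδ m
  have hsk : ∀ k : ℕ, Summable fun v => u v ^ k * (a v * P v) := fun k => by
    refine Summable.of_norm (hs.congr fun v => ?_)
    rw [norm_mul (u v ^ k), norm_pow, hu1, one_pow, one_mul]
  have hlim : Filter.Tendsto (fun N : ℕ => ∑' v, (∑ k ∈ Finset.range N, u v ^ k) / N * (a v * P v))
      Filter.atTop (nhds (∑' v, (if u v = 1 then 1 else 0) * (a v * P v))) := by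
    refine tendsto_tsum_of_dominated_convergence hs
      (fun v => (tendsto_mean_pow (hu1 v)).mul_const _) (Filter.Eventually.of_forall fun N v => ?_)
    rw [norm_mul]
    refine mul_le_of_le_one_left (norm_nonneg _) ?_
    rw [norm_div, Complex.norm_natCast]
    refine div_le_one_of_le₀ ((norm_sum_le _ _).trans ?_) (Nat.cast_nonneg N)
    simp [norm_pow, hu1]
  have hzero : ∀ N : ℕ, ∑' v, (∑ k ∈ Finset.range N, u v ^ k) / N * (a v * P v) = 0 := fun N => by
    calc _ = ∑' v, (N : ℂ)⁻¹ * ∑ k ∈ Finset.range N, u v ^ k * (a v * P v) :=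
          tsum_congr fun v => by rw [← Finset.sum_mul]; ring
      _ = 0 := by
        rw [tsum_mul_left, Summable.tsum_finsetSum fun k _ => hsk k]
        simp [hmom]
  simp only [hzero] at hlim
  refine Eq.trans (tsum_congr fun v => ?_) (tendsto_nhds_unique hlim tendsto_const_nhds)
  simp only [huμ]
  split_ifs <;> simp [hP]

-- The restriction to one value is repeated for each coordinate in `Z`; the moment of order 0 of the
-- result is the mass of the fibre.
open Classical in
theorem tsum_fiber_eq_zero [Countable V] (ha : HasExpMoment Z lam δ a) (hδ : 0 < δ)
    (h0 : HasVanishingMoments Z lam a) (μ : Fin n → ℝ) :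
    ∑' v, (if ∀ i ∈ Z, lam v i = μ i then a v else 0) = 0 := by
  have key : ∀ S ⊆ Z, HasVanishingMoments Z lam
      fun v => if ∀ i ∈ S, lam v i = μ i then a v else 0 := fun S => by
    induction S using Finset.induction_on with
    | empty => intro _; simpa using h0
    | insert i S _ ih =>
      intro hS
      have h1 := ih ((Finset.subset_insert _ _).trans hS)
      have h2 : HasExpMoment Z lam δ fun v => if ∀ i ∈ S, lam v i = μ i then a v else 0 :=
        ha.of_norm_le fun v => by split_ifs <;> simp
      have h3 := h1.restrict_coord h2 hδ (hS (Finset.mem_insert_self i S)) (μ i)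
      intro m
      refine Eq.trans (tsum_congr fun v => ?_) (h3 m)
      simp only [Finset.forall_mem_insert, ite_and]
  have := key Z subset_rfl 0
  simpa [fallingFactorial] using this

end

/-! ### Hypergeometric series attached to a simplex -/

/-- The vector `A m ∈ ℤ^d`. -/
def weight {d n : ℕ} (A : Matrix (Fin d) (Fin n) ℤ) (m : Fin n →₀ ℕ) : Fin d → ℤ :=
  A.mulVec fun j => (m j : ℤ)

/-- The lattice `ℤA_σ` generated by the columns in `σ`. -/
def simplexLattice {d n : ℕ} (A : Matrix (Fin d) (Fin n) ℤ) (σ : Finset (Fin n)) :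
    AddSubgroup (Fin d → ℤ) :=
  AddSubgroup.closure ((fun (j : Fin n) (i : Fin d) => A i j) '' (σ : Set (Fin n)))

theorem weight_add {d n : ℕ} (A : Matrix (Fin d) (Fin n) ℤ) (m m' : Fin n →₀ ℕ) :
    weight A (m + m') = weight A m + weight A m' := by
  rw [weight, weight, weight, ← Matrix.mulVec_add]
  exact congrArg A.mulVec (funext fun j => by simp)

theorem weight_single {d n : ℕ} (A : Matrix (Fin d) (Fin n) ℤ) (j : Fin n) (k : ℕ) (i : Fin d) :
    weight A (Finsupp.single j k) i = A i j * k := by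
  rw [weight, Matrix.mulVec, dotProduct, Finset.sum_eq_single j]
  · simp
  · intro b _ hb; simp [hb.symm]
  · simp

theorem weight_apply {d n : ℕ} (A : Matrix (Fin d) (Fin n) ℤ) (m : Fin n →₀ ℕ) (i : Fin d) :
    weight A m i = ∑ j, A i j * m j := rfl

section Coordinates

variable {d n : ℕ} (A : Matrix (Fin d) (Fin n) ℤ) (σ : Finset (Fin n)) (h : σ.card = d)

theorem mulVec_simplexCoord (hdet : IsUnit (subMatrix A σ h).det) (j : Fin n) :
    (subMatrix A σ h).mulVec (simplexCoord A σ h j) = col A j := by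
  rw [simplexCoord, Matrix.mulVec_mulVec, Matrix.mul_nonsing_inv _ hdet, Matrix.one_mulVec]

theorem simplexCoord_vertex (hdet : IsUnit (subMatrix A σ h).det) (k k' : Fin d) :
    simplexCoord A σ h (σ.orderEmbOfFin h k) k' = if k = k' then 1 else 0 := by
  have h1 : (subMatrix A σ h).mulVec (Pi.single k 1) = col A (σ.orderEmbOfFin h k) := by
    rw [Matrix.mulVec_single_one]; rfl
  rw [simplexCoord, ← h1, Matrix.mulVec_mulVec, Matrix.nonsing_inv_mul _ hdet, Matrix.one_mulVec,
    Pi.single_apply]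
  simp [eq_comm]

theorem sum_simplexCoord_mul (m : Fin n →₀ ℕ) (k : Fin d) :
    ∑ j, simplexCoord A σ h j k * (m j : ℝ) =
      (subMatrix A σ h)⁻¹.mulVec (fun i => (weight A m i : ℝ)) k := by
  have h1 : (fun i => (weight A m i : ℝ)) = ∑ j, (m j : ℝ) • col A j := by
    funext i
    rw [weight_apply, Finset.sum_apply]
    push_cast
    exact Finset.sum_congr rfl fun j _ => by simp [col, mul_comm]
  rw [h1, Matrix.mulVec_sum, Finset.sum_apply]
  refine Finset.sum_congr rfl fun j _ => ?_
  rw [Matrix.mulVec_smul, Pi.smul_apply, smul_eq_mul, mul_comm]; rfl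

theorem exists_orderEmbOfFin {i : Fin n} (hi : i ∈ σ) : ∃ k, σ.orderEmbOfFin h k = i := by
  have : i ∈ Set.range (σ.orderEmbOfFin h) := by
    rw [Finset.range_orderEmbOfFin]; exact hi
  exact this

end Coordinates

/-- The logarithms of the coordinates of `p` in `σ`. -/
def simplexLog {d n : ℕ} (σ : Finset (Fin n)) (h : σ.card = d) (p : Fin n → ℂ) (k : Fin d) : ℂ :=
  Complex.log (p (σ.orderEmbOfFin h k))

/-- The condition for `κ` to belong to the support of the `m`-th derivative of the hypergeometric
series attached to the simplex `σ` and to the class of `w` modulo `ℤA_σ`. -/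
def IsSupported {d n : ℕ} (A : Matrix (Fin d) (Fin n) ℤ) (σ : Finset (Fin n)) (w : Fin d → ℤ)
    (m κ : Fin n →₀ ℕ) : Prop :=
  (∀ i ∈ σ, κ i = 0) ∧ weight A (κ + m) - w ∈ simplexLattice A σ

open Classical in
/-- The summands of the hypergeometric series attached to the simplex `σ` and to the class of `w`
modulo `ℤA_σ`. -/
def hyperTerm {d n : ℕ} (A : Matrix (Fin d) (Fin n) ℤ) (σ : Finset (Fin n)) (h : σ.card = d)
    (p : Fin n → ℂ) (w : Fin d → ℤ) (c : Fin d → ℂ) (m κ : Fin n →₀ ℕ) : ℂ :=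
  if IsSupported A σ w m κ then
    seriesTerm (simplexCoord A σ h) (simplexLog σ h p) p c m κ else 0

/-- The coefficients, up to factorials, of the Taylor series at `p` of the hypergeometric series
attached to the simplex `σ` and to the class of `w` modulo `ℤA_σ`. -/
def hyperCoeff {d n : ℕ} (A : Matrix (Fin d) (Fin n) ℤ) (σ : Finset (Fin n)) (h : σ.card = d)
    (p : Fin n → ℂ) (w : Fin d → ℤ) (c : Fin d → ℂ) (m : Fin n →₀ ℕ) : ℂ :=
  ∑' κ, hyperTerm A σ h p w c m κ

/-- The exponent of `x` belonging to the summand `κ` of the `m`-th derivative. -/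
def exponent {d n : ℕ} (A : Matrix (Fin d) (Fin n) ℤ) (σ : Finset (Fin n)) (h : σ.card = d)
    {F : Type*} [Field F] [Algebra ℝ F] (c : Fin d → F) (m κ : Fin n →₀ ℕ) (j : Fin n) : F :=
  κ j + ∑ k, if σ.orderEmbOfFin h k = j then
    c k - algebraMap ℝ F (∑ j, simplexCoord A σ h j k * (κ j + m j : ℝ)) else 0

theorem gammaMonomial_sub_one (ℓ a : ℂ) :
    Complex.exp ℓ * gammaMonomial ℓ (a - 1) = a * gammaMonomial ℓ a := by
  rw [gammaMonomial, gammaMonomial, sub_add_cancel,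
    Complex.one_div_Gamma_eq_self_mul_one_div_Gamma_add_one a, sub_mul, one_mul, Complex.exp_sub]
  field_simp

section Term

variable {d n : ℕ} {A : Matrix (Fin d) (Fin n) ℤ} {σ : Finset (Fin n)} {h : σ.card = d}
  {p : Fin n → ℂ} {w : Fin d → ℤ} {c : Fin d → ℂ}

theorem exponent_vertex {F : Type*} [Field F] [Algebra ℝ F] (c : Fin d → F) (m κ : Fin n →₀ ℕ)
    (k : Fin d) : exponent A σ h c m κ (σ.orderEmbOfFin h k) = κ (σ.orderEmbOfFin h k) +
      (c k - algebraMap ℝ F (∑ j, simplexCoord A σ h j k * (κ j + m j : ℝ))) := by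
  rw [exponent, Finset.sum_eq_single k]
  · simp
  · intro b _ hb
    rw [if_neg]
    simpa using hb
  · simp

theorem exponent_of_notMem {F : Type*} [Field F] [Algebra ℝ F] (c : Fin d → F)
    (m κ : Fin n →₀ ℕ) {j : Fin n} (hj : j ∉ σ) : exponent A σ h c m κ j = κ j := by
  rw [exponent, Finset.sum_eq_zero, add_zero]
  intro k _
  rw [if_neg]
  rintro rfl
  exact hj (Finset.orderEmbOfFin_mem _ _ _)

theorem hyperTerm_of_isSupported {m κ : Fin n →₀ ℕ} (hκ : IsSupported A σ w m κ) :
    hyperTerm A σ h p w c m κ =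
      seriesTerm (simplexCoord A σ h) (simplexLog σ h p) p c m κ := if_pos hκ

theorem hyperTerm_of_not_isSupported {m κ : Fin n →₀ ℕ} (hκ : ¬ IsSupported A σ w m κ) :
    hyperTerm A σ h p w c m κ = 0 := if_neg hκ

/-- This is the source of the toric equations: `m` enters only through `A_σ⁻¹ A m` and through the
class of `A(κ + m)`. -/
theorem hyperTerm_congr_weight {m m' : Fin n →₀ ℕ} (hm : weight A m = weight A m')
    (κ : Fin n →₀ ℕ) : hyperTerm A σ h p w c m κ = hyperTerm A σ h p w c m' κ := by
  have h1 : ∀ k, ∑ j, simplexCoord A σ h j k * (κ j + m j : ℝ) =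
      ∑ j, simplexCoord A σ h j k * (κ j + m' j : ℝ) := fun k => by
    simp only [mul_add, Finset.sum_add_distrib, sum_simplexCoord_mul, hm]
  have h2 : IsSupported A σ w m κ ↔ IsSupported A σ w m' κ := by
    rw [IsSupported, IsSupported, weight_add, weight_add, hm]
  by_cases hs : IsSupported A σ w m κ
  · rw [hyperTerm_of_isSupported hs, hyperTerm_of_isSupported (h2.1 hs)]
    simp only [seriesTerm, h1]
  · rw [hyperTerm_of_not_isSupported hs, hyperTerm_of_not_isSupported (mt h2.2 hs)]

theorem hyperCoeff_congr_weight {m m' : Fin n →₀ ℕ} (hm : weight A m = weight A m') :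
    hyperCoeff A σ h p w c m = hyperCoeff A σ h p w c m' :=
  tsum_congr fun κ => hyperTerm_congr_weight hm κ

theorem col_mem_simplexLattice {j : Fin n} (hj : j ∈ σ) (k : ℕ) :
    weight A (Finsupp.single j k) ∈ simplexLattice A σ := by
  have : weight A (Finsupp.single j k) = k • (fun i => A i j) := by
    funext i
    rw [weight_single, Pi.smul_apply, nsmul_eq_mul, mul_comm]
  rw [this]
  exact AddSubgroup.nsmul_mem _ (AddSubgroup.subset_closure (Set.mem_image_of_mem _ hj)) _

/-- For a vertex, `A_σ⁻¹ a_j` is a unit vector and `a_j ∈ ℤA_σ`: the support is unchanged and a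
single Gamma factor shifts, by the functional equation of Γ. Together with the next lemma this
expresses that `x_j ∂_j` multiplies a monomial by its exponent. -/
theorem mul_hyperTerm_vertex (hdet : IsUnit (subMatrix A σ h).det)
    (hp : ∀ i ∈ σ, p i ≠ 0) (m κ : Fin n →₀ ℕ) {j : Fin n} (hj : j ∈ σ) :
    p j * hyperTerm A σ h p w c (m + Finsupp.single j 1) κ =
      exponent A σ h c m κ j * hyperTerm A σ h p w c m κ := by
  obtain ⟨k, rfl⟩ := exists_orderEmbOfFin σ h hj
  have hcond : IsSupported A σ w (m + Finsupp.single (σ.orderEmbOfFin h k) 1) κ ↔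
      IsSupported A σ w m κ := by
    refine and_congr_right fun _ => ?_
    rw [← add_assoc, weight_add A (κ + m), add_sub_right_comm]
    exact AddSubgroup.add_mem_cancel_right _ (col_mem_simplexLattice hj 1)
  by_cases hif : IsSupported A σ w m κ
  · rw [hyperTerm_of_isSupported hif, hyperTerm_of_isSupported (hcond.2 hif)]
    rw [exponent_vertex, hif.1 _ hj]
    set e := σ.orderEmbOfFin h k with he
    set b : Fin d → ℝ := fun k' => ∑ j, simplexCoord A σ h j k' * (κ j + m j : ℝ) with hb
    have hb' : ∀ k', ∑ j, simplexCoord A σ h j k' *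
        (κ j + (m + Finsupp.single e 1 : Fin n →₀ ℕ) j : ℝ) = b k' + if k = k' then 1 else 0 :=
      fun k' => by
        rw [← simplexCoord_vertex A σ h hdet k k', hb]
        have : ∀ j, simplexCoord A σ h j k' * (κ j + (m + Finsupp.single e 1 : Fin n →₀ ℕ) j : ℝ) =
            simplexCoord A σ h j k' * (κ j + m j : ℝ) +
              if j = e then simplexCoord A σ h j k' else 0 := fun j => by
          rw [Finsupp.add_apply, Finsupp.single_apply]
          by_cases hje : e = j
          · subst hje; simp; ring
          · simp [hje, Ne.symm hje]
        simp only [this, Finset.sum_add_distrib]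
        simp [he]
    simp only [seriesTerm, hb']
    rw [← Finset.mul_prod_erase _ _ (Finset.mem_univ k), ← Finset.mul_prod_erase _ (fun k' =>
      gammaMonomial (simplexLog σ h p k') (c k' - (b k' : ℝ))) (Finset.mem_univ k)]
    have h2 : ∏ x ∈ Finset.univ.erase k, gammaMonomial (simplexLog σ h p x)
        (c x - ((b x + if k = x then 1 else 0 : ℝ) : ℂ)) =
        ∏ x ∈ Finset.univ.erase k, gammaMonomial (simplexLog σ h p x) (c x - (b x : ℝ)) :=
      Finset.prod_congr rfl fun x hx => by
        rw [if_neg (Ne.symm (Finset.ne_of_mem_erase hx)), add_zero]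
    have h3 : p e * gammaMonomial (simplexLog σ h p k) (c k - ((b k + 1 : ℝ) : ℂ)) =
        (c k - (b k : ℝ)) * gammaMonomial (simplexLog σ h p k) (c k - (b k : ℝ)) := by
      rw [← gammaMonomial_sub_one, simplexLog, Complex.exp_log (hp _ hj)]
      congr 2; push_cast; ring
    rw [h2, if_pos rfl, ← mul_assoc, ← mul_assoc, h3, Nat.cast_zero, zero_add]
    simp only [Complex.coe_algebraMap, mul_assoc, hb]
  · rw [hyperTerm_of_not_isSupported hif, hyperTerm_of_not_isSupported (mt hcond.1 hif), mul_zero,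
      mul_zero]

/-- Off `σ` the derivative lowers `κ_j`, so the term `κ` of the derivative comes from the term `κ +
e_j` of the series. -/
theorem mul_hyperTerm_of_notMem (m κ : Fin n →₀ ℕ) {j : Fin n} (hj : j ∉ σ) :
    p j * hyperTerm A σ h p w c (m + Finsupp.single j 1) κ =
      exponent A σ h c m (κ + Finsupp.single j 1) j *
        hyperTerm A σ h p w c m (κ + Finsupp.single j 1) := by
  rw [exponent_of_notMem _ _ _ hj]
  have h1 : (∀ i ∈ σ, (κ + Finsupp.single j 1 : Fin n →₀ ℕ) i = 0) ↔ ∀ i ∈ σ, κ i = 0 :=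
    forall₂_congr fun i hi => by
      have : j ≠ i := fun hji => hj (hji ▸ hi)
      simp [this]
  have h2 : κ + Finsupp.single j 1 + m = κ + (m + Finsupp.single j 1) := by abel
  have hcond : IsSupported A σ w m (κ + Finsupp.single j 1) ↔
      IsSupported A σ w (m + Finsupp.single j 1) κ := by
    rw [IsSupported, IsSupported, h1, h2]
  by_cases hif : IsSupported A σ w (m + Finsupp.single j 1) κ
  · rw [hyperTerm_of_isSupported hif, hyperTerm_of_isSupported (hcond.2 hif)]
    have h3 : ∀ i, ((κ + Finsupp.single j 1 : Fin n →₀ ℕ) i + m i : ℝ) =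
        (κ i + (m + Finsupp.single j 1 : Fin n →₀ ℕ) i : ℝ) := fun i => by
      simp only [Finsupp.add_apply]; push_cast; ring
    simp only [seriesTerm, h3]
    rw [← Finset.mul_prod_erase _ (fun i => p i ^ κ i / ((κ i)! : ℂ)) (Finset.mem_univ j),
      ← Finset.mul_prod_erase _ (fun i => p i ^ (κ + Finsupp.single j 1 : Fin n →₀ ℕ) i /
        (((κ + Finsupp.single j 1 : Fin n →₀ ℕ) i)! : ℂ)) (Finset.mem_univ j)]
    have h4 : ∏ i ∈ Finset.univ.erase j, p i ^ (κ + Finsupp.single j 1 : Fin n →₀ ℕ) i /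
        (((κ + Finsupp.single j 1 : Fin n →₀ ℕ) i)! : ℂ) =
        ∏ i ∈ Finset.univ.erase j, p i ^ κ i / ((κ i)! : ℂ) :=
      Finset.prod_congr rfl fun i hi => by
        simp [(Finset.ne_of_mem_erase hi).symm]
    rw [h4]
    simp only [Finsupp.add_apply, Finsupp.single_eq_same, Nat.factorial_succ]
    have : ((κ j)! : ℂ) ≠ 0 := by exact_mod_cast (Nat.factorial_pos _).ne'
    have : ((κ j : ℂ) + 1) ≠ 0 := Nat.cast_add_one_ne_zero _
    push_cast
    field_simp
    ring
  · rw [hyperTerm_of_not_isSupported hif, hyperTerm_of_not_isSupported (mt hcond.1 hif), mul_zero,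
      mul_zero]

theorem hasSum_exponent_mul (hdet : IsUnit (subMatrix A σ h).det) (hp : ∀ i ∈ σ, p i ≠ 0)
    (hsum : ∀ m, Summable (hyperTerm A σ h p w c m)) (m : Fin n →₀ ℕ) (j : Fin n) :
    HasSum (fun κ => exponent A σ h c m κ j * hyperTerm A σ h p w c m κ)
      (p j * hyperCoeff A σ h p w c (m + Finsupp.single j 1)) := by
  have h1 := ((hsum (m + Finsupp.single j 1)).hasSum).mul_left (p j)
  by_cases hj : j ∈ σ
  · simp only [mul_hyperTerm_vertex hdet hp m _ hj] at h1
    exact h1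
  · simp only [mul_hyperTerm_of_notMem m _ hj] at h1
    -- The shift `κ ↦ κ + e_j` misses the `κ` with `κ_j = 0`, where the exponent vanishes.
    refine (Function.Injective.hasSum_iff (add_left_injective (Finsupp.single j 1)) ?_).1 h1
    intro κ hκ
    have : κ j = 0 := by
      by_contra hne
      refine hκ ⟨κ - Finsupp.single j 1, ?_⟩
      refine tsub_add_cancel_of_le ?_
      rw [Finsupp.single_le_iff]
      exact Nat.one_le_iff_ne_zero.2 hne
    rw [exponent_of_notMem _ _ _ hj, this]
    simp

/-- The homogeneity behind the Euler equations: `A` times the exponent vector is the same for every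
term, since `A_σ A_σ⁻¹ A(κ + m)` cancels against the contribution of `κ`. -/
theorem sum_mul_exponent (hdet : IsUnit (subMatrix A σ h).det) (m κ : Fin n →₀ ℕ) (i : Fin d) :
    ∑ j, (A i j : ℂ) * exponent A σ h c m κ j =
      ((subMatrix A σ h).map (algebraMap ℝ ℂ)).mulVec c i - weight A m i := by
  set b : Fin d → ℝ := fun k => ∑ j, simplexCoord A σ h j k * (κ j + m j : ℝ) with hb
  have h1 : (subMatrix A σ h).mulVec b = fun i => (weight A (κ + m) i : ℝ) := by
    have : b = (subMatrix A σ h)⁻¹.mulVec (fun i => (weight A (κ + m) i : ℝ)) := by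
      funext k
      rw [← sum_simplexCoord_mul]
      simp [hb]
    rw [this, Matrix.mulVec_mulVec, Matrix.mul_nonsing_inv _ hdet, Matrix.one_mulVec]
  have h2 : ∑ j, (A i j : ℂ) * (∑ k, if σ.orderEmbOfFin h k = j then c k - (b k : ℂ) else 0) =
      ∑ k, (A i (σ.orderEmbOfFin h k) : ℂ) * (c k - (b k : ℂ)) := by
    simp only [Finset.mul_sum, mul_ite, mul_zero]
    rw [Finset.sum_comm]
    simp
  have h3 : ∑ k, (A i (σ.orderEmbOfFin h k) : ℂ) * (b k : ℂ) = weight A (κ + m) i := by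
    have := congrFun h1 i
    simp only [Matrix.mulVec, dotProduct, subMatrix, Matrix.of_apply, col] at this
    exact_mod_cast congrArg (fun r : ℝ => (r : ℂ)) this
  have h4 : ((subMatrix A σ h).map (algebraMap ℝ ℂ)).mulVec c i =
      ∑ k, (A i (σ.orderEmbOfFin h k) : ℂ) * c k := by
    simp [Matrix.mulVec, dotProduct, subMatrix, col]
  have h5 : ∀ j, exponent A σ h c m κ j =
      κ j + ∑ k, if σ.orderEmbOfFin h k = j then c k - (b k : ℂ) else 0 := fun j => rfl
  rw [Finset.sum_congr rfl fun j _ => by rw [h5, mul_add], Finset.sum_add_distrib, h2, h4]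
  simp only [mul_sub, Finset.sum_sub_distrib]
  rw [h3, weight_add, Pi.add_apply, weight_apply A κ]
  push_cast
  ring

theorem sum_mul_hyperCoeff (hdet : IsUnit (subMatrix A σ h).det) (hp : ∀ i ∈ σ, p i ≠ 0)
    (hsum : ∀ m, Summable (hyperTerm A σ h p w c m)) (m : Fin n →₀ ℕ) (i : Fin d) :
    ∑ j, (A i j : ℂ) * (p j * hyperCoeff A σ h p w c (m + Finsupp.single j 1)) =
      (((subMatrix A σ h).map (algebraMap ℝ ℂ)).mulVec c i - weight A m i) *
        hyperCoeff A σ h p w c m := by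
  have h1 := hasSum_sum (s := Finset.univ) fun j _ =>
    (hasSum_exponent_mul hdet hp hsum m j).mul_left (A i j : ℂ)
  have h2 := ((hsum m).hasSum).mul_left
    (((subMatrix A σ h).map (algebraMap ℝ ℂ)).mulVec c i - weight A m i)
  refine h1.unique (h2.congr_fun fun κ => ?_)
  rw [← sum_mul_exponent hdet m κ i, Finset.sum_mul]
  exact Finset.sum_congr rfl fun j _ => by ring

end Term

/-! ### Linear independence of the hypergeometric series at a generic real parameter -/

/-- The conditions under which the hypergeometric series attached to `σ` defines a Gevrey series of
order `s` along `Y_τ` at `p`; `D` bounds the coordinates of the columns. -/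
structure IsConvergent {d n : ℕ} (A : Matrix (Fin d) (Fin n) ℤ) (D : ℝ) (τ : Finset (Fin n))
    (s : ℝ) (p : Fin n → ℂ) (σ : Finset (Fin n)) (h : σ.card = d) : Prop where
  isUnit_det : IsUnit (subMatrix A σ h).det
  ne_zero : ∀ i ∈ σ, p i ≠ 0
  eq_zero : ∀ j ∉ τ, p j = 0
  abs_coord_le : ∀ j k, |simplexCoord A σ h j k| ≤ D
  height_le_one : ∀ j ∈ τ, height A σ h j ≤ 1
  height_le : ∀ j ∉ τ, height A σ h j ≤ s
  lt_one : ∀ j ∉ σ, height A σ h j = 1 → Real.exp (growthRate d n D) *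
    (‖p j‖ * Real.exp (-∑ k, simplexCoord A σ h j k * (simplexLog σ h p k).re)) < 1

/-! ### Derivatives of the series as falling factorials of the exponents. -/

theorem fallingFactorial_zero (x : ℂ) : fallingFactorial x 0 = 1 := rfl

theorem fallingFactorial_add (x : ℂ) (k l : ℕ) :
    fallingFactorial x (k + l) = fallingFactorial x k * fallingFactorial (x - k) l := by
  rw [fallingFactorial, Finset.prod_range_add]
  congr 1
  exact Finset.prod_congr rfl fun i _ => by push_cast; ring

section Shift

variable {d n : ℕ} {A : Matrix (Fin d) (Fin n) ℤ} {σ : Finset (Fin n)} {h : σ.card = d}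
  {p : Fin n → ℂ} {w : Fin d → ℤ} {c : Fin d → ℂ}

theorem sum_simplexCoord_add_single (hdet : IsUnit (subMatrix A σ h).det) (m : Fin n →₀ ℕ)
    (k k' : Fin d) : ∑ j, simplexCoord A σ h j k' *
      ((m + Finsupp.single (σ.orderEmbOfFin h k) 1 : Fin n →₀ ℕ) j : ℝ) =
      ∑ j, simplexCoord A σ h j k' * (m j : ℝ) + if k = k' then 1 else 0 := by
  rw [← simplexCoord_vertex A σ h hdet k k']
  set e := σ.orderEmbOfFin h k
  have : ∀ j, simplexCoord A σ h j k' * ((m + Finsupp.single e 1 : Fin n →₀ ℕ) j : ℝ) =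
      simplexCoord A σ h j k' * (m j : ℝ) +
        if j = e then simplexCoord A σ h j k' else 0 := fun j => by
    rw [Finsupp.add_apply, Finsupp.single_apply]
    by_cases hje : e = j
    · subst hje; simp; ring
    · simp [hje, Ne.symm hje]
  simp only [this, Finset.sum_add_distrib]
  simp

theorem exponent_add_single_vertex (hdet : IsUnit (subMatrix A σ h).det) (m κ : Fin n →₀ ℕ)
    {j : Fin n} (hj : j ∈ σ) : exponent A σ h c (m + Finsupp.single j 1) κ =
      exponent A σ h c m κ - Pi.single j 1 := by
  obtain ⟨k, rfl⟩ := exists_orderEmbOfFin σ h hj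
  funext i
  rw [Pi.sub_apply]
  by_cases hi : i ∈ σ
  · obtain ⟨k', rfl⟩ := exists_orderEmbOfFin σ h hi
    rw [exponent_vertex, exponent_vertex]
    have h1 := sum_simplexCoord_add_single hdet (κ + m) k k'
    have h2 : ∀ j, ((κ + m + Finsupp.single (σ.orderEmbOfFin h k) 1 : Fin n →₀ ℕ) j : ℝ) =
        κ j + (m + Finsupp.single (σ.orderEmbOfFin h k) 1 : Fin n →₀ ℕ) j := fun j => by
      simp only [Finsupp.add_apply]; push_cast; ring
    have h3 : ∀ j, ((κ + m : Fin n →₀ ℕ) j : ℝ) = κ j + m j := fun j => by simp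
    simp only [h2, h3] at h1
    rw [h1]
    by_cases hk : k = k'
    · subst hk; simp; ring
    · simp [hk, Ne.symm hk]
  · rw [exponent_of_notMem _ _ _ hi, exponent_of_notMem _ _ _ hi, Pi.single_apply, if_neg, sub_zero]
    rintro rfl
    exact hi hj

theorem exponent_add_single_right (m κ : Fin n →₀ ℕ) (j : Fin n) :
    exponent A σ h c (m + Finsupp.single j 1) κ =
      exponent A σ h c m (κ + Finsupp.single j 1) - Pi.single j 1 := by
  funext i
  rw [Pi.sub_apply]
  have h3 : ∀ i, ((κ + Finsupp.single j 1 : Fin n →₀ ℕ) i + m i : ℝ) =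
      (κ i + (m + Finsupp.single j 1 : Fin n →₀ ℕ) i : ℝ) := fun i => by
    simp only [Finsupp.add_apply]; push_cast; ring
  simp only [exponent, h3]
  rw [Finsupp.add_apply, Pi.single_apply, Finsupp.single_apply]
  by_cases hij : j = i
  · subst hij; rw [if_pos rfl, if_pos rfl]; push_cast; ring
  · rw [if_neg hij, if_neg (Ne.symm hij)]; push_cast; ring

theorem tsum_hyperTerm_shift (hdet : IsUnit (subMatrix A σ h).det) (hp : ∀ i ∈ σ, p i ≠ 0)
    (m : Fin n →₀ ℕ) (j : Fin n) (f : (Fin n → ℂ) → ℂ) :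
    p j * ∑' κ, hyperTerm A σ h p w c (m + Finsupp.single j 1) κ *
        f (exponent A σ h c (m + Finsupp.single j 1) κ) =
      ∑' κ, hyperTerm A σ h p w c m κ *
        (exponent A σ h c m κ j * f (exponent A σ h c m κ - Pi.single j 1)) := by
  rw [← tsum_mul_left]
  by_cases hj : j ∈ σ
  · refine tsum_congr fun κ => ?_
    rw [← mul_assoc, mul_hyperTerm_vertex hdet hp m κ hj, exponent_add_single_vertex hdet m κ hj]
    ring
  · refine Eq.trans ?_ (Function.Injective.tsum_eq (add_left_injective (Finsupp.single j 1))
      (f := fun κ => hyperTerm A σ h p w c m κ *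
        (exponent A σ h c m κ j * f (exponent A σ h c m κ - Pi.single j 1))) ?_)
    · refine tsum_congr fun κ => ?_
      rw [← mul_assoc, mul_hyperTerm_of_notMem m κ hj, exponent_add_single_right m κ j]
      ring
    · intro κ hκ
      by_contra hrange
      apply hκ
      have : κ j = 0 := by
        by_contra hne
        refine hrange ⟨κ - Finsupp.single j 1, ?_⟩
        refine tsub_add_cancel_of_le ?_
        rw [Finsupp.single_le_iff]
        exact Nat.one_le_iff_ne_zero.2 hne
      simp only
      rw [exponent_of_notMem _ _ _ hj, this]
      simp

/-- Summed form of `x^m ∂^m x^v = [v]_m x^v`. The test function `f` of the exponents is carried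
along so that the statement is additive in `m`: the falling factorials produced by one step become
part of the test function of the next. -/
theorem prod_pow_mul_tsum_hyperTerm (hdet : IsUnit (subMatrix A σ h).det)
    (hp : ∀ i ∈ σ, p i ≠ 0) (m α : Fin n →₀ ℕ) (f : (Fin n → ℂ) → ℂ) :
    (∏ i, p i ^ m i) * ∑' κ, hyperTerm A σ h p w c (α + m) κ * f (exponent A σ h c (α + m) κ) =
      ∑' κ, hyperTerm A σ h p w c α κ * ((∏ i, fallingFactorial (exponent A σ h c α κ i) (m i)) *
        f (exponent A σ h c α κ - fun i => (m i : ℂ))) := by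
  have hzero : (fun _ : Fin n => (0 : ℂ)) = 0 := rfl
  have hadd : ∀ m m' : Fin n →₀ ℕ, (∀ (α : Fin n →₀ ℕ) (f : (Fin n → ℂ) → ℂ), (∏ i, p i ^ m i) *
      ∑' κ, hyperTerm A σ h p w c (α + m) κ * f (exponent A σ h c (α + m) κ) =
      ∑' κ, hyperTerm A σ h p w c α κ * ((∏ i, fallingFactorial (exponent A σ h c α κ i) (m i)) *
        f (exponent A σ h c α κ - fun i => (m i : ℂ)))) →
      (∀ (α : Fin n →₀ ℕ) (f : (Fin n → ℂ) → ℂ), (∏ i, p i ^ m' i) *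
      ∑' κ, hyperTerm A σ h p w c (α + m') κ * f (exponent A σ h c (α + m') κ) =
      ∑' κ, hyperTerm A σ h p w c α κ * ((∏ i, fallingFactorial (exponent A σ h c α κ i) (m' i)) *
        f (exponent A σ h c α κ - fun i => (m' i : ℂ)))) →
      ∀ (α : Fin n →₀ ℕ) (f : (Fin n → ℂ) → ℂ), (∏ i, p i ^ (m + m') i) *
      ∑' κ, hyperTerm A σ h p w c (α + (m + m')) κ * f (exponent A σ h c (α + (m + m')) κ) =
      ∑' κ, hyperTerm A σ h p w c α κ *
        ((∏ i, fallingFactorial (exponent A σ h c α κ i) ((m + m') i)) *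
        f (exponent A σ h c α κ - fun i => ((m + m') i : ℂ))) := by
    intro m m' hm hm' α f
    have h1 : ∏ i, p i ^ (m + m') i = (∏ i, p i ^ m i) * ∏ i, p i ^ m' i := by
      rw [← Finset.prod_mul_distrib]
      exact Finset.prod_congr rfl fun i _ => by rw [Finsupp.add_apply, pow_add]
    rw [h1, mul_assoc, ← add_assoc, hm' (α + m) f, hm α fun E =>
      (∏ i, fallingFactorial (E i) (m' i)) * f (E - fun i => (m' i : ℂ))]
    refine tsum_congr fun κ => ?_
    have h2 : ∏ i, fallingFactorial (exponent A σ h c α κ i) ((m + m') i) =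
        (∏ i, fallingFactorial (exponent A σ h c α κ i) (m i)) *
          ∏ i, fallingFactorial ((exponent A σ h c α κ - fun i => (m i : ℂ)) i) (m' i) := by
      rw [← Finset.prod_mul_distrib]
      exact Finset.prod_congr rfl fun i _ => by
        rw [Finsupp.add_apply, fallingFactorial_add]; rfl
    rw [h2, mul_assoc]
    congr 4
    funext i
    simp only [Pi.sub_apply, Finsupp.add_apply]
    push_cast; ring
  revert α f
  induction m using Finsupp.induction_linear with
  | zero => intro α f; simp [hzero, fallingFactorial_zero]
  | add m m' hm hm' => exact hadd m m' hm hm'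
  | single j k =>
    induction k with
    | zero => intro α f; simp [hzero, fallingFactorial_zero]
    | succ k ih =>
      rw [Finsupp.single_add]
      refine hadd _ _ ih fun α f => ?_
      have h1 : ∏ i, p i ^ (Finsupp.single j 1 : Fin n →₀ ℕ) i = p j := by
        rw [Finset.prod_eq_single j]
        · simp
        · intro b _ hb; simp [hb.symm]
        · simp
      rw [h1, tsum_hyperTerm_shift hdet hp]
      refine tsum_congr fun κ => ?_
      have h2 : ∏ i, fallingFactorial (exponent A σ h c α κ i)
          ((Finsupp.single j 1 : Fin n →₀ ℕ) i) = exponent A σ h c α κ j := by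
        rw [Finset.prod_eq_single j]
        · simp [fallingFactorial]
        · intro b _ hb; simp [hb.symm, fallingFactorial_zero]
        · simp
      rw [h2]
      congr 4
      funext i
      simp [Pi.single_apply, Finsupp.single_apply, eq_comm]

end Shift

theorem exponent_ofReal {d n : ℕ} {A : Matrix (Fin d) (Fin n) ℤ} {σ : Finset (Fin n)}
    {h : σ.card = d} (c : Fin d → ℝ) (m κ : Fin n →₀ ℕ) (i : Fin n) :
    exponent A σ h (fun k => (c k : ℂ)) m κ i = ((exponent A σ h c m κ i : ℝ) : ℂ) := by
  by_cases hi : i ∈ σ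
  · obtain ⟨k, rfl⟩ := exists_orderEmbOfFin σ h hi
    rw [exponent_vertex, exponent_vertex]
    simp
  · rw [exponent_of_notMem _ _ _ hi, exponent_of_notMem _ _ _ hi]; simp

theorem exists_exponent_bound {d n : ℕ} (A : Matrix (Fin d) (Fin n) ℤ) (σ : Finset (Fin n))
    (h : σ.card = d) (Z : Finset (Fin n)) (c : Fin d → ℝ) (m : Fin n →₀ ℕ) :
    ∃ C : ℝ, 0 ≤ C ∧ ∀ κ, ∑ i ∈ Z, |exponent A σ h c m κ i| ≤ C * (1 + ∑ j, (κ j : ℝ)) := by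
  have key : ∀ i, ∃ C : ℝ, 0 ≤ C ∧ ∀ κ : Fin n →₀ ℕ,
      |exponent A σ h c m κ i| ≤ C * (1 + ∑ j, (κ j : ℝ)) := fun i => by
    by_cases hi : i ∈ σ
    · obtain ⟨k, rfl⟩ := exists_orderEmbOfFin σ h hi
      refine ⟨1 + |c k| + ∑ j, |simplexCoord A σ h j k| * (1 + m j), by positivity, fun κ => ?_⟩
      rw [exponent_vertex]
      have hS : ∀ j, (κ j : ℝ) ≤ ∑ j, (κ j : ℝ) := fun j =>
        Finset.single_le_sum (f := fun j => (κ j : ℝ)) (fun _ _ => by positivity)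
          (Finset.mem_univ j)
      have hS0 : (0 : ℝ) ≤ ∑ j, (κ j : ℝ) := Finset.sum_nonneg fun _ _ => by positivity
      set S := ∑ j, (κ j : ℝ) with hSdef
      have h1 : |∑ j, simplexCoord A σ h j k * (κ j + m j : ℝ)| ≤
          (∑ j, |simplexCoord A σ h j k| * (1 + m j)) * (1 + S) := by
        refine (Finset.abs_sum_le_sum_abs _ _).trans ?_
        rw [Finset.sum_mul]
        refine Finset.sum_le_sum fun j _ => ?_
        rw [abs_mul, abs_of_nonneg (by positivity : (0 : ℝ) ≤ κ j + m j), mul_assoc]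
        gcongr
        have := hS j
        have : (0 : ℝ) ≤ m j := by positivity
        nlinarith
      have h2 : |c k| ≤ |c k| * (1 + S) := le_mul_of_one_le_right (abs_nonneg _) (by linarith)
      have h3 := hS (σ.orderEmbOfFin h k)
      have h4 : (0 : ℝ) ≤ κ (σ.orderEmbOfFin h k) := by positivity
      calc _ ≤ |(κ (σ.orderEmbOfFin h k) : ℝ)| + (|c k| +
            |∑ j, simplexCoord A σ h j k * (κ j + m j : ℝ)|) :=
            (abs_add_le _ _).trans (by gcongr; exact abs_sub _ _)
        _ ≤ _ := by rw [abs_of_nonneg h4]; linarith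
    · refine ⟨1, zero_le_one, fun κ => ?_⟩
      rw [exponent_of_notMem _ _ _ hi, abs_of_nonneg (by positivity), one_mul]
      have := Finset.single_le_sum (f := fun j => (κ j : ℝ)) (fun _ _ => by positivity)
          (Finset.mem_univ i)
      linarith
  choose C hC hb using key
  refine ⟨∑ i ∈ Z, C i, Finset.sum_nonneg fun i _ => hC i, fun κ => ?_⟩
  rw [Finset.sum_mul]
  exact Finset.sum_le_sum fun i _ => hb i κ

/-- The logarithms `ℓ` stay fixed while `p` is scaled, so only the powers `p ^ κ` change. This makes
room for an exponential weight in `κ`. -/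
theorem norm_seriesTerm_scale {d n : ℕ} (x : Fin n → Fin d → ℝ) (ℓ : Fin d → ℂ) (p : Fin n → ℂ)
    (c : Fin d → ℂ) (δ : ℝ) (m κ : Fin n →₀ ℕ) :
    ‖seriesTerm x ℓ (fun j => Real.exp δ * p j) c m κ‖ =
      ‖seriesTerm x ℓ p c m κ‖ * Real.exp (δ * ∑ j, (κ j : ℝ)) := by
  have h1 : ∏ j, (((Real.exp δ : ℝ) : ℂ) * p j) ^ κ j / ((κ j)! : ℂ) =
      ((Real.exp (δ * ∑ j, (κ j : ℝ)) : ℝ) : ℂ) * ∏ j, (p j ^ κ j / ((κ j)! : ℂ)) := by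
    rw [Finset.mul_sum, Real.exp_sum, Complex.ofReal_prod, ← Finset.prod_mul_distrib]
    refine Finset.prod_congr rfl fun j _ => ?_
    rw [mul_pow, mul_comm δ, Real.exp_nat_mul]; push_cast; ring
  rw [seriesTerm, seriesTerm, h1, norm_mul, norm_mul, norm_mul, Complex.norm_real,
    Real.norm_of_nonneg (Real.exp_pos _).le]
  ring

/-- The convergence conditions are strict, hence survive a dilation of `p` by `exp (δ₁ / 2)`, which
gains `exp (δ₁ / 2 * |κ|)`. As the exponents grow at most linearly in `κ`, this gain absorbs the
weight for small `δ`. -/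
theorem exists_hasExpMoment {d n : ℕ} {A : Matrix (Fin d) (Fin n) ℤ} {D : ℝ} (hD : 0 ≤ D)
    {τ : Finset (Fin n)} {s : ℝ} {p : Fin n → ℂ} {σ : Finset (Fin n)} {h : σ.card = d}
    (hc : IsConvergent A D τ s p σ h) (Z : Finset (Fin n)) (w : Fin d → ℤ) (c : Fin d → ℝ)
    (α : Fin n →₀ ℕ) : ∃ δ₀ : ℝ, 0 < δ₀ ∧ ∀ δ, 0 ≤ δ → δ ≤ δ₀ →
      HasExpMoment Z (fun κ => exponent A σ h c α κ) δ
        (fun κ => hyperTerm A σ h p w (fun k => (c k : ℂ)) α κ) := by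
  have hev : ∀ᶠ δ in nhds (0 : ℝ), ∀ j, j ∉ σ → height A σ h j = 1 →
      Real.exp (growthRate d n D) * (‖((Real.exp δ : ℝ) : ℂ) * p j‖ *
        Real.exp (-∑ k, simplexCoord A σ h j k * (simplexLog σ h p k).re)) < 1 := by
    refine Filter.eventually_all.2 fun j => ?_
    by_cases hj : j ∉ σ ∧ height A σ h j = 1
    · have hcont : Continuous fun δ : ℝ => Real.exp (growthRate d n D) *
          (‖((Real.exp δ : ℝ) : ℂ) * p j‖ *
            Real.exp (-∑ k, simplexCoord A σ h j k * (simplexLog σ h p k).re)) := by fun_prop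
      have h0 := hc.lt_one j hj.1 hj.2
      filter_upwards [hcont.continuousAt.eventually_lt (continuousAt_const (y := (1 : ℝ)))
        (by simpa using h0)] with δ hδ _ _ using hδ
    · exact Filter.Eventually.of_forall fun δ h1 h2 => absurd ⟨h1, h2⟩ hj
  obtain ⟨δ₁, hδ₁, hball⟩ := Metric.eventually_nhds_iff.1 hev
  obtain ⟨C, hC, hexp⟩ := exists_exponent_bound A σ h Z c α
  obtain ⟨B, hB⟩ : ∃ B : ℝ, ∀ k, ‖(c k : ℂ)‖ ≤ B :=
    ⟨∑ k, ‖(c k : ℂ)‖, fun k => Finset.single_le_sum (f := fun k => ‖(c k : ℂ)‖)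
      (fun _ _ => norm_nonneg _) (Finset.mem_univ k)⟩
  have hhalf := hball (y := δ₁ / 2) (by rw [Real.dist_eq, sub_zero, abs_of_pos] <;> linarith)
  obtain ⟨C₁, hC₁, t, ht, ht0, hbound⟩ := exists_seriesTerm_bound hD hc.abs_coord_le (σ := σ)
    (s := s) (ℓ := simplexLog σ h p) (p := fun j => ((Real.exp (δ₁ / 2) : ℝ) : ℂ) * p j)
    (fun j hj => by simp [hc.eq_zero j hj]) hc.height_le_one hc.height_le
    (fun j hj hj1 => hhalf j hj hj1) B
  refine ⟨δ₁ / 2 / (C + 1), by positivity, fun δ hδ0 hδ => ?_⟩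
  have hδC : δ * C ≤ δ₁ / 2 := by
    rw [le_div_iff₀ (by positivity)] at hδ
    nlinarith
  set W : ℝ := (∏ i ∈ τᶜ, ((α i)! : ℝ)) ^ (1 - s) / ∏ i, ((α i)! : ℝ) with hW
  have hW0 : 0 < W := by positivity
  refine Summable.of_nonneg_of_le (fun κ => by positivity) (fun κ => ?_)
    (ht.mul_left (Real.exp (δ * C) * (C₁ ^ (∑ i, α i) / W)))
  by_cases hκ : IsSupported A σ w α κ
  · simp only
    rw [hyperTerm_of_isSupported hκ]
    have h1 := hbound (fun k => (c k : ℂ)) hB α κ hκ.1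
    rw [norm_seriesTerm_scale, mul_div_assoc, ← hW, ← le_div_iff₀ hW0] at h1
    have hS0 : (0 : ℝ) ≤ ∑ j, (κ j : ℝ) := Finset.sum_nonneg fun _ _ => by positivity
    calc _ ≤ ‖seriesTerm (simplexCoord A σ h) (simplexLog σ h p) p (fun k => (c k : ℂ)) α κ‖ *
          Real.exp (δ * C + δ₁ / 2 * ∑ j, (κ j : ℝ)) := by
          gcongr
          have := mul_le_mul_of_nonneg_left (hexp κ) hδ0
          nlinarith
      _ ≤ Real.exp (δ * C) * (C₁ ^ (∑ i, α i) * t κ / W) := by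
          rw [Real.exp_add, mul_left_comm]
          gcongr
      _ = _ := by ring
  · simp only
    rw [hyperTerm_of_not_isSupported hκ, norm_zero, zero_mul]
    have := ht0 κ
    positivity

theorem gammaMonomial_ne_zero {ℓ a : ℂ} (ha : ∀ z : ℤ, a ≠ z) : gammaMonomial ℓ a ≠ 0 := by
  refine mul_ne_zero (Complex.exp_ne_zero _) (inv_ne_zero (Complex.Gamma_ne_zero fun m hm => ?_))
  apply ha (-(m : ℤ) - 1)
  push_cast
  linear_combination hm

/-- A relation among the series says that a discrete measure on the exponents has vanishing
factorial moments in the coordinates where `p` is nonzero. By genericity the fibre of a well chosen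
exponent carries only one nonzero mass, which isolates the coefficient `g j₀`. -/
theorem linearIndependent_hyperCoeff {d n : ℕ} {A : Matrix (Fin d) (Fin n) ℤ} {D : ℝ} (hD : 0 ≤ D)
    {τ : Finset (Fin n)} {s : ℝ} {p : Fin n → ℂ} {J : Type*} [Finite J]
    (σ : J → Finset (Fin n)) (h : ∀ j, (σ j).card = d) (w : J → Fin d → ℤ)
    (hc : ∀ j, IsConvergent A D τ s p (σ j) (h j))
    (hinj : ∀ j j', σ j = σ j' → w j - w j' ∈ simplexLattice A (σ j) → j = j')
    (hrep : ∀ j, ∃ κ, IsSupported A (σ j) (w j) 0 κ) (c : J → Fin d → ℝ)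
    (hgen : ∀ j k (m : Fin n →₀ ℕ) (z : ℤ),
      c j k - ∑ i, simplexCoord A (σ j) (h j) i k * (m i : ℝ) ≠ z) :
    LinearIndependent ℂ fun j => hyperCoeff A (σ j) (h j) p (w j) fun k => (c j k : ℂ) := by
  classical
  have := Fintype.ofFinite J
  rw [Fintype.linearIndependent_iff]
  intro g hg j₀
  set Z : Finset (Fin n) := Finset.univ.filter fun i => p i ≠ 0 with hZ
  obtain ⟨κ₀, hκ₀⟩ := hrep j₀
  -- At `p` a term with `κ_i ≠ 0` and `p_i = 0` is invisible. Differentiating by `∂^α` first removes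
  -- the part of `κ₀` in those coordinates and leaves the nonvanishing term `κ₁`.
  set α : Fin n →₀ ℕ := κ₀.filter fun i => p i = 0 with hα
  set κ₁ : Fin n →₀ ℕ := κ₀.filter fun i => ¬ p i = 0 with hκ₁
  have hsplit : κ₁ + α = κ₀ := by rw [add_comm]; exact Finsupp.filter_add_filter_not _ _
  set T : J → (Fin n →₀ ℕ) → ℂ := fun j κ =>
    hyperTerm A (σ j) (h j) p (w j) (fun k => (c j k : ℂ)) α κ with hT
  set lam : J × (Fin n →₀ ℕ) → Fin n → ℝ := fun v => exponent A (σ v.1) (h v.1) (c v.1) α v.2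
    with hlam
  set a : J × (Fin n →₀ ℕ) → ℂ := fun v => g v.1 * T v.1 v.2 with ha
  choose δ₀ hδ₀ hmom using fun j => exists_hasExpMoment hD (hc j) Z (w j) (c j) α
  obtain ⟨δ, hδ, hδle⟩ : ∃ δ : ℝ, 0 < δ ∧ ∀ j, δ ≤ δ₀ j := by
    have : Nonempty J := ⟨j₀⟩
    obtain ⟨j₁, hj₁⟩ := Finite.exists_min δ₀
    exact ⟨δ₀ j₁, hδ₀ j₁, hj₁⟩
  have haexp : HasExpMoment Z lam δ a := by
    refine (summable_prod_of_nonneg fun v => by positivity).2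
      ⟨fun j => ?_, Summable.of_finite⟩
    refine ((hmom j δ hδ.le (hδle j)).mul_left ‖g j‖).congr fun κ => ?_
    simp only [ha, hlam, hT, norm_mul, mul_assoc]
  have hvan : HasVanishingMoments Z lam a := fun m => by
    set mZ : Fin n →₀ ℕ := Finsupp.equivFunOnFinite.symm fun i => if p i ≠ 0 then m i else 0
      with hmZ
    have hprod : ∀ v, ∏ i ∈ Z, fallingFactorial (lam v i) (m i) =
        ∏ i, fallingFactorial (exponent A (σ v.1) (h v.1) (fun k => (c v.1 k : ℂ)) α v.2 i) (mZ i) :=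
      fun v => by
        rw [hZ, Finset.prod_filter]
        refine Finset.prod_congr rfl fun i _ => ?_
        rw [exponent_ofReal]
        simp only [hmZ, hlam, Finsupp.equivFunOnFinite_symm_apply_apply]
        split_ifs <;> simp [fallingFactorial_zero]
    rw [Summable.tsum_prod (haexp.summable hδ m).of_norm, tsum_fintype]
    have hj : ∀ j, ∑' κ, a (j, κ) * ∏ i ∈ Z, fallingFactorial (lam (j, κ) i) (m i) =
        (∏ i, p i ^ mZ i) * (g j * hyperCoeff A (σ j) (h j) p (w j) (fun k => (c j k : ℂ)) (α + mZ)) :=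
      fun j => by
        have h1 := prod_pow_mul_tsum_hyperTerm (w := w j) (c := fun k => (c j k : ℂ))
          (hc j).isUnit_det (hc j).ne_zero mZ α fun _ => 1
        simp only [mul_one] at h1
        rw [hyperCoeff, mul_left_comm, h1, ← tsum_mul_left]
        refine tsum_congr fun κ => ?_
        rw [hprod]
        simp only [ha, hT, mul_assoc]
    rw [Finset.sum_congr rfl fun j _ => hj j, ← Finset.mul_sum]
    have h2 := congrFun hg (α + mZ)
    simp only [Finset.sum_apply, Pi.smul_apply, smul_eq_mul, Pi.zero_apply] at h2
    rw [h2, mul_zero]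
  have hfib := tsum_fiber_eq_zero haexp hδ hvan (lam (j₀, κ₁))
  have hsupp₁ : IsSupported A (σ j₀) (w j₀) α κ₁ := by
    refine ⟨fun i hi => ?_, ?_⟩
    · rw [hκ₁, Finsupp.filter_apply]
      simp [hκ₀.1 i hi]
    · rw [hsplit]; simpa using hκ₀.2
  rw [tsum_eq_single (j₀, κ₁)] at hfib
  · rw [if_pos fun _ _ => rfl, ha] at hfib
    refine (mul_eq_zero.1 hfib).resolve_right ?_
    simp only [hT]
    rw [hyperTerm_of_isSupported hsupp₁, seriesTerm]
    refine mul_ne_zero (Finset.prod_ne_zero_iff.2 fun k _ => gammaMonomial_ne_zero fun z hz => ?_)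
      (Finset.prod_ne_zero_iff.2 fun i _ => div_ne_zero ?_ ?_)
    · refine hgen j₀ k (κ₁ + α) z ?_
      simp only [Finsupp.add_apply]
      push_cast
      exact_mod_cast hz
    · by_cases hi : p i = 0
      · rw [hκ₁, Finsupp.filter_apply, if_neg (not_not.2 hi), pow_zero]; exact one_ne_zero
      · exact pow_ne_zero _ hi
    · exact_mod_cast (Nat.factorial_pos _).ne'
  · rintro ⟨j, κ⟩ hne
    split_ifs with heq
    swap
    · rfl
    by_contra hane
    have hTne : T j κ ≠ 0 := fun h0 => hane (by simp [ha, h0])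
    have hsupp : IsSupported A (σ j) (w j) α κ := by
      by_contra hs
      exact hTne (hyperTerm_of_not_isSupported hs)
    have hκZ : ∀ i, p i = 0 → κ i = 0 := fun i hi => by
      by_contra hki
      apply hTne
      simp only [hT]
      rw [hyperTerm_of_isSupported hsupp, seriesTerm,
        Finset.prod_eq_zero (i := i) (Finset.mem_univ i) (f := fun j => p j ^ κ j / ((κ j)! : ℂ))
          (by rw [hi, zero_pow hki, zero_div]), mul_zero]
    -- At an index of `σ j` outside `σ j₀` one exponent would be a natural number and the other, by
    -- genericity, not an integer.
    have hσ : σ j = σ j₀ := by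
      refine Finset.eq_of_subset_of_card_le (fun i hi => ?_) (by rw [h, h])
      by_contra hi₀
      have h1 := heq i (by simpa [hZ] using (hc j).ne_zero i hi)
      obtain ⟨k, rfl⟩ := exists_orderEmbOfFin (σ j) (h j) hi
      simp only [hlam] at h1
      rw [exponent_vertex, exponent_of_notMem _ _ _ hi₀, hsupp.1 _ hi] at h1
      refine hgen j k (κ + α) (κ₁ ((σ j).orderEmbOfFin (h j) k)) ?_
      simp only [Finsupp.add_apply]
      push_cast
      simpa using h1
    -- Off `σ` the exponent at an index with `p_i ≠ 0` is `κ_i` itself; both sides vanish on `σ` and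
    -- where `p_i = 0`.
    have hκ : κ = κ₁ := by
      ext i
      by_cases hi : p i = 0
      · rw [hκZ i hi, hκ₁, Finsupp.filter_apply, if_neg (not_not.2 hi)]
      · by_cases hiσ : i ∈ σ j
        · rw [hsupp.1 i hiσ, hsupp₁.1 i (hσ ▸ hiσ)]
        · have h1 := heq i (by simpa [hZ] using hi)
          simp only [hlam] at h1
          rw [exponent_of_notMem _ _ _ hiσ, exponent_of_notMem _ _ _ (hσ ▸ hiσ)] at h1
          exact_mod_cast h1
    have hj : j₀ = j := by
      refine hinj j₀ j hσ.symm ?_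
      have h1 := hsupp.2
      rw [hσ, hκ] at h1
      have h2 := AddSubgroup.sub_mem _ h1 hsupp₁.2
      simpa using h2
    exact hne (by rw [hj, hκ])

/-! ### Recurrences for the coefficients of solutions -/

/-- The systems of coefficients `ψ` for which `∑ ψ_m / m! (x - p)^m` is a solution of `M_A(β)`. -/
def relations {d n : ℕ} (A : Matrix (Fin d) (Fin n) ℤ) (p : Fin n → ℂ) (β : Fin d → ℂ) :
    Submodule ℂ ((Fin n →₀ ℕ) → ℂ) where
  carrier := {ψ | (∀ m m', weight A m = weight A m' → ψ m = ψ m') ∧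
    ∀ i m, ∑ j, (A i j : ℂ) * (p j * ψ (m + Finsupp.single j 1)) = (β i - weight A m i) * ψ m}
  zero_mem' := by simp
  add_mem' := by
    rintro ψ ψ' ⟨h1, h2⟩ ⟨h1', h2'⟩
    refine ⟨fun m m' hm => ?_, fun i m => ?_⟩
    · rw [Pi.add_apply, Pi.add_apply, h1 m m' hm, h1' m m' hm]
    · simp only [Pi.add_apply, mul_add, Finset.sum_add_distrib, h2, h2']
  smul_mem' := by
    rintro a ψ ⟨h1, h2⟩
    refine ⟨fun m m' hm => ?_, fun i m => ?_⟩
    · rw [Pi.smul_apply, Pi.smul_apply, h1 m m' hm]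
    · simp only [Pi.smul_apply, smul_eq_mul]
      rw [mul_left_comm, ← h2, Finset.mul_sum]
      exact Finset.sum_congr rfl fun j _ => by ring

theorem isClosedAtZero_relations {d n : ℕ} (A : Matrix (Fin d) (Fin n) ℤ) (p : Fin n → ℂ)
    (β₀ β₁ : Fin d → ℂ) : IsClosedAtZero fun ε => relations A p (β₀ + ε • (β₁ - β₀)) := by
  intro f hf hmem
  have hev : ∀ᶠ ε in nhdsWithin (0 : ℂ) {0}ᶜ, f ε ∈ relations A p (β₀ + ε • (β₁ - β₀)) := by
    filter_upwards [nhdsWithin_le_nhds (Metric.ball_mem_nhds (0 : ℂ) two_pos),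
      self_mem_nhdsWithin] with ε h1 h2 using hmem ε h1 h2
  have hlim : ∀ m, Filter.Tendsto (fun ε => f ε m) (nhdsWithin (0 : ℂ) {0}ᶜ) (nhds (f 0 m)) :=
    fun m => (hf m).tendsto.mono_left nhdsWithin_le_nhds
  refine ⟨fun m m' hm => ?_, fun i m => ?_⟩
  · refine tendsto_nhds_unique_of_eventuallyEq (hlim m) (hlim m') ?_
    filter_upwards [hev] with ε hε using hε.1 m m' hm
  · have hβ : Filter.Tendsto (fun ε : ℂ => (β₀ + ε • (β₁ - β₀)) i - (weight A m i : ℂ))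
        (nhdsWithin (0 : ℂ) {0}ᶜ) (nhds ((β₀ + (0 : ℂ) • (β₁ - β₀)) i - (weight A m i : ℂ))) := by
      refine Filter.Tendsto.mono_left (Continuous.tendsto ?_ 0) nhdsWithin_le_nhds
      simp only [Pi.add_apply, Pi.smul_apply]
      fun_prop
    refine tendsto_nhds_unique_of_eventuallyEq (tendsto_finsetSum _ fun j _ =>
      ((hlim (m + Finsupp.single j 1)).const_mul (p j)).const_mul (A i j : ℂ))
      (hβ.mul (hlim m)) ?_
    filter_upwards [hev] with ε hε using hε.2 i m

/-- The growth of the coefficients, up to factorials, of Gevrey series of order `s`. -/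
def gevreyWeight {n : ℕ} (τ : Finset (Fin n)) (s : ℝ) (m : Fin n →₀ ℕ) : ℝ :=
  (∏ i, ((m i)! : ℝ)) / (∏ i ∈ τᶜ, ((m i)! : ℝ)) ^ (1 - s)

theorem gevreyWeight_pos {n : ℕ} (τ : Finset (Fin n)) (s : ℝ) (m : Fin n →₀ ℕ) :
    0 < gevreyWeight τ s m := by
  unfold gevreyWeight; positivity

/-- The vector `A_σ⁻¹ β`. -/
def simplexParam {d n : ℕ} (A : Matrix (Fin d) (Fin n) ℤ) (σ : Finset (Fin n)) (h : σ.card = d)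
    (β : Fin d → ℂ) : Fin d → ℂ :=
  ((subMatrix A σ h)⁻¹.map (algebraMap ℝ ℂ)).mulVec β

theorem mulVec_simplexParam {d n : ℕ} {A : Matrix (Fin d) (Fin n) ℤ} {σ : Finset (Fin n)}
    {h : σ.card = d} (hdet : IsUnit (subMatrix A σ h).det) (β : Fin d → ℂ) :
    ((subMatrix A σ h).map (algebraMap ℝ ℂ)).mulVec (simplexParam A σ h β) = β := by
  rw [simplexParam, Matrix.mulVec_mulVec, ← Matrix.map_mul, Matrix.mul_nonsing_inv _ hdet,
    Matrix.map_one _ (map_zero _) (map_one _), Matrix.one_mulVec]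

/-! ### Holomorphic dependence on the parameter, and generic parameters. -/

theorem differentiable_gammaMonomial (ℓ : ℂ) : Differentiable ℂ (gammaMonomial ℓ) := by
  unfold gammaMonomial
  refine Differentiable.mul (by fun_prop) ?_
  exact Complex.differentiable_one_div_Gamma.comp (differentiable_id.add_const 1)

theorem differentiable_hyperTerm {d n : ℕ} (A : Matrix (Fin d) (Fin n) ℤ) (σ : Finset (Fin n))
    (h : σ.card = d) (p : Fin n → ℂ) (w : Fin d → ℤ) (c₀ c₁ : Fin d → ℂ) (m κ : Fin n →₀ ℕ) :
    Differentiable ℂ fun ε : ℂ => hyperTerm A σ h p w (c₀ + ε • c₁) m κ := by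
  by_cases hκ : IsSupported A σ w m κ
  · simp only [hyperTerm_of_isSupported hκ, seriesTerm]
    refine Differentiable.mul_const (Differentiable.fun_finsetProd fun k _ => ?_) _
    refine (differentiable_gammaMonomial _).comp ?_
    simp only [Pi.add_apply, Pi.smul_apply, smul_eq_mul]
    fun_prop
  · simp only [hyperTerm_of_not_isSupported hκ]
    exact differentiable_const _

theorem exists_hyperTerm_bound {d n : ℕ} {A : Matrix (Fin d) (Fin n) ℤ} {D : ℝ} (hD : 0 ≤ D)
    {τ : Finset (Fin n)} {s : ℝ} {p : Fin n → ℂ} {σ : Finset (Fin n)} {h : σ.card = d}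
    (hc : IsConvergent A D τ s p σ h) (B : ℝ) :
    ∃ C₁ : ℝ, 0 < C₁ ∧ ∃ t : (Fin n →₀ ℕ) → ℝ, Summable t ∧ (∀ κ, 0 ≤ t κ) ∧
      ∀ c : Fin d → ℂ, (∀ k, ‖c k‖ ≤ B) → ∀ w m κ,
        ‖hyperTerm A σ h p w c m κ‖ ≤ gevreyWeight τ s m * C₁ ^ (∑ i, m i) * t κ := by
  obtain ⟨C₁, hC₁, t, ht, ht0, hb⟩ := exists_seriesTerm_bound hD hc.abs_coord_le (σ := σ)
    (s := s) (ℓ := simplexLog σ h p) (p := p) hc.eq_zero hc.height_le_one hc.height_le hc.lt_one B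
  refine ⟨C₁, hC₁, t, ht, ht0, fun c hcB w m κ => ?_⟩
  by_cases hκ : IsSupported A σ w m κ
  · rw [hyperTerm_of_isSupported hκ]
    have h1 := hb c hcB m κ hκ.1
    have h2 : (0 : ℝ) < (∏ i ∈ τᶜ, ((m i)! : ℝ)) ^ (1 - s) := by positivity
    have h3 : (0 : ℝ) < ∏ i, ((m i)! : ℝ) := by positivity
    rw [div_le_iff₀ h3, ← le_div_iff₀ h2] at h1
    refine h1.trans_eq ?_
    rw [gevreyWeight]; ring
  · rw [hyperTerm_of_not_isSupported hκ, norm_zero]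
    have := ht0 κ
    have := gevreyWeight_pos τ s m
    positivity

/-- `A_σ⁻¹ β` is affine in `ε`, hence bounded on the disc, so one majorant serves all `ε`: it gives
holomorphy of the sums and the common growth bound. -/
theorem exists_isDominatedFamily {d n : ℕ} {A : Matrix (Fin d) (Fin n) ℤ} {D : ℝ} (hD : 0 ≤ D)
    {τ : Finset (Fin n)} {s : ℝ} {p : Fin n → ℂ} {σ : Finset (Fin n)} {h : σ.card = d}
    (hc : IsConvergent A D τ s p σ h) (β₀ β₁ : Fin d → ℂ) : ∃ C₁ : ℝ, 0 < C₁ ∧ ∀ C ≥ C₁, ∀ w,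
      IsDominatedFamily (fun m => gevreyWeight τ s m * C ^ (∑ i, m i))
        (fun ε => relations A p (β₀ + ε • (β₁ - β₀)))
        (fun ε => hyperCoeff A σ h p w (simplexParam A σ h (β₀ + ε • (β₁ - β₀)))) := by
  set c₀ := simplexParam A σ h β₀ with hc₀
  set c₁ := simplexParam A σ h (β₁ - β₀) with hc₁
  have hlin : ∀ ε : ℂ, simplexParam A σ h (β₀ + ε • (β₁ - β₀)) = c₀ + ε • c₁ := fun ε => by
    rw [simplexParam, Matrix.mulVec_add, Matrix.mulVec_smul]; rfl
  have hB : ∀ ε ∈ Metric.ball (0 : ℂ) 2, ∀ k, ‖(c₀ + ε • c₁) k‖ ≤ ‖c₀‖ + 2 * ‖c₁‖ :=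
    fun ε hε k => by
      have h2 : ‖ε‖ ≤ 2 := by simpa using (mem_ball_zero_iff.1 hε).le
      refine (norm_le_pi_norm _ k).trans ((norm_add_le _ _).trans ?_)
      rw [norm_smul]
      gcongr
  obtain ⟨C₁, hC₁, t, ht, ht0, hb⟩ := exists_hyperTerm_bound hD hc (‖c₀‖ + 2 * ‖c₁‖)
  have hsum : ∀ ε ∈ Metric.ball (0 : ℂ) 2, ∀ w m,
      Summable fun κ => ‖hyperTerm A σ h p w (c₀ + ε • c₁) m κ‖ := fun ε hε w m =>
    Summable.of_nonneg_of_le (fun _ => norm_nonneg _) (fun κ => hb _ (hB ε hε) w m κ)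
      (ht.mul_left _)
  refine ⟨C₁, hC₁, fun C hC w => ⟨fun m => ?_, ⟨∑' κ, t κ, fun ε hε m => ?_⟩, fun ε hε => ?_⟩⟩
  · simp only [hlin, hyperCoeff]
    exact Complex.differentiableOn_tsum_of_summable_norm (ht.mul_left _)
      (fun κ => (differentiable_hyperTerm A σ h p w c₀ c₁ m κ).differentiableOn) Metric.isOpen_ball
      fun κ ε hε => hb _ (hB ε hε) w m κ
  · simp only [hlin, hyperCoeff]
    refine (norm_tsum_le_tsum_norm (hsum ε hε w m)).trans ?_
    refine ((hsum ε hε w m).tsum_le_tsum (fun κ => hb _ (hB ε hε) w m κ) (ht.mul_left _)).trans ?_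
    rw [tsum_mul_left, mul_comm]
    have := gevreyWeight_pos τ s m
    have : 0 ≤ ∑' κ, t κ := tsum_nonneg ht0
    gcongr
  · refine ⟨fun m m' hm => hyperCoeff_congr_weight hm, fun i m => ?_⟩
    rw [sum_mul_hyperCoeff hc.isUnit_det hc.ne_zero
      (fun m => by rw [hlin]; exact (hsum ε hε w m).of_norm), mulVec_simplexParam hc.isUnit_det]

/-- On the curve `(t, t², …, t^d)` each forbidden condition is a polynomial equation in `t`. It is
nontrivial because a row of `A_σ⁻¹` is nonzero and the exponents `i + 1` stay clear of the constant
term; countably many finite sets of roots are avoided. -/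
theorem exists_generic_param {d n : ℕ} (A : Matrix (Fin d) (Fin n) ℤ) :
    ∃ β : Fin d → ℝ, ∀ (σ : Finset (Fin n)) (h : σ.card = d), IsUnit (subMatrix A σ h).det →
      ∀ (k : Fin d) (m : Fin n →₀ ℕ) (z : ℤ),
        (subMatrix A σ h)⁻¹.mulVec β k - ∑ i, simplexCoord A σ h i k * (m i : ℝ) ≠ z := by
  classical
  let P : (Finset (Fin n) × Fin d × (Fin n →₀ ℕ) × ℤ) → Polynomial ℝ := fun q =>
    if h : q.1.card = d then
      ∑ i, Polynomial.C ((subMatrix A q.1 h)⁻¹ q.2.1 i) * Polynomial.X ^ ((i : ℕ) + 1) -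
        Polynomial.C (∑ i, simplexCoord A q.1 h i q.2.1 * (q.2.2.1 i : ℝ) + q.2.2.2)
    else 0
  have hcount : (⋃ q, {t : ℝ | P q ≠ 0 ∧ (P q).IsRoot t}).Countable := by
    refine Set.countable_iUnion fun q => ?_
    by_cases hq : P q = 0
    · simp [hq]
    · exact (Polynomial.finite_setOfPred_isRoot hq).countable.mono fun t ht => ht.2
  obtain ⟨t, ht⟩ := (hcount.dense_compl ℝ).nonempty
  refine ⟨fun i => t ^ ((i : ℕ) + 1), fun σ h hdet k m z hz => ht ?_⟩
  refine Set.mem_iUnion.2 ⟨(σ, k, m, z), ?_, ?_⟩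
  · have hrow : ∃ i, (subMatrix A σ h)⁻¹ k i ≠ 0 := by
      by_contra! hall
      have h1 := congrFun (congrFun (Matrix.nonsing_inv_mul _ hdet) k) k
      rw [Matrix.mul_apply, Matrix.one_apply_eq] at h1
      simp [hall] at h1
    obtain ⟨i, hi⟩ := hrow
    intro h0
    have h2 := congrArg (fun Q => Polynomial.coeff Q ((i : ℕ) + 1)) h0
    simp only [P, h, dif_pos, Polynomial.coeff_sub, Polynomial.finsetSum_coeff,
      Polynomial.coeff_C_mul, Polynomial.coeff_X_pow, Polynomial.coeff_C_succ, sub_zero,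
      Polynomial.coeff_zero] at h2
    rw [Finset.sum_eq_single i] at h2
    · simp at h2; exact hi h2
    · intro b _ hb
      have : ¬ ((i : ℕ) + 1 = (b : ℕ) + 1) := fun h => hb (Fin.ext (by omega))
      rw [if_neg this, mul_zero]
    · simp
  · simp only [P, h, dif_pos, Polynomial.IsRoot, Polynomial.eval_sub, Polynomial.eval_finsetSum,
      Polynomial.eval_mul, Polynomial.eval_C, Polynomial.eval_pow, Polynomial.eval_X]
    rw [Matrix.mulVec, dotProduct] at hz
    linarith

/-- The generic parameter sits at `ε = 1` and the given `β` at `ε = 0`; the constant `C` dominates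
all the members of the family. -/
theorem exists_linearIndependent_relations {d n : ℕ} {A : Matrix (Fin d) (Fin n) ℤ} {D : ℝ}
    (hD : 0 ≤ D) {τ : Finset (Fin n)} {s : ℝ} {p : Fin n → ℂ} {J : Type*} [Finite J]
    (σ : J → Finset (Fin n)) (h : ∀ j, (σ j).card = d) (w : J → Fin d → ℤ)
    (hc : ∀ j, IsConvergent A D τ s p (σ j) (h j))
    (hinj : ∀ j j', σ j = σ j' → w j - w j' ∈ simplexLattice A (σ j) → j = j')
    (hrep : ∀ j, ∃ κ, IsSupported A (σ j) (w j) 0 κ) (β : Fin d → ℂ) :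
    ∃ C : ℝ, 0 < C ∧ ∃ G : J → (Fin n →₀ ℕ) → ℂ, LinearIndependent ℂ G ∧ ∀ j,
      G j ∈ relations A p β ∧
        ∃ C', ∀ m, ‖G j m‖ ≤ C' * (gevreyWeight τ s m * C ^ (∑ i, m i)) := by
  have := Fintype.ofFinite J
  obtain ⟨b, hb⟩ := exists_generic_param A
  set β₁ : Fin d → ℂ := fun i => (b i : ℂ) with hβ₁
  choose C₁ hC₁ hdom using fun j => exists_isDominatedFamily hD (hc j) β β₁
  refine ⟨1 + ∑ j, C₁ j, by have := Finset.sum_nonneg fun j (_ : j ∈ Finset.univ) => (hC₁ j).le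
                            positivity, ?_⟩
  have hle : ∀ j, C₁ j ≤ 1 + ∑ j, C₁ j := fun j => by
    have := Finset.single_le_sum (f := C₁) (fun j _ => (hC₁ j).le) (Finset.mem_univ j)
    linarith
  have hli : LinearIndependent ℂ fun j => hyperCoeff A (σ j) (h j) p (w j)
      (simplexParam A (σ j) (h j) (β + (1 : ℂ) • (β₁ - β))) := by
    have h1 : ∀ j, simplexParam A (σ j) (h j) (β + (1 : ℂ) • (β₁ - β)) =
        fun k => (((subMatrix A (σ j) (h j))⁻¹.mulVec b k : ℝ) : ℂ) := fun j => by
      rw [one_smul, add_sub_cancel]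
      funext k
      simp [simplexParam, Matrix.mulVec, dotProduct, hβ₁]
    simp only [h1]
    exact linearIndependent_hyperCoeff hD σ h w hc hinj hrep _
      fun j k m z => hb (σ j) (h j) (hc j).isUnit_det k m z
  obtain ⟨G, hG, hGm⟩ := exists_linearIndependent_at_zero (isClosedAtZero_relations A p β β₁)
    (fun j ε => hyperCoeff A (σ j) (h j) p (w j)
      (simplexParam A (σ j) (h j) (β + ε • (β₁ - β)))) (fun j => hdom j _ (hle j) (w j)) hli
  refine ⟨G, hG, fun j => ⟨?_, (hGm j).2⟩⟩
  simpa using (hGm j).1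

/-! ### Solutions as exponential generating series -/

/-- The series `∑ ψ_m / m! (x - p)^m`. -/
def expSeries {n : ℕ} : ((Fin n →₀ ℕ) → ℂ) →ₗ[ℂ] MvPowerSeries (Fin n) ℂ where
  toFun ψ := fun m => ψ m / ∏ i, ((m i)! : ℂ)
  map_add' _ _ := funext fun _ => add_div _ _ _
  map_smul' _ _ := funext fun _ => mul_div_assoc _ _ _

theorem coeff_expSeries {n : ℕ} (ψ : (Fin n →₀ ℕ) → ℂ) (m : Fin n →₀ ℕ) :
    MvPowerSeries.coeff m (expSeries ψ) = ψ m / ∏ i, ((m i)! : ℂ) := rfl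

theorem expSeries_injective {n : ℕ} : Function.Injective (expSeries (n := n)) := fun ψ ψ' h => by
  funext m
  have h1 := congrArg (MvPowerSeries.coeff m) h
  rw [coeff_expSeries, coeff_expSeries] at h1
  refine (div_left_inj' ?_).1 h1
  exact Finset.prod_ne_zero_iff.2 fun i _ => by exact_mod_cast (Nat.factorial_pos _).ne'

theorem partialOp_expSeries {n : ℕ} (i : Fin n) (ψ : (Fin n →₀ ℕ) → ℂ) :
    partialOp i (expSeries ψ) = expSeries fun m => ψ (m + Finsupp.single i 1) := by
  ext m
  change MvPowerSeries.coeff m (MvPowerSeries.pderiv ℂ i (expSeries ψ)) = _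
  rw [MvPowerSeries.coeff_pderiv, coeff_expSeries, coeff_expSeries]
  have h1 : ∏ j, (((m + Finsupp.single i 1 : Fin n →₀ ℕ) j)! : ℂ) =
      (m i + 1) * ∏ j, ((m j)! : ℂ) := by
    rw [← Finset.mul_prod_erase _ _ (Finset.mem_univ i),
      ← Finset.mul_prod_erase _ (fun j => ((m j)! : ℂ)) (Finset.mem_univ i), ← mul_assoc]
    congr 1
    · simp [Nat.factorial_succ]
    · exact Finset.prod_congr rfl fun j hj => by simp [(Finset.ne_of_mem_erase hj).symm]
  have h2 : (m i : ℂ) + 1 ≠ 0 := Nat.cast_add_one_ne_zero _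
  rw [h1, div_mul_eq_mul_div, mul_comm (ψ _), mul_div_mul_left _ _ h2]

theorem partialOp_pow_expSeries {n : ℕ} (i : Fin n) (k : ℕ) (ψ : (Fin n →₀ ℕ) → ℂ) :
    (partialOp i ^ k) (expSeries ψ) = expSeries fun m => ψ (m + Finsupp.single i k) := by
  induction k generalizing ψ with
  | zero => simp
  | succ k ih =>
    rw [pow_succ, Module.End.mul_apply, partialOp_expSeries, ih]
    congr 1
    funext m
    rw [add_assoc, ← Finsupp.single_add]

theorem weylDPow_expSeries {n : ℕ} (p : Fin n → ℂ) (u : Fin n → ℕ) (ψ : (Fin n →₀ ℕ) → ℂ) :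
    (weylDPow p u).1 (expSeries ψ) =
      expSeries fun m => ψ (m + Finsupp.equivFunOnFinite.symm u) := by
  have key : ∀ (l : List (Fin n)) (ψ : (Fin n →₀ ℕ) → ℂ),
      ((l.map fun i => weylD p i ^ u i).prod).1 (expSeries ψ) =
        expSeries fun m => ψ (m + (l.map fun i => Finsupp.single i (u i)).sum) := fun l => by
    induction l with
    | nil => intro ψ; simp
    | cons i l ih =>
      intro ψ
      have h1 : (((i :: l).map fun i => weylD p i ^ u i).prod).1 (expSeries ψ) =
          (partialOp i ^ u i) (((l.map fun i => weylD p i ^ u i).prod).1 (expSeries ψ)) := by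
        rw [List.map_cons, List.prod_cons]; rfl
      rw [h1, ih, partialOp_pow_expSeries]
      congr 1
      funext m
      rw [List.map_cons, List.sum_cons, add_assoc]
  rw [weylDPow, List.ofFn_eq_map, key]
  congr 1
  funext m
  congr 2
  ext j
  rw [← List.ofFn_eq_map, List.sum_ofFn, Finsupp.finsetSum_apply]
  simp [Finsupp.single_apply]

/-- The second summand comes from `x_j = p_j + (x_j - p_j)`; summed over `j` with weights `A i j` it
produces the `Am` in `relations`. -/
theorem coordOp_partialOp_expSeries {n : ℕ} (p : Fin n → ℂ) (j : Fin n)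
    (ψ : (Fin n →₀ ℕ) → ℂ) : coordOp p j (partialOp j (expSeries ψ)) =
      expSeries fun m => p j * ψ (m + Finsupp.single j 1) + m j * ψ m := by
  classical
  rw [partialOp_expSeries]
  change (MvPowerSeries.C (p j) + MvPowerSeries.X j) *
    expSeries (fun m => ψ (m + Finsupp.single j 1)) = _
  ext m
  rw [add_mul, map_add, MvPowerSeries.coeff_C_mul, coeff_expSeries, coeff_expSeries, add_div,
    mul_div_assoc]
  congr 1
  by_cases hm : m j = 0
  · have : ¬ Finsupp.single j 1 ≤ m := by
      rw [Finsupp.single_le_iff, hm]; simp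
    rw [MvPowerSeries.X, MvPowerSeries.coeff_monomial_mul, if_neg this, hm]
    simp
  · have hle : Finsupp.single j 1 ≤ m := by
      rw [Finsupp.single_le_iff]; exact Nat.one_le_iff_ne_zero.2 hm
    obtain ⟨m', rfl⟩ : ∃ m', m = m' + Finsupp.single j 1 :=
      ⟨m - Finsupp.single j 1, (tsub_add_cancel_of_le hle).symm⟩
    rw [mul_comm, MvPowerSeries.X, MvPowerSeries.coeff_add_mul_monomial, mul_one, coeff_expSeries]
    have h1 : ∏ i, (((m' + Finsupp.single j 1 : Fin n →₀ ℕ) i)! : ℂ) =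
        (m' j + 1) * ∏ i, ((m' i)! : ℂ) := by
      rw [← Finset.mul_prod_erase _ _ (Finset.mem_univ j),
        ← Finset.mul_prod_erase _ (fun j => ((m' j)! : ℂ)) (Finset.mem_univ j), ← mul_assoc]
      congr 1
      · simp [Nat.factorial_succ]
      · exact Finset.prod_congr rfl fun i hi => by simp [(Finset.ne_of_mem_erase hi).symm]
    have h2 : (m' j : ℂ) + 1 ≠ 0 := Nat.cast_add_one_ne_zero _
    have h3 : (((m' + Finsupp.single j 1 : Fin n →₀ ℕ) j : ℕ) : ℂ) = m' j + 1 := by simp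
    rw [h1, h3, mul_div_mul_left _ _ h2]

theorem expSeries_mem_solutions {d n : ℕ} {A : Matrix (Fin d) (Fin n) ℤ} {β : Fin d → ℂ}
    {p : Fin n → ℂ} {F : Submodule ℂ (MvPowerSeries (Fin n) ℂ)} {ψ : (Fin n →₀ ℕ) → ℂ}
    (hψ : ψ ∈ relations A p β) (hF : expSeries ψ ∈ F) : expSeries ψ ∈ solutions A β p F := by
  refine ⟨hF, fun P hP => ?_⟩
  induction hP using Submodule.span_induction with
  | zero => rfl
  | add P Q _ _ hP hQ =>
    change (P.1 + Q.1) (expSeries ψ) = 0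
    rw [LinearMap.add_apply, hP, hQ, add_zero]
  | smul a P _ hP =>
    change (a.1 * P.1) (expSeries ψ) = 0
    rw [Module.End.mul_apply, hP, map_zero]
  | mem P hP =>
    rcases hP with ⟨u, hu, rfl⟩ | ⟨i, rfl⟩
    · change ((weylDPow p fun i => (u i).toNat).1 - (weylDPow p fun i => (-u i).toNat).1)
        (expSeries ψ) = 0
      rw [LinearMap.sub_apply, weylDPow_expSeries, weylDPow_expSeries, sub_eq_zero]
      congr 1
      funext m
      refine hψ.1 _ _ ?_
      rw [weight_add, weight_add]
      congr 1
      rw [← sub_eq_zero, weight, weight, ← Matrix.mulVec_sub, ← hu]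
      congr 1
      funext j
      simp only [Pi.sub_apply, Finsupp.equivFunOnFinite_symm_apply_apply]
      omega
    · have h1 : (eulerOp A β p i).1 = ∑ j, (A i j : ℂ) • (coordOp p j * partialOp j) -
          algebraMap ℂ (Module.End ℂ (MvPowerSeries (Fin n) ℂ)) (β i) := by
        simp [eulerOp, weylX, weylD]
      rw [h1, LinearMap.sub_apply, LinearMap.sum_apply]
      simp only [LinearMap.smul_apply, Module.End.mul_apply, coordOp_partialOp_expSeries,
        Module.algebraMap_end_apply]
      rw [← map_smul, ← Finset.sum_congr rfl fun j _ => map_smul expSeries (A i j : ℂ) _, ← map_sum,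
        ← map_sub, ← map_zero expSeries]
      congr 1
      funext m
      have h2 := hψ.2 i m
      simp only [Pi.sub_apply, Finset.sum_apply, Pi.smul_apply, smul_eq_mul, mul_add,
        Finset.sum_add_distrib, h2, Pi.zero_apply]
      rw [weight_apply]
      push_cast
      simp only [← mul_assoc, ← Finset.sum_mul]
      ring

theorem summable_pow_degree {n : ℕ} {r : ℝ} (h0 : 0 ≤ r) (h1 : r < 1) :
    Summable fun m : Fin n →₀ ℕ => r ^ (∑ i, m i) := by
  simp only [← Finset.prod_pow_eq_pow_sum]
  exact summable_finsupp_prod (fun _ _ => by positivity)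
    fun _ => summable_geometric_of_lt_one h0 h1

theorem expSeries_mem_gevreySeries {n : ℕ} {τ : Finset (Fin n)} {s C C' : ℝ} (hC : 0 < C)
    {ψ : (Fin n →₀ ℕ) → ℂ} (hψ : ∀ m, ‖ψ m‖ ≤ C' * (gevreyWeight τ s m * C ^ (∑ i, m i))) :
    expSeries ψ ∈ gevreySeries τ s := by
  -- At this radius the coefficients are dominated by a constant times `(1/2)^|m|`.
  refine ⟨1 / (2 * C), by positivity, ?_⟩
  refine Summable.of_nonneg_of_le (fun m => by positivity) (fun m => ?_)
    ((summable_pow_degree (n := n) (r := 1 / 2) (by norm_num) (by norm_num)).mul_left C')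
  have hcoeff : ‖MvPowerSeries.coeff m (rho τ s (expSeries ψ))‖ =
      ‖ψ m‖ / gevreyWeight τ s m := by
    change ‖(ψ m / ∏ i, ((m i)! : ℂ)) / (((∏ i ∈ τᶜ, ((m i)! : ℝ)) ^ (s - 1) : ℝ) : ℂ)‖ = _
    have h1 : (0 : ℝ) < ∏ i ∈ τᶜ, ((m i)! : ℝ) := by positivity
    rw [norm_div, norm_div, Complex.norm_real, Real.norm_of_nonneg (by positivity), gevreyWeight,
      norm_prod, ← neg_sub 1 s, Real.rpow_neg h1.le]
    simp only [Complex.norm_natCast]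
    field_simp
  have hg := gevreyWeight_pos τ s m
  rw [hcoeff]
  calc _ ≤ (C' * (gevreyWeight τ s m * C ^ (∑ i, m i))) / gevreyWeight τ s m *
        (1 / (2 * C)) ^ (∑ i, m i) := by gcongr; exact hψ m
    _ = C' * (C * (1 / (2 * C))) ^ (∑ i, m i) := by rw [mul_pow]; field_simp
    _ = _ := by congr 2; field_simp

/-- For fixed `α` the factorial factor and the power of `r` in the normal directions are constants,
so the same radius works for every `α`. -/
theorem gevreySeries_le_formalSeries {n : ℕ} (τ : Finset (Fin n)) (s : ℝ) :
    gevreySeries τ s ≤ formalSeries τ := by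
  rintro f ⟨r, hr, hf⟩
  refine ⟨r, hr, fun α => ?_⟩
  have h1 := hf.comp_injective (Subtype.val_injective (p := fun m : Fin n →₀ ℕ => ∀ i ∉ τ, m i = α i))
  set W : ℝ := (∏ i ∈ τᶜ, ((α i)! : ℝ)) ^ (s - 1) with hW
  have hW0 : 0 < W := by positivity
  refine (h1.mul_left (W / r ^ (∑ i ∈ τᶜ, α i))).congr fun m => ?_
  have h2 : ‖MvPowerSeries.coeff m.1 (rho τ s f)‖ = ‖MvPowerSeries.coeff m.1 f‖ / W := by
    change ‖MvPowerSeries.coeff m.1 f / (((∏ i ∈ τᶜ, ((m.1 i)! : ℝ)) ^ (s - 1) : ℝ) : ℂ)‖ = _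
    have h3 : ∏ i ∈ τᶜ, ((m.1 i)! : ℝ) = ∏ i ∈ τᶜ, ((α i)! : ℝ) :=
      Finset.prod_congr rfl fun i hi => by rw [m.2 i (Finset.mem_compl.1 hi)]
    rw [h3, ← hW, norm_div, Complex.norm_real, Real.norm_of_nonneg hW0.le]
  have h4 : ∑ i, m.1 i = ∑ i ∈ τ, m.1 i + ∑ i ∈ τᶜ, α i := by
    rw [← Finset.sum_add_sum_compl τ]
    congr 1
    exact Finset.sum_congr rfl fun i hi => m.2 i (Finset.mem_compl.1 hi)
  simp only [Function.comp_apply]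
  rw [h2, h4, pow_add]
  field_simp

theorem card_le_cdim {n : ℕ} {V : Submodule ℂ (MvPowerSeries (Fin n) ℂ)} {J : Type} [Finite J]
    {f : J → MvPowerSeries (Fin n) ℂ} (hf : LinearIndependent ℂ f) (hV : ∀ j, f j ∈ V) :
    (Nat.card J : ℝ≥0∞) ≤ cdim V := by
  have h1 : LinearIndependent ℂ fun j => (⟨f j, hV j⟩ : V) :=
    LinearIndependent.of_comp V.subtype hf
  have h2 := h1.cardinal_le_rank
  have h3 := OrderHomClass.mono Cardinal.toENat h2
  rw [cdim]
  have h4 : Cardinal.toENat (Cardinal.mk J) = (Nat.card J : ℕ∞) := by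
    rw [← Nat.cast_card (α := J)]; simp
  rw [h4] at h3
  exact_mod_cast (ENat.toENNReal_le.2 h3)

/-! ### Lattice indices and volumes of simplices -/

theorem simplexLattice_le_lattice {d n : ℕ} (A : Matrix (Fin d) (Fin n) ℤ) (σ : Finset (Fin n)) :
    simplexLattice A σ ≤ lattice A :=
  AddSubgroup.closure_mono (Set.image_subset_range _ _)

section Index

variable {d n : ℕ} {A : Matrix (Fin d) (Fin n) ℤ} {σ : Finset (Fin n)} {h : σ.card = d}

theorem index_simplexLattice (hdet : IsUnit (subMatrix A σ h).det) :
    ((simplexLattice A σ).index : ℝ) = |(subMatrix A σ h).det| := by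
  set B : Matrix (Fin d) (Fin d) ℤ := Matrix.of fun i k => A i (σ.orderEmbOfFin h k) with hB
  have hBmap : (subMatrix A σ h).det = (B.det : ℝ) := by
    have : subMatrix A σ h = B.map (Int.castRingHom ℝ) := rfl
    rw [this, ← RingHom.mapMatrix_apply, ← RingHom.map_det]
    rfl
  have hB0 : B.det ≠ 0 := fun h0 => hdet.ne_zero (by rw [hBmap, h0, Int.cast_zero])
  have hinj : Function.Injective B.mulVecLin := 
    (injective_iff_map_eq_zero _).2 fun v hv => Matrix.eq_zero_of_mulVec_eq_zero hB0 hv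
  have hrange : simplexLattice A σ = (LinearMap.range B.mulVecLin).toAddSubgroup := by
    have hcols : (fun (j : Fin n) (i : Fin d) => A i j) '' (σ : Set (Fin n)) =
        Set.range B.col := by
      rw [← Finset.range_orderEmbOfFin σ h, ← Set.range_comp]
      rfl
    rw [Matrix.range_mulVecLin, simplexLattice, hcols, Submodule.span_int_eq_addSubgroupClosure]
  let b := (Pi.basisFun ℤ (Fin d)).map (LinearEquiv.ofInjective B.mulVecLin hinj)
  have h1 := Submodule.natAbs_det_basis_change (Pi.basisFun ℤ (Fin d)) _ b
  have h2 : (Pi.basisFun ℤ (Fin d)).det ((↑) ∘ b) = B.det := by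
    rw [Pi.basisFun_det, ← Matrix.det_transpose B]
    change Matrix.det _ = _
    congr 1
    ext k i
    change (B.mulVec (Pi.basisFun ℤ (Fin d) k)) i = B i k
    simp
  rw [h2] at h1
  rw [hBmap, hrange, ← Int.cast_abs, ← Int.natCast_natAbs, h1]
  rfl

theorem index_simplexLattice_ne_zero (hdet : IsUnit (subMatrix A σ h).det) :
    (simplexLattice A σ).index ≠ 0 := fun h0 => by
  have := index_simplexLattice hdet
  rw [h0, Nat.cast_zero, eq_comm, abs_eq_zero] at this
  exact hdet.ne_zero this

/-- Every class contains some `Aκ` with `κ` nonnegative and zero on `σ`: columns in `σ` may be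
dropped, and a negative is reached through `-a ≡ (N - 1) a`, with `N` the index of `ℤA_σ`. -/
theorem exists_isSupported (hdet : IsUnit (subMatrix A σ h).det) {w : Fin d → ℤ}
    (hw : w ∈ lattice A) : ∃ κ, IsSupported A σ w 0 κ := by
  have h0 := index_simplexLattice_ne_zero hdet
  have hzero : weight A 0 = 0 := by funext i; simp [weight_apply]
  simp only [IsSupported, add_zero]
  induction hw using AddSubgroup.closure_induction with
  | zero => exact ⟨0, by simp, by rw [hzero, sub_zero]; exact zero_mem _⟩
  | mem w hw =>
    obtain ⟨j, rfl⟩ := hw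
    by_cases hj : j ∈ σ
    · refine ⟨0, by simp, ?_⟩
      rw [hzero, zero_sub]
      exact neg_mem (AddSubgroup.subset_closure ⟨j, hj, rfl⟩)
    · refine ⟨Finsupp.single j 1, fun i hi => ?_, ?_⟩
      · exact Finsupp.single_eq_of_ne fun hij => hj (hij ▸ hi)
      · convert zero_mem (simplexLattice A σ)
        funext i
        simp [weight_single]
  | add w w' _ _ hw hw' =>
    obtain ⟨κ, hκ, hκw⟩ := hw
    obtain ⟨κ', hκ', hκw'⟩ := hw'
    refine ⟨κ + κ', fun i hi => by simp [hκ i hi, hκ' i hi], ?_⟩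
    rw [weight_add, add_sub_add_comm]
    exact add_mem hκw hκw'
  | neg w _ hw =>
    obtain ⟨κ, hκ, hκw⟩ := hw
    set N := (simplexLattice A σ).index
    refine ⟨(N - 1) • κ, fun i hi => by simp [hκ i hi], ?_⟩
    have hsmul : ∀ k : ℕ, weight A (k • κ) = k • weight A κ := fun k => by
      induction k with
      | zero => rw [zero_smul, zero_smul, hzero]
      | succ k ih => rw [succ_nsmul, succ_nsmul, weight_add, ih]
    have h1 : weight A ((N - 1) • κ) + weight A κ = N • weight A κ := by
      rw [← weight_add, ← succ_nsmul, Nat.sub_add_cancel (Nat.one_le_iff_ne_zero.2 h0), hsmul]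
    have h2 : weight A ((N - 1) • κ) - -w = N • weight A κ - (weight A κ - w) := by
      rw [← h1]; abel
    rw [h2]
    exact sub_mem ((simplexLattice A σ).nsmul_index_mem _) hκw

end Index

/-! ### Polytopes and the volume of the standard simplex. -/

theorem mem_polytope_iff {d n : ℕ} {A : Matrix (Fin d) (Fin n) ℤ} {τ : Finset (Fin n)}
    {y : Fin d → ℝ} : y ∈ polytope A τ ↔ ∃ c : Fin n → ℝ, (∀ i ∈ τ, 0 ≤ c i) ∧
      ∑ i ∈ τ, c i ≤ 1 ∧ y = ∑ i ∈ τ, c i • col A i := by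
  classical
  constructor
  · intro hy
    refine convexHull_min (t := {y | ∃ c : Fin n → ℝ, (∀ i ∈ τ, 0 ≤ c i) ∧
      ∑ i ∈ τ, c i ≤ 1 ∧ y = ∑ i ∈ τ, c i • col A i}) ?_ ?_ hy
    · rintro y (rfl | ⟨j, hj, rfl⟩)
      · exact ⟨0, by simp, by simp, by simp⟩
      · refine ⟨Pi.single j 1, fun i _ => ?_, ?_, ?_⟩
        · by_cases hij : i = j
          · subst hij; simp
          · simp [hij]
        · simp only [Pi.single_apply, Finset.sum_ite_eq']; split_ifs <;> norm_num
        · simp only [Pi.single_apply, ite_smul, one_smul, zero_smul]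
          rw [Finset.sum_ite_eq' τ j, if_pos (by exact_mod_cast hj)]
    · rintro _ ⟨c, hc, hc1, rfl⟩ _ ⟨c', hc', hc1', rfl⟩ a b ha hb hab
      refine ⟨a • c + b • c', fun i hi => ?_, ?_, ?_⟩
      · have := hc i hi
        have := hc' i hi
        simp only [Pi.add_apply, Pi.smul_apply, smul_eq_mul]
        positivity
      · simp only [Pi.add_apply, Pi.smul_apply, smul_eq_mul, Finset.sum_add_distrib,
          ← Finset.mul_sum]
        nlinarith
      · simp only [Finset.smul_sum, ← Finset.sum_add_distrib, Pi.add_apply, Pi.smul_apply,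
          smul_eq_mul, add_smul, mul_smul]
  · rintro ⟨c, hc, hc1, rfl⟩
    have hconv : Convex ℝ (polytope A τ) := convex_convexHull ℝ _
    have h0 : (0 : Fin d → ℝ) ∈ polytope A τ := subset_convexHull ℝ _ (Set.mem_insert _ _)
    have hcol : ∀ i ∈ τ, col A i ∈ polytope A τ := fun i hi =>
      subset_convexHull ℝ _ (Set.mem_insert_of_mem _ ⟨i, hi, rfl⟩)
    rcases (Finset.sum_nonneg hc).eq_or_lt with hS | hS
    · have : ∀ i ∈ τ, c i = 0 := (Finset.sum_eq_zero_iff_of_nonneg hc).1 hS.symm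
      rw [Finset.sum_eq_zero fun i hi => by rw [this i hi, zero_smul]]
      exact h0
    -- Normalizing the coefficients gives a convex combination of columns, which is then contracted
    -- towards the origin.
    · have h1 := hconv.sum_mem (t := τ) (w := fun i => (∑ i ∈ τ, c i)⁻¹ * c i)
        (fun i hi => by have := hc i hi; positivity)
        (by rw [← Finset.mul_sum, inv_mul_cancel₀ hS.ne']) hcol
      have h2 := hconv.smul_mem_of_zero_mem h0 h1 ⟨hS.le, hc1⟩
      rw [Finset.smul_sum] at h2
      convert h2 using 2 with i
      rw [smul_smul, mul_inv_cancel_left₀ hS.ne']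

/-- The `2^d` reflections of the open simplex in the coordinate hyperplanes are disjoint and lie in
the unit ball of the `ℓ¹` norm, whose volume is `2^d / d!`. Only this inequality is needed. -/
theorem factorial_mul_volume_stdSimplex_le (d : ℕ) : (d ! : ℝ≥0∞) *
    MeasureTheory.volume {x : Fin d → ℝ | (∀ i, 0 ≤ x i) ∧ ∑ i, x i ≤ 1} ≤ 1 := by
  rcases Nat.eq_zero_or_pos d with rfl | hd
  · refine (mul_le_mul_right (MeasureTheory.measure_mono (Set.subset_univ _)) _).trans ?_
    simp [MeasureTheory.volume_pi]
  have : Nonempty (Fin d) := ⟨⟨0, hd⟩⟩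
  set Δ := {x : Fin d → ℝ | (∀ i, 0 ≤ x i) ∧ ∑ i, x i ≤ 1} with hΔ
  have hconv : Convex ℝ Δ := by
    rintro x ⟨hx, hx1⟩ y ⟨hy, hy1⟩ a b ha hb hab
    refine ⟨fun i => ?_, ?_⟩
    · have := hx i
      have := hy i
      simp only [Pi.add_apply, Pi.smul_apply, smul_eq_mul]
      positivity
    · simp only [Pi.add_apply, Pi.smul_apply, smul_eq_mul, Finset.sum_add_distrib,
          ← Finset.mul_sum]
      nlinarith
  have hpos : ∀ x ∈ interior Δ, ∀ i, 0 < x i := fun x hx i => by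
    have h1 : Δ ⊆ Set.univ.pi fun _ => Set.Ici 0 := fun x hx i _ => hx.1 i
    have h2 := interior_mono h1 hx
    rw [interior_pi_set Set.finite_univ] at h2
    simpa using h2 i (Set.mem_univ i)
  let f : (Fin d → ℤˣ) → (Fin d → ℝ) →ₗ[ℝ] (Fin d → ℝ) := fun s =>
    Matrix.toLin' (Matrix.diagonal fun i => ((s i : ℤ) : ℝ))
  have hf : ∀ s x i, f s x i = ((s i : ℤ) : ℝ) * x i := fun s x i => by
    simp [f, Matrix.mulVec_diagonal]
  have habs : ∀ u : ℤˣ, |((u : ℤ) : ℝ)| = 1 := fun u => by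
    rcases Int.units_eq_one_or u with rfl | rfl <;> simp
  have hvol : ∀ s, MeasureTheory.volume (f s '' interior Δ) = MeasureTheory.volume (interior Δ) :=
    fun s => by
      rw [MeasureTheory.Measure.addHaar_image_linearMap, LinearMap.det_toLin', Matrix.det_diagonal,
        Finset.abs_prod]
      simp [habs]
  have hdisj : Pairwise (Function.onFun Disjoint fun s => f s '' interior Δ) := by
    intro s s' hss
    refine Set.disjoint_left.2 ?_
    rintro _ ⟨x, hx, rfl⟩ ⟨y, hy, hxy⟩
    refine hss (funext fun i => ?_)
    have h1 := congrFun hxy i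
    rw [hf, hf] at h1
    have h2 := hpos x hx i
    have h3 := hpos y hy i
    rcases Int.units_eq_one_or (s i) with hs | hs <;>
      rcases Int.units_eq_one_or (s' i) with hs' | hs' <;> rw [hs, hs'] at h1 <;>
      first | (rw [hs, hs']; done) | (simp at h1; linarith)
  have hmeas : ∀ s, MeasureTheory.NullMeasurableSet (f s '' interior Δ) MeasureTheory.volume :=
    fun s => ((hconv.interior).linear_image (f s)).nullMeasurableSet _
  have hsub : (⋃ s, f s '' interior Δ) ⊆
      {x : Fin d → ℝ | (∑ i, |x i| ^ (1 : ℝ)) ^ (1 / (1 : ℝ)) ≤ 1} := by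
    refine Set.iUnion_subset fun s => ?_
    rintro _ ⟨x, hx, rfl⟩
    have hx' := interior_subset hx
    simp only [Set.mem_ofPred_eq, hf, abs_mul, habs, one_mul, Real.rpow_one, div_one]
    rw [Finset.sum_congr rfl fun i _ => abs_of_nonneg (hx'.1 i)]
    exact hx'.2
  have h1 := (MeasureTheory.measure_mono (μ := MeasureTheory.volume) hsub).trans_eq
    (MeasureTheory.volume_sum_rpow_le (ι := Fin d) le_rfl 1)
  rw [MeasureTheory.measure_iUnion₀ (hdisj.mono fun _ _ h => h.aedisjoint) hmeas, tsum_fintype,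
    Finset.sum_congr rfl fun s _ => hvol s] at h1
  have h2 : MeasureTheory.volume (interior Δ) = MeasureTheory.volume Δ :=
    (MeasureTheory.measure_congr (interior_ae_eq_of_null_frontier (hconv.addHaar_frontier _)))
  simp only [h2, Finset.sum_const, Finset.card_univ, Fintype.card_fun, Fintype.card_units_int,
    Fintype.card_fin, nsmul_eq_mul, ENNReal.ofReal_one, one_pow, one_mul, div_one,
    Real.Gamma_nat_eq_factorial, one_add_one_eq_two, Real.Gamma_two, mul_one] at h1
  rw [ENNReal.ofReal_div_of_pos (by positivity), ENNReal.ofReal_pow (by norm_num),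
    ENNReal.ofReal_natCast] at h1
  have h3 : ENNReal.ofReal 2 = 2 := by simp
  have hd0 : (d ! : ℝ≥0∞) ≠ 0 := by exact_mod_cast (Nat.factorial_pos d).ne'
  rw [h3, ENNReal.le_div_iff_mul_le (Or.inl hd0) (Or.inl (ENNReal.natCast_ne_top _)), mul_assoc,
    mul_comm (MeasureTheory.volume Δ), Nat.cast_pow, Nat.cast_ofNat] at h1
  refine (ENNReal.mul_le_mul_iff_right (a := 2 ^ d) (by simp) (by simp)).1 ?_
  rwa [mul_one]

theorem sum_orderEmbOfFin {d n : ℕ} {M : Type*} [AddCommMonoid M] (σ : Finset (Fin n))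
    (h : σ.card = d) (f : Fin n → M) : ∑ k, f (σ.orderEmbOfFin h k) = ∑ i ∈ σ, f i := by
  rw [← Finset.sum_image (f := f) (g := σ.orderEmbOfFin h)
    fun _ _ _ _ h => (σ.orderEmbOfFin _).injective h]
  congr 1
  ext i
  simp only [Finset.mem_image, Finset.mem_univ, true_and]
  exact ⟨by rintro ⟨k, rfl⟩; exact Finset.orderEmbOfFin_mem _ _ _,
    fun hi => exists_orderEmbOfFin σ h hi⟩

theorem subMatrix_mulVec {d n : ℕ} (A : Matrix (Fin d) (Fin n) ℤ) (σ : Finset (Fin n))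
    (h : σ.card = d) (c : Fin n → ℝ) :
    (subMatrix A σ h).mulVec (fun k => c (σ.orderEmbOfFin h k)) = ∑ i ∈ σ, c i • col A i := by
  rw [← sum_orderEmbOfFin σ h fun i => c i • col A i, Matrix.mulVec_eq_sum]
  refine Finset.sum_congr rfl fun k _ => ?_
  rw [op_smul_eq_smul]
  rfl

theorem exists_extend_orderEmbOfFin {d n : ℕ} (σ : Finset (Fin n)) (h : σ.card = d)
    (x : Fin d → ℝ) : ∃ c : Fin n → ℝ, ∀ k, c (σ.orderEmbOfFin h k) = x k :=
  ⟨Function.extend (σ.orderEmbOfFin h) x 0,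
    fun k => (σ.orderEmbOfFin h).injective.extend_apply x 0 k⟩

theorem polytope_eq_image {d n : ℕ} {A : Matrix (Fin d) (Fin n) ℤ} {σ : Finset (Fin n)}
    {h : σ.card = d} : polytope A σ = Matrix.toLin' (subMatrix A σ h) ''
      {x : Fin d → ℝ | (∀ i, 0 ≤ x i) ∧ ∑ i, x i ≤ 1} := by
  ext y
  rw [mem_polytope_iff]
  constructor
  · rintro ⟨c, hc, hc1, rfl⟩
    refine ⟨fun k => c (σ.orderEmbOfFin h k), ⟨fun k => hc _ (Finset.orderEmbOfFin_mem _ _ _), ?_⟩,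
      ?_⟩
    · rwa [sum_orderEmbOfFin]
    · rw [Matrix.toLin'_apply, subMatrix_mulVec]
  · rintro ⟨x, ⟨hx, hx1⟩, rfl⟩
    obtain ⟨c, hc⟩ := exists_extend_orderEmbOfFin σ h x
    obtain rfl : (fun k => c (σ.orderEmbOfFin h k)) = x := funext hc
    refine ⟨c, fun i hi => ?_, ?_, ?_⟩
    · obtain ⟨k, rfl⟩ := exists_orderEmbOfFin σ h hi
      exact hx k
    · rwa [← sum_orderEmbOfFin σ h]
    · rw [Matrix.toLin'_apply, subMatrix_mulVec]

theorem normVol_le_relIndex {d n : ℕ} {A : Matrix (Fin d) (Fin n) ℤ} {σ : Finset (Fin n)}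
    {h : σ.card = d} (hdet : IsUnit (subMatrix A σ h).det) :
    normVol A σ ≤ ((simplexLattice A σ).relIndex (lattice A) : ℝ≥0∞) := by
  refine ENNReal.div_le_of_le_mul ?_
  rw [← Nat.cast_mul, AddSubgroup.relIndex_mul_index (simplexLattice_le_lattice A σ),
    polytope_eq_image (h := h), MeasureTheory.Measure.addHaar_image_linearMap, LinearMap.det_toLin',
    ← index_simplexLattice hdet, ENNReal.ofReal_natCast, mul_left_comm]
  exact mul_le_of_le_one_right' (factorial_mul_volume_stdSimplex_le d)

/-! ### Volumes and triangulations -/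

theorem polytope_subset_pos {d n : ℕ} (A : Matrix (Fin d) (Fin n) ℤ) (τ : Finset (Fin n)) :
    polytope A τ ⊆ pos A τ := fun y hy => by
  obtain ⟨c, hc, -, rfl⟩ := mem_polytope_iff.1 hy
  exact ⟨c, hc, rfl⟩

theorem polytope_mono {d n : ℕ} (A : Matrix (Fin d) (Fin n) ℤ) {σ τ : Finset (Fin n)}
    (h : σ ⊆ τ) : polytope A σ ⊆ polytope A τ :=
  convexHull_mono (Set.insert_subset_insert (Set.image_mono (Finset.coe_subset.2 h)))

theorem isCompact_polytope {d n : ℕ} (A : Matrix (Fin d) (Fin n) ℤ) (τ : Finset (Fin n)) :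
    IsCompact (polytope A τ) :=
  ((τ.finite_toSet.image _).insert 0).isCompact_convexHull ℝ

theorem convex_polytope {d n : ℕ} (A : Matrix (Fin d) (Fin n) ℤ) (τ : Finset (Fin n)) :
    Convex ℝ (polytope A τ) := convex_convexHull ℝ _

theorem volume_pos_eq_zero {d n : ℕ} (A : Matrix (Fin d) (Fin n) ℤ) {τ : Finset (Fin n)}
    (hτ : τ.card < d) : MeasureTheory.volume (pos A τ) = 0 := by
  classical
  set E := Submodule.span ℝ ((τ.image (col A) : Finset (Fin d → ℝ)) : Set (Fin d → ℝ)) with hE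
  have hle : pos A τ ⊆ E := by
    rintro _ ⟨c, -, rfl⟩
    exact Submodule.sum_mem _ fun i hi => Submodule.smul_mem _ _
      (Submodule.subset_span (Finset.mem_coe.2 (Finset.mem_image_of_mem _ hi)))
  refine MeasureTheory.measure_mono_null hle (MeasureTheory.Measure.addHaar_submodule _ _ ?_)
  intro htop
  have h1 := finrank_span_finset_le_card (R := ℝ) (τ.image (col A))
  rw [Set.finrank, ← hE, htop, finrank_top, Module.finrank_fin_fun] at h1
  exact absurd (h1.trans Finset.card_image_le) (not_le.2 hτ)

theorem isUnit_det_subMatrix {d n : ℕ} {A : Matrix (Fin d) (Fin n) ℤ} {σ : Finset (Fin n)}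
    (h : σ.card = d) (hσ : LinearIndependent ℝ fun i : σ => col A i) :
    IsUnit (subMatrix A σ h).det := by
  rw [← Matrix.isUnit_iff_isUnit_det, ← Matrix.linearIndependent_cols_iff_isUnit]
  exact hσ.comp (σ.orderIsoOfFin h) (σ.orderIsoOfFin h).injective

section Simplex

variable {d n : ℕ} {A : Matrix (Fin d) (Fin n) ℤ} {σ : Finset (Fin n)} {h : σ.card = d}

theorem mem_pos_iff (hdet : IsUnit (subMatrix A σ h).det) {y : Fin d → ℝ} :
    y ∈ pos A σ ↔ ∀ k, 0 ≤ (subMatrix A σ h)⁻¹.mulVec y k := by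
  constructor
  · rintro ⟨c, hc, rfl⟩ k
    rw [← subMatrix_mulVec A σ h, Matrix.mulVec_mulVec, Matrix.nonsing_inv_mul _ hdet,
      Matrix.one_mulVec]
    exact hc _ (Finset.orderEmbOfFin_mem _ _ _)
  · intro hy
    obtain ⟨c, hc⟩ := exists_extend_orderEmbOfFin σ h ((subMatrix A σ h)⁻¹.mulVec y)
    refine ⟨c, fun i hi => ?_, ?_⟩
    · obtain ⟨k, rfl⟩ := exists_orderEmbOfFin σ h hi
      rw [hc]
      exact hy k
    · rw [← subMatrix_mulVec A σ h, funext hc, Matrix.mulVec_mulVec, Matrix.mul_nonsing_inv _ hdet,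
        Matrix.one_mulVec]

theorem mem_polytope_simplex_iff (hdet : IsUnit (subMatrix A σ h).det) {y : Fin d → ℝ} :
    y ∈ polytope A σ ↔ (∀ k, 0 ≤ (subMatrix A σ h)⁻¹.mulVec y k) ∧
      ∑ k, (subMatrix A σ h)⁻¹.mulVec y k ≤ 1 := by
  rw [polytope_eq_image (h := h)]
  constructor
  · rintro ⟨x, hx, rfl⟩
    rw [Matrix.toLin'_apply, Matrix.mulVec_mulVec, Matrix.nonsing_inv_mul _ hdet,
      Matrix.one_mulVec]
    exact hx
  · intro hy
    refine ⟨_, hy, ?_⟩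
    rw [Matrix.toLin'_apply, Matrix.mulVec_mulVec, Matrix.mul_nonsing_inv _ hdet,
      Matrix.one_mulVec]

theorem sum_inv_mulVec_sum (c : Fin n → ℝ) (τ : Finset (Fin n)) :
    ∑ k, (subMatrix A σ h)⁻¹.mulVec (∑ j ∈ τ, c j • col A j) k =
      ∑ j ∈ τ, c j * height A σ h j := by
  simp only [Matrix.mulVec_sum, Matrix.mulVec_smul, Finset.sum_apply, Pi.smul_apply, smul_eq_mul,
    height, simplexCoord, Finset.mul_sum]
  exact Finset.sum_comm

end Simplex

namespace IsTriangulation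

variable {d n : ℕ} {A : Matrix (Fin d) (Fin n) ℤ} {τ : Finset (Fin n)}
  {T : Finset (Finset (Fin n))}

/-- Two distinct facets share fewer than `d` columns, so their cones meet in a null set. -/
theorem aedisjoint_pos (hT : IsTriangulation A τ T) {σ σ' : Finset (Fin n)} (hσ : σ ∈ facets d T)
    (hσ' : σ' ∈ facets d T) (hne : σ ≠ σ') :
    MeasureTheory.AEDisjoint MeasureTheory.volume (pos A σ) (pos A σ') := by
  obtain ⟨hσT, hσd⟩ := Finset.mem_filter.1 hσ
  obtain ⟨hσT', hσd'⟩ := Finset.mem_filter.1 hσ'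
  rw [MeasureTheory.AEDisjoint, hT.inter σ hσT σ' hσT']
  refine volume_pos_eq_zero A ?_
  refine (Finset.card_lt_card (Finset.inter_subset_left.ssubset_of_ne fun h => hne ?_)).trans_eq hσd
  exact Finset.eq_of_subset_of_card_le (Finset.inter_eq_left.1 h) (by rw [hσd, hσd'])

theorem volume_iUnion_facets (hT : IsTriangulation A τ T) :
    MeasureTheory.volume (⋃ σ ∈ facets d T, polytope A σ) =
      ∑ σ ∈ facets d T, MeasureTheory.volume (polytope A σ) :=
  MeasureTheory.measure_biUnion_finset₀
    (fun _ hσ _ hσ' hne => (hT.aedisjoint_pos hσ hσ' hne).mono (polytope_subset_pos _ _)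
      (polytope_subset_pos _ _))
    fun σ _ => (isCompact_polytope A σ).isClosed.measurableSet.nullMeasurableSet

theorem isUnit_det (hT : IsTriangulation A τ T) {σ : Finset (Fin n)} (hσ : σ ∈ T)
    (h : σ.card = d) : IsUnit (subMatrix A σ h).det :=
  isUnit_det_subMatrix h (hT.linearIndependent σ hσ)

/-- In a point of `Δ_τ` the coordinates with respect to `σ` sum to a combination of heights, hence
to at most 1. So `Δ_τ ∩ pos(σ) ⊆ Δ_σ`, and the lower-dimensional cones are null. -/
theorem normVol_eq_sum (hT : IsTriangulation A τ T)
    (hh : ∀ σ ∈ T, ∀ h : σ.card = d, ∀ j ∈ τ, height A σ h j ≤ 1) :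
    normVol A τ = ∑ σ ∈ facets d T, normVol A σ := by
  have hvol : MeasureTheory.volume (polytope A τ) =
      ∑ σ ∈ facets d T, MeasureTheory.volume (polytope A σ) := by
    rw [← hT.volume_iUnion_facets]
    refine le_antisymm ?_ (MeasureTheory.measure_mono (Set.iUnion₂_subset fun σ hσ =>
      polytope_mono A (hT.subset σ (Finset.mem_filter.1 hσ).1)))
    have hsub : polytope A τ ⊆ (⋃ σ ∈ facets d T, polytope A σ) ∪
        ⋃ σ ∈ T.filter fun σ => σ.card < d, pos A σ := fun y hy => by
      have h1 := polytope_subset_pos A τ hy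
      rw [← hT.cover] at h1
      obtain ⟨σ, hσ, hyσ⟩ := Set.mem_iUnion₂.1 h1
      have hcard : σ.card ≤ d := by
        have := (hT.linearIndependent σ hσ).fintype_card_le_finrank
        simpa using this
      rcases hcard.eq_or_lt with h | h
      · refine Or.inl (Set.mem_iUnion₂.2 ⟨σ, Finset.mem_filter.2 ⟨hσ, h⟩, ?_⟩)
        have hdet := hT.isUnit_det hσ h
        refine (mem_polytope_simplex_iff hdet).2 ⟨(mem_pos_iff hdet).1 hyσ, ?_⟩
        obtain ⟨c, hc, hc1, rfl⟩ := mem_polytope_iff.1 hy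
        rw [sum_inv_mulVec_sum]
        refine (Finset.sum_le_sum fun j hj => ?_).trans hc1
        exact mul_le_of_le_one_right (hc j hj) (hh σ hσ h j hj)
      · exact Or.inr (Set.mem_iUnion₂.2 ⟨σ, Finset.mem_filter.2 ⟨hσ, h⟩, hyσ⟩)
    refine (MeasureTheory.measure_mono hsub).trans ((MeasureTheory.measure_union_le _ _).trans ?_)
    have hnull : MeasureTheory.volume (⋃ σ ∈ T.filter fun σ => σ.card < d, pos A σ) = 0 :=
      (MeasureTheory.measure_biUnion_null_iff (Finset.countable_toSet _)).2 fun σ hσ =>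
        volume_pos_eq_zero A (Finset.mem_filter.1 hσ).2
    rw [hnull, add_zero]
  simp only [normVol, hvol, Finset.mul_sum, div_eq_mul_inv, Finset.sum_mul]

/-- The converse of `normVol_eq_sum`: a column of height greater than 1 would make `Δ_τ` protrude
from `Δ_σ` inside the cone of `σ`, and the protruding part has positive volume not covered by any
simplex. -/
theorem height_le_one (hT : IsTriangulation A τ T)
    (hvol : normVol A τ = ∑ σ ∈ facets d T, normVol A σ) {σ : Finset (Fin n)} (hσ : σ ∈ T)
    (h : σ.card = d) {j : Fin n} (hj : j ∈ τ) : height A σ h j ≤ 1 := by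
  by_contra! hlt
  have hdet := hT.isUnit_det hσ h
  set L := (subMatrix A σ h)⁻¹ with hL
  have hσf : σ ∈ facets d T := Finset.mem_filter.2 ⟨hσ, h⟩
  have hcont : ∀ k, Continuous fun y : Fin d → ℝ => L.mulVec y k := fun k =>
    (continuous_apply k).comp (Continuous.matrix_mulVec continuous_const continuous_id)
  have hd : 0 < d := Nat.pos_of_ne_zero fun h0 => by
    subst h0
    simp [height] at hlt
    linarith
  have hvol' : MeasureTheory.volume (polytope A τ) =
      ∑ σ ∈ facets d T, MeasureTheory.volume (polytope A σ) := by
    -- The index of `ℤA` divides that of `ℤA_σ`, which is `|det A_σ| ≠ 0`; the normalizing factors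
    -- can therefore be cancelled.
    have hi : ((lattice A).index : ℝ≥0∞) ≠ 0 := by
      have h1 := AddSubgroup.relIndex_mul_index (simplexLattice_le_lattice A σ)
      have h2 := index_simplexLattice_ne_zero hdet
      rw [← h1] at h2
      exact_mod_cast right_ne_zero_of_mul h2
    have hd : (d ! : ℝ≥0∞) ≠ 0 := by exact_mod_cast (Nat.factorial_pos d).ne'
    simp only [normVol, div_eq_mul_inv] at hvol
    rw [← Finset.sum_mul, ← Finset.mul_sum] at hvol
    rw [ENNReal.mul_left_inj (by simp) (by simpa using hi)] at hvol
    exact (ENNReal.mul_right_inj hd (ENNReal.natCast_ne_top _)).1 hvol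
  rw [← hT.volume_iUnion_facets] at hvol'
  set V : Set (Fin d → ℝ) := (⋂ k, {y | 0 < L.mulVec y k}) ∩ {y | 1 < ∑ k, L.mulVec y k} with hV
  have hVo : IsOpen V :=
    (isOpen_iInter_of_finite fun k => isOpen_lt continuous_const (hcont k)).inter
      (isOpen_lt continuous_const (continuous_finsetSum _ fun k _ => hcont k))
  have hVpos : V ⊆ pos A σ := fun y hy =>
    (mem_pos_iff hdet).2 fun k => (Set.mem_iInter.1 hy.1 k).le
  have hVdisj : MeasureTheory.AEDisjoint MeasureTheory.volume V
      (⋃ σ ∈ facets d T, polytope A σ) := by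
    simp only [MeasureTheory.AEDisjoint.iUnion_right_iff]
    intro σ' hσ'
    by_cases hne : σ = σ'
    · subst hne
      refine Disjoint.aedisjoint (Set.disjoint_left.2 fun y hy hy' => ?_)
      exact absurd ((mem_polytope_simplex_iff hdet).1 hy').2 (not_le.2 hy.2)
    · exact (hT.aedisjoint_pos hσf hσ' hne).mono hVpos (polytope_subset_pos _ _)
  have hLM : ∀ x, L.mulVec ((subMatrix A σ h).mulVec x) = x := fun x => by
    rw [Matrix.mulVec_mulVec, Matrix.nonsing_inv_mul _ hdet, Matrix.one_mulVec]
  have hsub := polytope_mono A (hT.subset σ hσ)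
  have hinter : (interior (polytope A τ)).Nonempty := by
    have ho : IsOpen ((⋂ k, {y | 0 < L.mulVec y k}) ∩ {y | ∑ k, L.mulVec y k < 1}) :=
      (isOpen_iInter_of_finite fun k => isOpen_lt continuous_const (hcont k)).inter
        (isOpen_lt (continuous_finsetSum _ fun k _ => hcont k) continuous_const)
    refine ⟨(subMatrix A σ h).mulVec fun _ => (1 / (d + 1) : ℝ),
      interior_maximal (fun y hy => hsub ((mem_polytope_simplex_iff hdet).2
        ⟨fun k => (Set.mem_iInter.1 hy.1 k).le, (le_of_lt hy.2)⟩)) ho ⟨?_, ?_⟩⟩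
    · refine Set.mem_iInter.2 fun k => ?_
      rw [Set.mem_ofPred_eq, hLM]
      positivity
    · rw [Set.mem_ofPred_eq, hLM, Finset.sum_const, Finset.card_univ, Fintype.card_fin,
        nsmul_eq_mul, mul_one_div, div_lt_one (by positivity)]
      linarith
  have hne : (V ∩ interior (polytope A τ)).Nonempty := by
    have hdR : (0 : ℝ) < d := by exact_mod_cast hd
    -- The barycentre of the face of `Δ_σ` opposite the origin. Moving it slightly towards `a_j`
    -- keeps its coordinates positive and raises their sum above 1.
    set q := (subMatrix A σ h).mulVec fun _ => (1 / d : ℝ) with hq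
    have hsum : ∑ _k : Fin d, (1 / d : ℝ) = 1 := by
      rw [Finset.sum_const, Finset.card_univ, Fintype.card_fin, nsmul_eq_mul]
      field_simp
    have hqmem : q ∈ polytope A τ := hsub <| by
      rw [mem_polytope_simplex_iff hdet, hq, ← hL, hLM]
      exact ⟨fun _ => by positivity, hsum.le⟩
    have hjmem : col A j ∈ polytope A τ :=
      subset_convexHull ℝ _ (Set.mem_insert_of_mem _ ⟨j, hj, rfl⟩)
    have hcoord : ∀ (ε : ℝ) k, L.mulVec ((1 - ε) • q + ε • col A j) k =
        (1 - ε) * (1 / d) + ε * simplexCoord A σ h j k := fun ε k => by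
      rw [Matrix.mulVec_add, Matrix.mulVec_smul, Matrix.mulVec_smul, hq, hLM]
      rfl
    have hev : ∀ᶠ ε in nhdsWithin (0 : ℝ) (Set.Ioi 0),
        ∀ k, 0 < (1 - ε) * (1 / d) + ε * simplexCoord A σ h j k := by
      refine Filter.Eventually.filter_mono nhdsWithin_le_nhds (Filter.eventually_all.2 fun k => ?_)
      have hc : Continuous fun ε : ℝ => (1 - ε) * (1 / d) + ε * simplexCoord A σ h j k := by fun_prop
      exact hc.continuousAt.eventually_const_lt (by simpa using hdR)
    obtain ⟨ε, hε, hε0, hε1⟩ := (hev.and (Ioo_mem_nhdsGT (zero_lt_one' ℝ))).exists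
    have hx : (1 - ε) • q + ε • col A j ∈ polytope A τ :=
      convex_polytope A τ hqmem hjmem (by linarith) hε0.le (by ring)
    have hxV : (1 - ε) • q + ε • col A j ∈ V := by
      refine ⟨Set.mem_iInter.2 fun k => ?_, ?_⟩
      · rw [Set.mem_ofPred_eq, hcoord]
        exact hε k
      · simp only [Set.mem_ofPred_eq, hcoord, Finset.sum_add_distrib, ← Finset.mul_sum, hsum]
        rw [← height]
        nlinarith
    have hcl := subset_closure hx
    rw [← (convex_polytope A τ).closure_interior_eq_closure_of_nonempty_interior hinter] at hcl
    exact mem_closure_iff.1 hcl V hVo hxV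
  have hmeas := (hVo.inter isOpen_interior).measure_pos MeasureTheory.volume hne
  have hfin : MeasureTheory.volume (polytope A τ) ≠ ∞ := (isCompact_polytope A τ).measure_ne_top
  have hun : V ∩ interior (polytope A τ) ∪ (⋃ σ ∈ facets d T, polytope A σ) ⊆ polytope A τ :=
    Set.union_subset (Set.inter_subset_right.trans interior_subset) (Set.iUnion₂_subset fun σ hσ =>
      polytope_mono A (hT.subset σ (Finset.mem_filter.1 hσ).1))
  have h1 := MeasureTheory.measure_mono (μ := MeasureTheory.volume) hun
  rw [MeasureTheory.measure_union₀' (hVo.inter isOpen_interior).measurableSet.nullMeasurableSet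
    (hVdisj.mono Set.inter_subset_left le_rfl), ← hvol'] at h1
  rw [add_comm] at h1
  exact absurd h1 (not_le.2 (ENNReal.lt_add_right hfin hmeas.ne'))

end IsTriangulation

/-! ### Regular triangulations of generic weights -/

/-- The **Farkas lemma** for finitely many linear functionals. -/
theorem exists_nonneg_combination {W ι : Type*} [AddCommGroup W] [Module ℝ W] (s : Finset ι)
    (α : ι → W →ₗ[ℝ] ℝ) (γ : W →ₗ[ℝ] ℝ) (H : ∀ x, (∀ i ∈ s, α i x ≤ 0) → γ x ≤ 0) :
    ∃ c : ι → ℝ, (∀ i ∈ s, 0 ≤ c i) ∧ γ = ∑ i ∈ s, c i • α i := by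
  classical
  induction s using Finset.induction_on generalizing α γ with
  | empty =>
    refine ⟨0, by simp, LinearMap.ext fun x => le_antisymm (H x (by simp)) ?_⟩
    have := H (-x) (by simp)
    rw [map_neg] at this
    simp only [Finset.sum_empty, LinearMap.zero_apply]
    linarith
  | insert a s ha ih =>
    by_cases hs : ∀ x, (∀ i ∈ s, α i x ≤ 0) → γ x ≤ 0
    · obtain ⟨c, hc, hγ⟩ := ih α γ hs
      refine ⟨Function.update c a 0, fun i hi => ?_, ?_⟩
      · by_cases hia : i = a
        · subst hia; simp
        · rw [Function.update_of_ne hia]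
          exact hc i ((Finset.mem_insert.1 hi).resolve_left hia)
      · rw [Finset.sum_insert ha, Function.update_self, zero_smul, zero_add, hγ]
        exact Finset.sum_congr rfl fun i hi => by
          rw [Function.update_of_ne (ne_of_mem_of_not_mem hi ha)]
    · push Not at hs
      obtain ⟨z, hz, hγz⟩ := hs
      have haz : 0 < α a z := by
        by_contra! hle
        exact absurd (H z fun i hi => (Finset.mem_insert.1 hi).elim (fun h => h ▸ hle) (hz i))
          (not_le.2 hγz)
      -- Since `α a y = 1`, the map `x ↦ x - α a x • y` projects onto the kernel of `α a`; composing
      -- with it eliminates one functional, and the induction hypothesis applies to the rest.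
      set y := (α a z)⁻¹ • z with hy
      have hay : α a y = 1 := by rw [hy, map_smul, smul_eq_mul, inv_mul_cancel₀ haz.ne']
      have hiy : ∀ i ∈ s, α i y ≤ 0 := fun i hi => by
        rw [hy, map_smul, smul_eq_mul]
        exact mul_nonpos_of_nonneg_of_nonpos (inv_nonneg.2 haz.le) (hz i hi)
      have hγy : 0 ≤ γ y := by
        rw [hy, map_smul, smul_eq_mul]
        exact mul_nonneg (inv_nonneg.2 haz.le) hγz.le
      obtain ⟨c, hc, hγ⟩ := ih (fun i => α i - α i y • α a) (γ - γ y • α a) fun x hx => by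
        have hx' : ∀ β : W →ₗ[ℝ] ℝ, (β - β y • α a) x = β (x - α a x • y) := fun β => by
          simp only [LinearMap.sub_apply, LinearMap.smul_apply, map_sub, map_smul, smul_eq_mul]
          ring
        rw [hx']
        refine H _ fun i hi => ?_
        rcases Finset.mem_insert.1 hi with rfl | hi
        · simp [hay]
        · rw [← hx']
          exact hx i hi
      have hsum : γ = (γ y - ∑ i ∈ s, c i * α i y) • α a + ∑ i ∈ s, c i • α i := by
        ext x
        have h1 := LinearMap.congr_fun hγ x
        simp only [LinearMap.sub_apply, LinearMap.smul_apply, LinearMap.sum_apply, smul_eq_mul,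
          mul_sub, Finset.sum_sub_distrib] at h1
        simp only [LinearMap.add_apply, LinearMap.smul_apply, LinearMap.sum_apply, smul_eq_mul,
          sub_mul, Finset.sum_mul, mul_assoc]
        linarith
      refine ⟨Function.update c a (γ y - ∑ i ∈ s, c i * α i y), fun i hi => ?_, ?_⟩
      · by_cases hia : i = a
        · subst hia
          rw [Function.update_self]
          have : ∑ j ∈ s, c j * α j y ≤ 0 :=
            Finset.sum_nonpos fun j hj => mul_nonpos_of_nonneg_of_nonpos (hc j hj) (hiy j hj)
          linarith
        · rw [Function.update_of_ne hia]
          exact hc i ((Finset.mem_insert.1 hi).resolve_left hia)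
      · rw [Finset.sum_insert ha, Function.update_self]
        nth_rewrite 1 [hsum]
        congr 1
        exact Finset.sum_congr rfl fun i hi => by
          rw [Function.update_of_ne (ne_of_mem_of_not_mem hi ha)]

theorem mem_weightComplex {d n : ℕ} {A : Matrix (Fin d) (Fin n) ℤ} {τ : Finset (Fin n)}
    {ω : Fin n → ℝ} {σ : Finset (Fin n)} : σ ∈ weightComplex A τ ω ↔ σ ⊆ τ ∧ ∃ c : Fin d → ℝ,
      (∀ j ∈ σ, c ⬝ᵥ col A j = ω j) ∧ ∀ j ∈ τ \ σ, c ⬝ᵥ col A j < ω j := by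
  classical
  rw [weightComplex, Finset.mem_filter, Finset.mem_powerset]

section Weight

variable {d n : ℕ} {A : Matrix (Fin d) (Fin n) ℤ} {τ : Finset (Fin n)} {ω : Fin n → ℝ}

/-- An optimal representation of a point of the cone `pos(τ)` by the columns of `A_τ`. -/
theorem exists_isMin_representation (hω : ∀ j, 1 ≤ ω j) {y : Fin d → ℝ} (hy : y ∈ pos A τ) :
    ∃ x : Fin n → ℝ, (∀ j, 0 ≤ x j) ∧ (∀ j ∉ τ, x j = 0) ∧ y = ∑ j, x j • col A j ∧
      ∀ x' : Fin n → ℝ, (∀ j, 0 ≤ x' j) → (∀ j ∉ τ, x' j = 0) → y = ∑ j, x' j • col A j →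
        ∑ j, x j * ω j ≤ ∑ j, x' j * ω j := by
  classical
  obtain ⟨c, hc, hyc⟩ := hy
  set x₀ : Fin n → ℝ := fun j => if j ∈ τ then c j else 0 with hx₀
  have hx₀y : y = ∑ j, x₀ j • col A j := by
    simp only [hx₀, ite_smul, zero_smul, Finset.sum_ite_mem, Finset.univ_inter]
    exact hyc
  set S : Set (Fin n → ℝ) := {x | (∀ j, 0 ≤ x j) ∧ (∀ j, j ∉ τ → x j = 0) ∧
    y = ∑ j, x j • col A j ∧ ∑ j, x j * ω j ≤ ∑ j, x₀ j * ω j} with hS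
  have hx₀S : x₀ ∈ S := by
    refine ⟨fun j => ?_, fun j hj => if_neg hj, hx₀y, le_rfl⟩
    simp only [hx₀]
    split_ifs with hj
    · exact hc j hj
    · exact le_rfl
  have hclosed : IsClosed S := by
    simp only [hS, Set.ofPred_and, Set.ofPred_forall]
    refine IsClosed.inter (isClosed_iInter fun j => isClosed_le continuous_const (by fun_prop)) ?_
    refine IsClosed.inter (isClosed_iInter fun j => isClosed_iInter fun _ =>
      isClosed_eq (by fun_prop) continuous_const) ?_
    exact IsClosed.inter (isClosed_eq continuous_const (by fun_prop))
      (isClosed_le (by fun_prop) continuous_const)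
  -- This is where `ω ≥ 1` enters: bounded cost bounds every coefficient, so the minimum is
  -- attained.
  have hbdd : S ⊆ Set.Icc 0 (fun _ => ∑ j, x₀ j * ω j) := fun x hx => by
    refine ⟨hx.1, fun j => ?_⟩
    have h1 := Finset.single_le_sum (f := fun j => x j * ω j)
      (fun j _ => mul_nonneg (hx.1 j) (zero_le_one.trans (hω j))) (Finset.mem_univ j)
    have h2 : x j ≤ x j * ω j := le_mul_of_one_le_right (hx.1 j) (hω j)
    exact h2.trans (h1.trans hx.2.2.2)
  obtain ⟨x, hx, hmin⟩ := (isCompact_Icc.of_isClosed_subset hclosed hbdd).exists_isMinOn ⟨x₀, hx₀S⟩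
    (f := fun x => ∑ j, x j * ω j) (by fun_prop)
  refine ⟨x, hx.1, hx.2.1, hx.2.2.1, fun x' h0 h1 h2 => ?_⟩
  by_cases hle : ∑ j, x' j * ω j ≤ ∑ j, x₀ j * ω j
  · exact hmin (show x' ∈ S from ⟨h0, h1, h2, hle⟩)
  · exact hx.2.2.2.trans (not_le.1 hle).le

/-- Complementary slackness: the columns used by an optimal representation lie on a common
supporting hyperplane of the lifted configuration. -/
theorem exists_supporting (hω : ∀ j, 1 ≤ ω j) {y : Fin d → ℝ} (hy : y ∈ pos A τ) :
    ∃ σ ∈ weightComplex A τ ω, y ∈ pos A σ := by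
  classical
  obtain ⟨x, hx0, hxτ, hxy, hmin⟩ := exists_isMin_representation hω hy
  set σ₀ := τ.filter fun j => 0 < x j with hσ₀
  suffices hc : ∃ c : Fin d → ℝ, (∀ j ∈ τ, c ⬝ᵥ col A j ≤ ω j) ∧
      ∀ j ∈ σ₀, ω j ≤ c ⬝ᵥ col A j by
    obtain ⟨c, hc1, hc2⟩ := hc
    refine ⟨τ.filter fun j => c ⬝ᵥ col A j = ω j, mem_weightComplex.2 ⟨Finset.filter_subset _ _, c,
      fun j hj => (Finset.mem_filter.1 hj).2, fun j hj => ?_⟩, x, fun j _ => hx0 j, ?_⟩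
    · obtain ⟨hjτ, hj⟩ := Finset.mem_sdiff.1 hj
      exact lt_of_le_of_ne (hc1 j hjτ) fun h => hj (Finset.mem_filter.2 ⟨hjτ, h⟩)
    · rw [hxy]
      refine (Finset.sum_subset (Finset.subset_univ _) fun j _ hj => ?_).symm
      have : x j = 0 := by
        by_contra hne
        have hjτ : j ∈ τ := by_contra fun h => hne (hxτ j h)
        have hjσ : j ∈ σ₀ := Finset.mem_filter.2 ⟨hjτ, lt_of_le_of_ne (hx0 j) (Ne.symm hne)⟩
        exact hj (Finset.mem_filter.2 ⟨hjτ, le_antisymm (hc1 j hjτ) (hc2 j hjσ)⟩)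
      rw [this, zero_smul]
  by_contra! hcon
  -- The conditions on `c` are made homogeneous by an extra variable `t`. If no `c` exists, they
  -- force `t ≤ 0`, and Farkas writes the functional `t` as a nonnegative combination.
  let e : Fin n → ((Fin d → ℝ) × ℝ) →ₗ[ℝ] ℝ := fun j =>
    (LinearMap.applyₗ (col A j) ∘ₗ dotProductBilin ℝ ℝ) ∘ₗ LinearMap.fst ℝ _ _ -
      ω j • LinearMap.snd ℝ _ _
  have he : ∀ j c t, e j (c, t) = c ⬝ᵥ col A j - ω j * t := fun j c t => rfl
  let α : Fin n ⊕ Fin n → ((Fin d → ℝ) × ℝ) →ₗ[ℝ] ℝ := Sum.elim e fun j => -e j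
  obtain ⟨c, hc, hγ⟩ := exists_nonneg_combination (τ.disjSum σ₀) α (LinearMap.snd ℝ _ _) (by
    rintro ⟨c, t⟩ hct
    by_contra! ht
    change 0 < t at ht
    obtain ⟨j, hj, hjlt⟩ := hcon (t⁻¹ • c) fun j hj => by
      have h1 : e j (c, t) ≤ 0 := hct (Sum.inl j) (Finset.inl_mem_disjSum.2 hj)
      rw [he] at h1
      rw [smul_dotProduct, smul_eq_mul, inv_mul_le_iff₀ ht]
      linarith
    have h1 : -e j (c, t) ≤ 0 := hct (Sum.inr j) (Finset.inr_mem_disjSum.2 hj)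
    rw [he] at h1
    rw [smul_dotProduct, smul_eq_mul, inv_mul_lt_iff₀ ht] at hjlt
    linarith)
  -- The multipliers form a direction along which the represented point is fixed and the cost falls
  -- at rate 1. It is nonnegative off the support of `x`, so a small step from `x` contradicts
  -- optimality.
  set v : Fin n → ℝ := fun j => (if j ∈ τ then c (Sum.inl j) else 0) -
    if j ∈ σ₀ then c (Sum.inr j) else 0 with hv
  have hval : ∀ b t, t = ∑ j, v j * e j (b, t) := fun b t => by
    have h1 := LinearMap.congr_fun hγ (b, t)
    rw [Finset.sum_disjSum] at h1
    simp only [LinearMap.snd_apply, LinearMap.add_apply, LinearMap.sum_apply, LinearMap.smul_apply,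
      α, Sum.elim_inl, Sum.elim_inr, LinearMap.neg_apply, smul_eq_mul] at h1
    simp only [hv, sub_mul, Finset.sum_sub_distrib, ite_mul, zero_mul, Finset.sum_ite_mem,
      Finset.univ_inter]
    simp only [mul_neg, Finset.sum_neg_distrib, ← sub_eq_add_neg] at h1
    exact h1
  have hvω : ∑ j, v j * ω j = -1 := by
    have := hval 0 1
    simp only [he, zero_dotProduct, zero_sub, mul_one, mul_neg, Finset.sum_neg_distrib] at this
    linarith
  have hvA : ∑ j, v j • col A j = 0 := by
    funext i
    have := hval (Pi.single i 1) 0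
    simp only [he, single_dotProduct, one_mul, mul_zero, sub_zero] at this
    rw [Finset.sum_apply]
    exact this.symm
  have hv0 : ∀ j, j ∉ σ₀ → 0 ≤ v j := fun j hj => by
    simp only [hv, hj, if_false, sub_zero]
    split_ifs with hjτ
    · exact hc _ (Finset.inl_mem_disjSum.2 hjτ)
    · exact le_rfl
  have hev : ∀ᶠ ε in nhdsWithin (0 : ℝ) (Set.Ioi 0), ∀ j, 0 ≤ x j + ε * v j := by
    refine Filter.eventually_all.2 fun j => ?_
    by_cases hj : j ∈ σ₀
    · refine Filter.Eventually.filter_mono nhdsWithin_le_nhds ?_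
      have hcont : Continuous fun ε : ℝ => x j + ε * v j := by fun_prop
      have h0 : 0 < x j + 0 * v j := by simpa using (Finset.mem_filter.1 hj).2
      exact (hcont.continuousAt.eventually_const_lt h0).mono fun _ h => h.le
    · filter_upwards [self_mem_nhdsWithin] with ε hε
      exact add_nonneg (hx0 j) (mul_nonneg (le_of_lt hε) (hv0 j hj))
  obtain ⟨ε, hε, hε0⟩ := (hev.and self_mem_nhdsWithin).exists
  have hle := hmin (fun j => x j + ε * v j) hε (fun j hj => by
    have hjσ : j ∉ σ₀ := fun h => hj (Finset.mem_filter.1 h).1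
    simp [hv, hxτ j hj, hj, hjσ]) (by
    simp only [add_smul, mul_smul, Finset.sum_add_distrib, ← Finset.smul_sum, hvA, smul_zero,
      add_zero]
    exact hxy)
  simp only [add_mul, Finset.sum_add_distrib, mul_assoc, ← Finset.mul_sum, hvω] at hle
  have : 0 < ε := hε0
  linarith

theorem pos_mono {σ ρ : Finset (Fin n)} (h : σ ⊆ ρ) : pos A σ ⊆ pos A ρ := by
  classical
  rintro _ ⟨c, hc, rfl⟩
  refine ⟨fun j => if j ∈ σ then c j else 0, fun j _ => ?_, ?_⟩
  · dsimp only
    split_ifs with hj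
    exacts [hc j hj, le_rfl]
  · simp only [ite_smul, zero_smul, Finset.sum_ite_mem, Finset.inter_eq_right.2 h]

/-- Complementary slackness: both representations of a common point have the same minimal cost, so a
representation by `σ'` puts no weight on columns strictly below the supporting hyperplane of `σ`. -/
theorem pos_inter_of_mem_weightComplex {σ σ' : Finset (Fin n)} (hσ : σ ∈ weightComplex A τ ω)
    (hσ' : σ' ∈ weightComplex A τ ω) : pos A σ ∩ pos A σ' = pos A (σ ∩ σ') := by
  classical
  refine Set.Subset.antisymm ?_ (Set.subset_inter (pos_mono Finset.inter_subset_left)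
    (pos_mono Finset.inter_subset_right))
  obtain ⟨hsub, b, hb, hb'⟩ := mem_weightComplex.1 hσ
  obtain ⟨hsub', b', hbb, hbb'⟩ := mem_weightComplex.1 hσ'
  rintro y ⟨⟨c, hc, hcy⟩, c', hc', hcy'⟩
  have hdot : ∀ (b : Fin d → ℝ) (c : Fin n → ℝ) (ρ : Finset (Fin n)),
      b ⬝ᵥ (∑ j ∈ ρ, c j • col A j) = ∑ j ∈ ρ, c j * (b ⬝ᵥ col A j) := fun b c ρ => by
    rw [dotProduct_sum]
    exact Finset.sum_congr rfl fun j _ => by rw [dotProduct_smul, smul_eq_mul]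
  have hle : ∀ j ∈ τ, b ⬝ᵥ col A j ≤ ω j := fun j hj => by
    by_cases hjσ : j ∈ σ
    · exact (hb j hjσ).le
    · exact (hb' j (Finset.mem_sdiff.2 ⟨hj, hjσ⟩)).le
  have hle' : ∀ j ∈ τ, b' ⬝ᵥ col A j ≤ ω j := fun j hj => by
    by_cases hjσ : j ∈ σ'
    · exact (hbb j hjσ).le
    · exact (hbb' j (Finset.mem_sdiff.2 ⟨hj, hjσ⟩)).le
  have h1 : ∑ j ∈ σ', c' j * ω j ≤ ∑ j ∈ σ, c j * ω j := by
    have h2 : b' ⬝ᵥ y = ∑ j ∈ σ', c' j * ω j := by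
      rw [hcy', hdot]
      exact Finset.sum_congr rfl fun j hj => by rw [hbb j hj]
    rw [← h2, hcy, hdot]
    exact Finset.sum_le_sum fun j hj => mul_le_mul_of_nonneg_left (hle' j (hsub hj)) (hc j hj)
  have h3 : ∑ j ∈ σ', c' j * (b ⬝ᵥ col A j) = ∑ j ∈ σ, c j * ω j := by
    rw [← hdot, ← hcy', hcy, hdot]
    exact Finset.sum_congr rfl fun j hj => by rw [hb j hj]
  have h4 : ∑ j ∈ σ', c' j * (ω j - b ⬝ᵥ col A j) = 0 := by
    refine le_antisymm ?_ (Finset.sum_nonneg fun j hj =>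
      mul_nonneg (hc' j hj) (sub_nonneg.2 (hle j (hsub' hj))))
    simp only [mul_sub, Finset.sum_sub_distrib]
    linarith
  rw [Finset.sum_eq_zero_iff_of_nonneg fun j hj =>
      mul_nonneg (hc' j hj) (sub_nonneg.2 (hle j (hsub' hj)))] at h4
  refine ⟨c', fun j hj => hc' j (Finset.mem_inter.1 hj).2, ?_⟩
  rw [hcy']
  refine (Finset.sum_subset Finset.inter_subset_right fun j hj hj' => ?_).symm
  have hjσ : j ∉ σ := fun h => hj' (Finset.mem_inter.2 ⟨h, hj⟩)
  have h5 := hb' j (Finset.mem_sdiff.2 ⟨hsub' hj, hjσ⟩)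
  rcases mul_eq_zero.1 (h4 j hj) with h6 | h6
  · rw [h6, zero_smul]
  · linarith

theorem exists_dotProduct_col_eq {σ : Finset (Fin n)}
    (hli : LinearIndependent ℝ fun i : σ => col A i) (g : Fin n → ℝ) :
    ∃ e : Fin d → ℝ, ∀ i ∈ σ, e ⬝ᵥ col A i = g i := by
  obtain ⟨f, hf⟩ := LinearMap.exists_leftInverse_of_injective
    (Fintype.linearCombination ℝ fun i : σ => col A i)
    (LinearMap.ker_eq_bot.2 (linearIndependent_iff_injective_fintypeLinearCombination.1 hli))
  let l : (Fin d → ℝ) →ₗ[ℝ] ℝ := Fintype.linearCombination ℝ (fun i : σ => g i) ∘ₗ f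
  refine ⟨fun i => l (Pi.single i 1), fun i hi => ?_⟩
  have h1 : l (col A i) = g i := by
    have h2 := LinearMap.congr_fun hf (Pi.single ⟨i, hi⟩ 1)
    simp only [LinearMap.comp_apply, Fintype.linearCombination_apply_single, one_smul,
      LinearMap.id_apply] at h2
    simp only [l, LinearMap.comp_apply, h2, Fintype.linearCombination_apply_single, one_smul]
  rw [← h1, l.pi_apply_eq_sum_univ]
  simp only [dotProduct, smul_eq_mul, mul_comm]
  refine Finset.sum_congr rfl fun k _ => ?_
  congr 2
  funext k'
  simp [Pi.single_apply, eq_comm]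

/-- The supporting functional is tilted slightly by one that is 0 on `ρ` and -1 on `σ \ ρ`; the
strict inequalities off `σ` survive. -/
theorem mem_weightComplex_of_subset {σ ρ : Finset (Fin n)} (hσ : σ ∈ weightComplex A τ ω)
    (hli : LinearIndependent ℝ fun i : σ => col A i) (hρ : ρ ⊆ σ) : ρ ∈ weightComplex A τ ω := by
  classical
  obtain ⟨hsub, b, hb, hb'⟩ := mem_weightComplex.1 hσ
  obtain ⟨e, he⟩ := exists_dotProduct_col_eq hli fun i => if i ∈ ρ then 0 else -1
  have hev : ∀ᶠ ε in nhdsWithin (0 : ℝ) (Set.Ioi 0), ∀ j ∈ τ \ σ,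
      (b + ε • e) ⬝ᵥ col A j < ω j := by
    refine Filter.Eventually.filter_mono nhdsWithin_le_nhds ((Finset.eventually_all _).2 ?_)
    intro j hj
    have hcont : Continuous fun ε : ℝ => (b + ε • e) ⬝ᵥ col A j := by
      simp only [add_dotProduct, smul_dotProduct]; fun_prop
    exact hcont.continuousAt.eventually_lt_const (by simpa using hb' j hj)
  obtain ⟨ε, hε, hε0⟩ := (hev.and self_mem_nhdsWithin).exists
  refine mem_weightComplex.2 ⟨hρ.trans hsub, b + ε • e, fun j hj => ?_, fun j hj => ?_⟩
  · rw [add_dotProduct, smul_dotProduct, hb j (hρ hj), he j (hρ hj), if_pos hj, smul_zero, add_zero]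
  · obtain ⟨hjτ, hjρ⟩ := Finset.mem_sdiff.1 hj
    by_cases hjσ : j ∈ σ
    · rw [add_dotProduct, smul_dotProduct, hb j hjσ, he j hjσ, if_neg hjρ, smul_eq_mul]
      have : 0 < ε := hε0
      linarith
    · exact hε j (Finset.mem_sdiff.2 ⟨hjτ, hjσ⟩)

theorem isTriangulation_weightComplex (hω : ∀ j, 1 ≤ ω j)
    (hli : ∀ σ ∈ weightComplex A τ ω, LinearIndependent ℝ fun i : σ => col A i) :
    IsTriangulation A τ (weightComplex A τ ω) where
  subset σ hσ := (mem_weightComplex.1 hσ).1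
  linearIndependent := hli
  down_closed σ hσ _ hρ := mem_weightComplex_of_subset hσ (hli σ hσ) hρ
  inter _ hσ _ hσ' := pos_inter_of_mem_weightComplex hσ hσ'
  cover := by
    refine Set.Subset.antisymm (Set.iUnion₂_subset fun σ hσ => pos_mono (mem_weightComplex.1 hσ).1)
      fun y hy => ?_
    obtain ⟨σ, hσ, hyσ⟩ := exists_supporting hω hy
    exact Set.mem_iUnion₂.2 ⟨σ, hσ, hyσ⟩

/-- The columns of a cell satisfy `b ⬝ᵥ a_i = ω i`, so every linear relation among them is also one
among the weights. -/
theorem linearIndependent_of_mem_weightComplex {σ : Finset (Fin n)}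
    (hσ : σ ∈ weightComplex A τ ω)
    (hω : ¬ (LinearIndependent ℝ fun i : σ => col A i) → ∃ c : Fin n → ℝ,
      ∑ i ∈ σ, c i • col A i = 0 ∧ ∑ i ∈ σ, c i * ω i ≠ 0) :
    LinearIndependent ℝ fun i : σ => col A i := by
  by_contra hli
  obtain ⟨c, hc, hcω⟩ := hω hli
  obtain ⟨-, b, hb, -⟩ := mem_weightComplex.1 hσ
  refine hcω ?_
  have h1 : b ⬝ᵥ (∑ i ∈ σ, c i • col A i) = ∑ i ∈ σ, c i * ω i := by
    rw [dotProduct_sum]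
    exact Finset.sum_congr rfl fun i hi => by rw [dotProduct_smul, smul_eq_mul, hb i hi]
  rw [← h1, hc, dotProduct_zero]

theorem sum_simplexCoord_mul_eq_dotProduct {σ : Finset (Fin n)} {h : σ.card = d}
    (hdet : IsUnit (subMatrix A σ h).det) {b : Fin d → ℝ} (hb : ∀ i ∈ σ, b ⬝ᵥ col A i = ω i)
    (j : Fin n) : ∑ k, simplexCoord A σ h j k * ω (σ.orderEmbOfFin h k) = b ⬝ᵥ col A j := by
  obtain ⟨c, hc⟩ := exists_extend_orderEmbOfFin σ h (simplexCoord A σ h j)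
  rw [← mulVec_simplexCoord A σ h hdet j, ← funext hc, subMatrix_mulVec, dotProduct_sum,
    sum_orderEmbOfFin σ h fun i => c i * ω i]
  exact Finset.sum_congr rfl fun i hi => by rw [dotProduct_smul, smul_eq_mul, hb i hi]

theorem sum_simplexCoord_mul_lt {σ : Finset (Fin n)} {h : σ.card = d}
    (hdet : IsUnit (subMatrix A σ h).det) (hσ : σ ∈ weightComplex A τ ω) {j : Fin n}
    (hj : j ∈ τ \ σ) : ∑ k, simplexCoord A σ h j k * ω (σ.orderEmbOfFin h k) < ω j := by
  obtain ⟨-, b, hb, hb'⟩ := mem_weightComplex.1 hσ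
  rw [sum_simplexCoord_mul_eq_dotProduct hdet hb]
  exact hb' j hj

theorem sum_simplexCoord_mul_le {σ : Finset (Fin n)} {h : σ.card = d}
    (hdet : IsUnit (subMatrix A σ h).det) (hσ : σ ∈ weightComplex A τ ω) {j : Fin n} (hj : j ∈ τ) :
    ∑ k, simplexCoord A σ h j k * ω (σ.orderEmbOfFin h k) ≤ ω j := by
  by_cases hjσ : j ∈ σ
  · obtain ⟨-, b, hb, -⟩ := mem_weightComplex.1 hσ
    rw [sum_simplexCoord_mul_eq_dotProduct hdet hb]
    exact (hb j hjσ).le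
  · exact (sum_simplexCoord_mul_lt hdet hσ (Finset.mem_sdiff.2 ⟨hj, hjσ⟩)).le

end Weight

/-- A generic perturbation of the constant weight `1`. -/
theorem exists_generic_weight {d n : ℕ} (A : Matrix (Fin d) (Fin n) ℤ) :
    ∃ ω : Fin n → ℝ, (∀ j, 1 ≤ ω j) ∧
      (∀ σ : Finset (Fin n), ¬ (LinearIndependent ℝ fun i : σ => col A i) → ∃ c : Fin n → ℝ,
        ∑ i ∈ σ, c i • col A i = 0 ∧ ∑ i ∈ σ, c i * ω i ≠ 0) ∧
      ∀ (σ : Finset (Fin n)) (h : σ.card = d) (j : Fin n),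
        ∑ k, simplexCoord A σ h j k * ω (σ.orderEmbOfFin h k) ≤ ω j → height A σ h j ≤ 1 := by
  classical
  -- The weights are `1 + t^(i+1)`. The distinct powers turn a linear relation among the columns
  -- into a nonzero polynomial in `t`, which has no roots in a punctured neighbourhood of 0.
  have hli : ∀ᶠ t in nhdsWithin (0 : ℝ) (Set.Ioi 0), ∀ σ : Finset (Fin n),
      ¬ (LinearIndependent ℝ fun i : σ => col A i) → ∃ c : Fin n → ℝ,
        ∑ i ∈ σ, c i • col A i = 0 ∧ ∑ i ∈ σ, c i * (1 + t ^ ((i : ℕ) + 1)) ≠ 0 := by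
    refine Filter.eventually_all.2 fun σ => ?_
    by_cases hσ : LinearIndependent ℝ fun i : σ => col A i
    · exact Filter.Eventually.of_forall fun _ h => absurd hσ h
    obtain ⟨c', hc', ⟨i₀, hi₀⟩, hci₀⟩ := Fintype.not_linearIndependent_iff.1 hσ
    set c : Fin n → ℝ := fun i => if hi : i ∈ σ then c' ⟨i, hi⟩ else 0 with hc
    have hc0 : ∑ i ∈ σ, c i • col A i = 0 := by
      rw [← hc', ← Finset.sum_coe_sort σ fun i => c i • col A i]
      exact Finset.sum_congr rfl fun i _ => by simp [hc]
    let P : Polynomial ℝ :=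
      ∑ i ∈ σ, Polynomial.C (c i) * (1 + Polynomial.X ^ ((i : ℕ) + 1))
    have hP : P ≠ 0 := fun h0 => by
      have h1 := congrArg (fun Q => Polynomial.coeff Q ((i₀ : ℕ) + 1)) h0
      simp only [P, Polynomial.finsetSum_coeff, Polynomial.coeff_C_mul, Polynomial.coeff_add,
        Polynomial.coeff_one, Polynomial.coeff_X_pow, Polynomial.coeff_zero] at h1
      rw [Finset.sum_eq_single i₀] at h1
      · simp [hc, hi₀] at h1
        exact hci₀ h1
      · intro i _ hi
        have : (i₀ : ℕ) ≠ i := fun h => hi (Fin.ext h.symm)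
        simp [this]
      · exact fun h => absurd hi₀ h
    have hfin := (Polynomial.finite_setOfPred_isRoot hP).subset
      (Set.sdiff_subset (t := {(0 : ℝ)}))
    have hmem := hfin.isClosed.isOpen_compl.mem_nhds (x := (0 : ℝ)) (by simp)
    filter_upwards [nhdsWithin_le_nhds hmem, self_mem_nhdsWithin] with t ht ht0 _
    refine ⟨c, hc0, fun h0 => ht ⟨?_, (ne_of_gt ht0)⟩⟩
    simpa [P, Polynomial.IsRoot, Polynomial.eval_finsetSum] using h0
  -- At `t = 0` the premise reads `height ≤ 1`; if that fails, continuity makes the premise fail for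
  -- all small `t`.
  have hheight : ∀ᶠ t in nhdsWithin (0 : ℝ) (Set.Ioi 0), ∀ (σ : Finset (Fin n)) (j : Fin n)
      (h : σ.card = d), ∑ k, simplexCoord A σ h j k *
        (1 + t ^ ((σ.orderEmbOfFin h k : ℕ) + 1)) ≤ 1 + t ^ ((j : ℕ) + 1) →
          height A σ h j ≤ 1 := by
    refine Filter.eventually_all.2 fun σ => Filter.eventually_all.2 fun j => ?_
    by_cases h : σ.card = d
    swap
    · exact Filter.Eventually.of_forall fun _ h' => absurd h' h
    by_cases hle : height A σ h j ≤ 1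
    · exact Filter.Eventually.of_forall fun _ _ _ => hle
    have hcont : Continuous fun t : ℝ => ∑ k, simplexCoord A σ h j k *
        (1 + t ^ ((σ.orderEmbOfFin h k : ℕ) + 1)) - (1 + t ^ ((j : ℕ) + 1)) := by fun_prop
    have h0 : 0 < ∑ k, simplexCoord A σ h j k *
        (1 + (0 : ℝ) ^ ((σ.orderEmbOfFin h k : ℕ) + 1)) - (1 + (0 : ℝ) ^ ((j : ℕ) + 1)) := by
      simpa [height] using hle
    filter_upwards [nhdsWithin_le_nhds (hcont.continuousAt.eventually_const_lt h0)] with t ht _ hle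
    linarith
  obtain ⟨t, ⟨hli, hheight⟩, ht⟩ := ((hli.and hheight).and self_mem_nhdsWithin).exists
  refine ⟨fun i => 1 + t ^ ((i : ℕ) + 1), fun j => ?_, hli, fun σ h j => hheight σ j h⟩
  have : 0 ≤ t ^ ((j : ℕ) + 1) := pow_nonneg (le_of_lt ht) _
  linarith

theorem exists_isVolumeTriangulation {d n : ℕ} (A : Matrix (Fin d) (Fin n) ℤ)
    (τ : Finset (Fin n)) : ∃ T, IsVolumeTriangulation A τ T := by
  obtain ⟨ω, hω, hli, hheight⟩ := exists_generic_weight A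
  have hT := isTriangulation_weightComplex (τ := τ) hω fun σ hσ =>
    linearIndependent_of_mem_weightComplex hσ (hli σ)
  refine ⟨weightComplex A τ ω, ⟨⟨ω, rfl⟩, hT⟩, hT.normVol_eq_sum fun σ hσ h j hj => ?_⟩
  exact hheight σ h j (sum_simplexCoord_mul_le (hT.isUnit_det hσ h) hσ hj)

/-! ### The domains of convergence -/

section Domain

variable {d n : ℕ} {A : Matrix (Fin d) (Fin n) ℤ} {τ : Finset (Fin n)}

theorem isOpen_simplexDomain (A : Matrix (Fin d) (Fin n) ℤ) (R : ℝ) (σ : Finset (Fin n)) :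
    IsOpen (simplexDomain A R σ) := by
  refine isOpen_iff_mem_nhds.2 fun x hx => ?_
  have h1 : ∀ᶠ y in nhds x, ∀ i ∈ σ, y i ≠ 0 := by
    refine (Finset.eventually_all _).2 fun i hi => ?_
    exact (continuous_apply i).continuousAt.eventually_ne (hx.1 i hi)
  have h2 : ∀ᶠ y in nhds x, ∀ j, ∀ h : σ.card = d, j ∉ σ → height A σ h j = 1 →
      ‖y j‖ < R * ∏ k, ‖y (σ.orderEmbOfFin h k)‖ ^ simplexCoord A σ h j k := by
    refine Filter.eventually_all.2 fun j => ?_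
    by_cases h : σ.card = d ∧ j ∉ σ ∧ ∀ h : σ.card = d, height A σ h j = 1
    · obtain ⟨h, hj, hh⟩ := h
      have hc : ContinuousAt (fun y : Fin n → ℂ => R *
          ∏ k, ‖y (σ.orderEmbOfFin h k)‖ ^ simplexCoord A σ h j k) x := by
        refine continuousAt_const.mul (tendsto_finsetProd _ fun k _ => ?_)
        refine ContinuousAt.rpow_const (continuous_apply _).norm.continuousAt (Or.inl ?_)
        exact norm_ne_zero_iff.2 (hx.1 _ (Finset.orderEmbOfFin_mem _ _ _))
      filter_upwards [(continuous_apply j).norm.continuousAt.eventually_lt hc (hx.2 h j hj (hh h))]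
        with y hy _ _ _
      exact hy
    · exact Filter.Eventually.of_forall fun y h' hj hh => absurd ⟨h', hj, fun _ => hh⟩ h
  filter_upwards [h1, h2] with y hy1 hy2
  exact ⟨hy1, fun h j => hy2 j h⟩

theorem exists_isOpen_commonDomain (A : Matrix (Fin d) (Fin n) ℤ) (R : ℝ) (τ : Finset (Fin n))
    (S : Finset (Finset (Fin n))) :
    ∃ O : Set (Fin n → ℂ), IsOpen O ∧ commonDomain A R τ S = coordSubspace τ ∩ O :=
  ⟨_, isOpen_biInter_finset fun σ _ => isOpen_simplexDomain A R σ, rfl⟩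

/-- At `x_j = exp(-t ω_j)` for `j ∈ τ`, the inequalities of `U_σ` become, up to the constant `R`,
the strict inequalities of the regular triangulation multiplied by `t`. For `t` large they hold for
any `R > 0` and all `σ` together. -/
theorem commonDomain_nonempty {T S : Finset (Finset (Fin n))} (hT : IsRegularTriangulation A τ T)
    (hS : S ⊆ facets d T) {R : ℝ} (hR : 0 < R) : (commonDomain A R τ S).Nonempty := by
  classical
  obtain ⟨⟨ω, hω⟩, hT⟩ := hT
  have hev : ∀ᶠ t in Filter.atTop, ∀ σ ∈ S, ∀ j ∈ τ \ σ, ∀ h : σ.card = d, Real.exp (-(t * ω j)) <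
      R * Real.exp (-(t * ∑ k, simplexCoord A σ h j k * ω (σ.orderEmbOfFin h k))) := by
    refine (Finset.eventually_all _).2 fun σ hσ => (Finset.eventually_all _).2 fun j hj => ?_
    obtain ⟨hσT, h⟩ := Finset.mem_filter.1 (hS hσ)
    have hlt := sum_simplexCoord_mul_lt (hT.isUnit_det hσT h) (hω ▸ hσT) hj
    set u := ∑ k, simplexCoord A σ h j k * ω (σ.orderEmbOfFin h k)
    have hlim : Filter.Tendsto (fun t => Real.exp (-(t * (ω j - u)))) Filter.atTop (nhds 0) :=
      Real.tendsto_exp_neg_atTop_nhds_zero.comp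
        (Filter.tendsto_id.atTop_mul_const (sub_pos.2 hlt))
    filter_upwards [hlim.eventually_lt_const hR] with t ht _
    have : Real.exp (-(t * ω j)) = Real.exp (-(t * (ω j - u))) * Real.exp (-(t * u)) := by
      rw [← Real.exp_add]; congr 1; ring
    rw [this]
    gcongr
  obtain ⟨t, ht⟩ := hev.exists
  refine ⟨fun j => if j ∈ τ then (Real.exp (-(t * ω j)) : ℂ) else 0, fun j hj => if_neg hj,
    Set.mem_iInter₂.2 fun σ hσ => ?_⟩
  obtain ⟨hσT, h⟩ := Finset.mem_filter.1 (hS hσ)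
  have hsub := hT.subset σ hσT
  have hval : ∀ i ∈ τ, ‖(if i ∈ τ then (Real.exp (-(t * ω i)) : ℂ) else 0)‖ =
      Real.exp (-(t * ω i)) := fun i hi => by
    rw [if_pos hi, Complex.norm_real, Real.norm_of_nonneg (Real.exp_pos _).le]
  refine ⟨fun i hi => ?_, fun _ j hj _ => ?_⟩
  · rw [← norm_ne_zero_iff, hval i (hsub hi)]
    exact (Real.exp_pos _).ne'
  · have hprod : ∏ k, ‖(if σ.orderEmbOfFin h k ∈ τ then
        (Real.exp (-(t * ω (σ.orderEmbOfFin h k))) : ℂ) else 0)‖ ^ simplexCoord A σ h j k =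
        Real.exp (-(t * ∑ k, simplexCoord A σ h j k * ω (σ.orderEmbOfFin h k))) := by
      rw [Finset.mul_sum, ← Finset.sum_neg_distrib, Real.exp_sum]
      refine Finset.prod_congr rfl fun k _ => ?_
      rw [hval _ (hsub (Finset.orderEmbOfFin_mem _ _ _)), ← Real.exp_mul]
      congr 1
      ring
    dsimp only
    rw [hprod]
    by_cases hjτ : j ∈ τ
    · rw [hval j hjτ]
      exact ht σ hσ j (Finset.mem_sdiff.2 ⟨hjτ, hj⟩) h
    · rw [if_neg hjτ, norm_zero]
      positivity

theorem exists_abs_simplexCoord_le (A : Matrix (Fin d) (Fin n) ℤ) : ∃ D : ℝ, 0 ≤ D ∧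
    ∀ (σ : Finset (Fin n)) (h : σ.card = d) j k, |simplexCoord A σ h j k| ≤ D := by
  obtain ⟨D, hD⟩ := (Set.finite_range fun q : {σ : Finset (Fin n) // σ.card = d} × Fin n × Fin d =>
    |simplexCoord A q.1.1 q.1.2 q.2.1 q.2.2|).bddAbove
  exact ⟨max D 0, le_max_right _ _, fun σ h j k =>
    (hD ⟨(⟨σ, h⟩, j, k), rfl⟩).trans (le_max_left _ _)⟩

/-- The choice `R = exp(-growthRate d n D)` turns the domain inequality into the ratio bound of the
convergence estimate. -/
theorem lt_one_of_mem_simplexDomain {D : ℝ} {σ : Finset (Fin n)} (h : σ.card = d) {p : Fin n → ℂ}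
    (hp : p ∈ simplexDomain A (Real.exp (-growthRate d n D)) σ) {j : Fin n} (hj : j ∉ σ)
    (hj1 : height A σ h j = 1) : Real.exp (growthRate d n D) *
      (‖p j‖ * Real.exp (-∑ k, simplexCoord A σ h j k * (simplexLog σ h p k).re)) < 1 := by
  have h1 := hp.2 h j hj hj1
  have h2 : ∏ k, ‖p (σ.orderEmbOfFin h k)‖ ^ simplexCoord A σ h j k =
      Real.exp (∑ k, simplexCoord A σ h j k * (simplexLog σ h p k).re) := by
    rw [Real.exp_sum]
    refine Finset.prod_congr rfl fun k _ => ?_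
    have h0 : 0 < ‖p (σ.orderEmbOfFin h k)‖ :=
      norm_pos_iff.2 (hp.1 _ (Finset.orderEmbOfFin_mem _ _ _))
    rw [simplexLog, Complex.log_re, Real.rpow_def_of_pos h0, mul_comm]
  rw [h2] at h1
  set u := ∑ k, simplexCoord A σ h j k * (simplexLog σ h p k).re
  set g := growthRate d n D
  calc _ < Real.exp g * ((Real.exp (-g) * Real.exp u) * Real.exp (-u)) := by gcongr
    _ = 1 := by
      rw [mul_assoc (Real.exp (-g)), ← Real.exp_add, ← mul_assoc, ← Real.exp_add]
      simp

theorem isConvergent_of_mem_commonDomain {D s : ℝ}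
    (hD : ∀ (σ : Finset (Fin n)) (h : σ.card = d) j k, |simplexCoord A σ h j k| ≤ D)
    {T : Finset (Finset (Fin n))} (hT : IsVolumeTriangulation A τ T) {p : Fin n → ℂ}
    (hp : p ∈ commonDomain A (Real.exp (-growthRate d n D)) τ (facetsOfOrder A τ T s))
    {σ : Finset (Fin n)} (hσ : σ ∈ facetsOfOrder A τ T s) (h : σ.card = d) :
    IsConvergent A D τ s p σ h := by
  classical
  obtain ⟨⟨-, hTri⟩, hvol⟩ := hT
  obtain ⟨hσf, hσs⟩ := Finset.mem_filter.1 hσ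
  have hσT := (Finset.mem_filter.1 hσf).1
  have hpσ := Set.mem_iInter₂.1 hp.2 σ hσ
  exact ⟨hTri.isUnit_det hσT h, hpσ.1, hp.1, hD σ h, fun j => hTri.height_le_one hvol hσT h,
    hσs h, fun j => lt_one_of_mem_simplexDomain h hpσ⟩

end Domain

/-! ### Lower bounds for the dimension of the solution spaces -/

theorem cdim_mono {n : ℕ} {V W : Submodule ℂ (MvPowerSeries (Fin n) ℂ)} (h : V ≤ W) :
    cdim V ≤ cdim W :=
  ENat.toENNReal_le.2 (OrderHomClass.mono Cardinal.toENat (Submodule.rank_mono h))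

theorem solutions_mono {d n : ℕ} (A : Matrix (Fin d) (Fin n) ℤ) (β : Fin d → ℂ) (p : Fin n → ℂ)
    {F F' : Submodule ℂ (MvPowerSeries (Fin n) ℂ)} (h : F ≤ F') :
    solutions A β p F ≤ solutions A β p F' := fun _ hf => ⟨h hf.1, hf.2⟩

/-- The independent solutions are indexed by a simplex together with a class in `ℤA / ℤA_σ`,
represented by `Quotient.out`; the finite index of `ℤA_σ` makes the index set finite. -/
theorem sum_normVol_le_cdim_solutions {d n : ℕ} {A : Matrix (Fin d) (Fin n) ℤ} {D s : ℝ}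
    {τ : Finset (Fin n)} {p : Fin n → ℂ} (hD : 0 ≤ D) {S : Finset (Finset (Fin n))}
    (hS : ∀ σ ∈ S, σ.card = d) (hc : ∀ σ ∈ S, ∀ h, IsConvergent A D τ s p σ h) (β : Fin d → ℂ) :
    ∑ σ ∈ S, normVol A σ ≤ cdim (solutions A β p (gevreySeries τ s)) := by
  classical
  let Q : S → Type := fun σ => lattice A ⧸ (simplexLattice A σ).addSubgroupOf (lattice A)
  have hdet : ∀ σ : S, IsUnit (subMatrix A σ.1 (hS σ.1 σ.2)).det := fun σ =>
    (hc σ.1 σ.2 _).isUnit_det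
  have hcard : ∀ σ : S, Nat.card (Q σ) = (simplexLattice A σ.1).relIndex (lattice A) :=
    fun _ => rfl
  have hfin : ∀ σ : S, Finite (Q σ) := fun σ => by
    refine Nat.finite_of_card_ne_zero ?_
    rw [hcard]
    have h1 := index_simplexLattice_ne_zero (hdet σ)
    rw [← AddSubgroup.relIndex_mul_index (simplexLattice_le_lattice A σ.1)] at h1
    exact left_ne_zero_of_mul h1
  let w : (Σ σ, Q σ) → Fin d → ℤ := fun j => (Quotient.out j.2 : lattice A)
  obtain ⟨C, hC, G, hG, hGm⟩ := exists_linearIndependent_relations (J := Σ σ, Q σ) hD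
    (fun j => j.1.1) (fun j => hS _ j.1.2) w (fun j => hc _ j.1.2 _) (by
      rintro ⟨⟨σ, hσ⟩, q⟩ ⟨⟨σ', hσ'⟩, q'⟩ hσσ hw
      obtain rfl : σ = σ' := hσσ
      obtain rfl : q = q' := by
        rw [← QuotientAddGroup.out_eq' q, ← QuotientAddGroup.out_eq' q', eq_comm,
          QuotientAddGroup.eq, AddSubgroup.mem_addSubgroupOf]
        simpa [w, neg_add_eq_sub] using hw
      rfl)
    (fun j => exists_isSupported (hdet j.1) (Quotient.out j.2 : lattice A).2) β
  have hle := card_le_cdim (V := solutions A β p (gevreySeries τ s))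
    (hG.map' expSeries (LinearMap.ker_eq_bot.2 expSeries_injective)) fun j => by
      obtain ⟨hrel, C', hC'⟩ := hGm j
      exact expSeries_mem_solutions hrel (expSeries_mem_gevreySeries hC hC')
  refine le_trans ?_ hle
  rw [Nat.card_sigma, ← Finset.sum_coe_sort, Nat.cast_sum]
  exact Finset.sum_le_sum fun σ _ => normVol_le_relIndex (hdet σ)

/-- A height is a sum of `d` coordinates bounded by `D`, so at order `s = d * D` no facet is
excluded. -/
theorem facetsOfOrder_eq_facets {d n : ℕ} {A : Matrix (Fin d) (Fin n) ℤ} {D : ℝ}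
    (hD : ∀ (σ : Finset (Fin n)) (h : σ.card = d) j k, |simplexCoord A σ h j k| ≤ D)
    (τ : Finset (Fin n)) (T : Finset (Finset (Fin n))) :
    facetsOfOrder A τ T (d * D) = facets d T := by
  classical
  refine Finset.filter_true_of_mem fun σ _ h j _ => ?_
  calc height A σ h j ≤ ∑ _k : Fin d, D := Finset.sum_le_sum fun k _ =>
        (le_abs_self _).trans (hD σ h j k)
    _ = d * D := by simp

end

end GKZ

theorem mainTheorem2 {d n : ℕ} (A : Matrix (Fin d) (Fin n) ℤ)
    (hA : (A.map (Int.cast : ℤ → ℝ)).rank = d) :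
    (∀ τ : Finset (Fin n), ∃ T, GKZ.IsVolumeTriangulation A τ T) ∧
    ∃ R : ℝ, 0 < R ∧
      ∀ (τ : Finset (Fin n)) (T : Finset (Finset (Fin n))), GKZ.IsVolumeTriangulation A τ T →
        ((GKZ.commonDomain A R τ (GKZ.facets d T)).Nonempty ∧
          (∃ O : Set (Fin n → ℂ), IsOpen O ∧
            GKZ.commonDomain A R τ (GKZ.facets d T) = GKZ.coordSubspace τ ∩ O) ∧
          ∀ β : Fin d → ℂ, ∀ p ∈ GKZ.commonDomain A R τ (GKZ.facets d T),
            GKZ.normVol A τ ≤ GKZ.cdim (GKZ.solutions A β p (GKZ.formalSeries τ))) ∧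
        ∀ s : ℝ,
          (GKZ.commonDomain A R τ (GKZ.facetsOfOrder A τ T s)).Nonempty ∧
          (∃ O : Set (Fin n → ℂ), IsOpen O ∧
            GKZ.commonDomain A R τ (GKZ.facetsOfOrder A τ T s) = GKZ.coordSubspace τ ∩ O) ∧
          ∀ β : Fin d → ℂ, ∀ p ∈ GKZ.commonDomain A R τ (GKZ.facetsOfOrder A τ T s),
            ∑ σ ∈ GKZ.facetsOfOrder A τ T s, GKZ.normVol A σ ≤
              GKZ.cdim (GKZ.solutions A β p (GKZ.gevreySeries τ s)) := by
  classical
  obtain ⟨D, hD0, hD⟩ := GKZ.exists_abs_simplexCoord_le A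
  refine ⟨GKZ.exists_isVolumeTriangulation A, Real.exp (-GKZ.growthRate d n D), Real.exp_pos _,
    fun τ T hT => ?_⟩
  have hGevrey : ∀ (s : ℝ) (β : Fin d → ℂ),
      ∀ p ∈ GKZ.commonDomain A (Real.exp (-GKZ.growthRate d n D)) τ (GKZ.facetsOfOrder A τ T s),
        ∑ σ ∈ GKZ.facetsOfOrder A τ T s, GKZ.normVol A σ ≤
          GKZ.cdim (GKZ.solutions A β p (GKZ.gevreySeries τ s)) := fun s β p hp =>
    GKZ.sum_normVol_le_cdim_solutions hD0
      (fun σ hσ => (Finset.mem_filter.1 (Finset.mem_filter.1 hσ).1).2)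
      (fun σ hσ h => GKZ.isConvergent_of_mem_commonDomain hD hT hp hσ h) β
  refine ⟨⟨GKZ.commonDomain_nonempty hT.1 subset_rfl (Real.exp_pos _),
    GKZ.exists_isOpen_commonDomain A _ τ _, fun β p hp => ?_⟩, fun s =>
    ⟨GKZ.commonDomain_nonempty hT.1 (Finset.filter_subset _ _) (Real.exp_pos _),
      GKZ.exists_isOpen_commonDomain A _ τ _, hGevrey s⟩⟩
  -- The formal case is the Gevrey case of order `d * D`, because Gevrey series are formal series.
  rw [← GKZ.facetsOfOrder_eq_facets hD τ T] at hp
  have h1 := hGevrey _ β p hp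
  rw [GKZ.facetsOfOrder_eq_facets hD, ← hT.2] at h1
  exact h1.trans (GKZ.cdim_mono (GKZ.solutions_mono A β p (GKZ.gevreySeries_le_formalSeries τ _)))
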